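/- Let $\Bbbk$ be a field of characteristic $0$ and let $H=(H,\mu,\eta,\Delta,\epsilon,S)$ be a finite-dimensional Hopf superalgebra over $\Bbbk$ (that is, $\mathbb Z_2$-graded, with all structure maps even, $\Delta$ and $\epsilon$ being superalgebra morphisms) whose antipode $S$ is invertible. Write $\Delta(a)=\sum a'\otimes a''$, $(\mathrm{id}\otimes\Delta)\Delta(a)=\sum a'\otimes a''\otimes a'''$; let $\tau(v\otimes w)=(-1)^{|v||w|}w\otimes v$ be the super flip, and let all tensor products of superalgebras carry the product $(a\otimes b)(c\otimes d)=(-1)^{|b||c|}ac\otimes bd$; signs are written for homogeneous elements. Let $\lambda:H^*\otimes H^*\to(H\otimes H)^*$, $\lambda(f\otimes g)(x\otimes y)=(-1)^{|g||x|}f(x)g(y)$, and let $X=(H^{op})^*$ be the Hopf superalgebra on the dual superspace $H^*$ with product $\Delta^*\circ\lambda$, unit $1_X=\epsilon$, coproduct $\lambda^{-1}\circ(\mu\circ\tau)^*$, counit $f\mapsto f(1_H)$ and antipode $(S^{-1})^*$. Define $\alpha:H\otimes X\to X$, $\alpha(a\otimes f)=a\cdot f$, and $\beta:H\otimes X\to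 H$, $\beta(a\otimes f)=a^f$, by \[ (a\cdot f)(x)=\sum(-1)^{|a||f|+|a'||a''|+|x||a'|}f\bigl(S^{-1}(a'')\,x\,a'\bigr),\qquad a^f=\sum(-1)^{|a||f|+|a'''|(|a''|+|a'|)}f\bigl(S^{-1}(a''')a'\bigr)\,a''. \] The quantum double $D(H)=X\bowtie H$ is the bicrossed product: the superspace $X\otimes H$ with unit $1_X\otimes 1_H$, product \[ (f\otimes a)(g\otimes b)=\sum(-1)^{|g'||a''|}\,f\,(a'\cdot g')\otimes(a'')^{g''}\,b, \] coproduct $\Delta(f\otimes a)=\sum(-1)^{|a'||f''|}(f'\otimes a')\otimes(f''\otimes a'')$, counit $f\otimes a\mapsto f(1_H)\epsilon(a)$, and antipode \[ f\otimes a\mapsto\sum(-1)^{|f'||f''|+|a'||a''|+|f'||a''|+|f''||a''|+|f'||a'|}\,S(a'')\cdot S_X(f'')\otimes S(a')^{S_X(f')}, \] where $\sum f'\otimes f''$ and $\sum g'\otimes g''$ denote the coproducts in $X$. Theorem. Let $\{e_i\}_{i\in I}$ be any basis of $H$, $\{e^i\}_{i\in I}$ the dual basis of $H^*$, and \[ R=\sum_{i\in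 I}(1_X\otimes e_i)\otimes(e^i\otimes 1_H)\in D(H)\otimes D(H). \] Then $(D(H),R)$ is a braided (quasitriangular) Hopf superalgebra: $D(H)$ with the above structure is a Hopf superalgebra with invertible antipode; $R$ is an even invertible element of the superalgebra $D(H)\otimes D(H)$ with $\tau(\Delta(x))=R\,\Delta(x)\,R^{-1}$ for all $x\in D(H)$; and \[ (\Delta\otimes\mathrm{id})(R)=R_{13}R_{23},\qquad (\mathrm{id}\otimes\Delta)(R)=R_{13}R_{12} \] in $D(H)^{\otimes 3}$, where $R_{12}=R\otimes 1$, $R_{23}=1\otimes R$ and $R_{13}=\sum_i s_i\otimes 1\otimes t_i$ for $R=\sum_i s_i\otimes t_i$. -/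

import Mathlib

open scoped TensorProduct

noncomputable section

universe u v w

/-- A `ℤ/2`-grading `V = V₀ ⊕ V₁` on a vector space, i.e. a structure of superspace. -/
structure SuperGrading (k : Type u) (V : Type v) [Field k] [AddCommGroup V] [Module k V] where
  deg : ZMod 2 → Submodule k V
  isCompl : IsCompl (deg 0) (deg 1)

/-- The sign `(-1)^(i j)` for `i j : ℤ/2`. -/
def koszulSign (k : Type u) [Field k] (i j : ZMod 2) : k := (-1) ^ (i.val * j.val)

namespace SuperGrading

variable {k : Type u} [Field k]
variable {V : Type v} [AddCommGroup V] [Module k V]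
variable {W : Type w} [AddCommGroup W] [Module k W]

theorem isCompl_add_one (G : SuperGrading k V) (i : ZMod 2) :
    IsCompl (G.deg i) (G.deg (i + 1)) := by
  fin_cases i
  · exact G.isCompl
  · exact G.isCompl.symm

/-- The projection of `V` onto its component of degree `i`, along the other component. -/
def proj (G : SuperGrading k V) (i : ZMod 2) : V →ₗ[k] V :=
  (G.deg i).projection (G.deg (i + 1)) (G.isCompl_add_one i)

theorem proj_mem (G : SuperGrading k V) (i : ZMod 2) (x : V) : G.proj i x ∈ G.deg i :=
  Submodule.projection_apply_mem _ x

theorem proj_of_mem (G : SuperGrading k V) {i : ZMod 2} {x : V} (hx : x ∈ G.deg i) (j : ZMod 2) :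
    G.proj j x = if j = i then x else 0 := by
  split_ifs with h
  · subst h
    exact Submodule.projection_apply_of_mem_left _ hx
  · have hj : i = j + 1 := by
      have key : ∀ a b : ZMod 2, ¬ b = a → a = b + 1 := by decide
      exact key i j h
    subst hj
    exact (Submodule.projection_apply_eq_zero_iff _).2 hx

theorem proj_zero_add_proj_one (G : SuperGrading k V) (x : V) : G.proj 0 x + G.proj 1 x = x :=
  Submodule.projection_add_projection_eq_self G.isCompl x

theorem isCompl_of_projections {A B : Submodule k V} (P Q : V →ₗ[k] V)
    (hPQ : ∀ x, P x + Q x = x) (hP : ∀ x, P x ∈ A) (hQ : ∀ x, Q x ∈ B)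
    (hPB : ∀ x ∈ B, P x = 0) (hQA : ∀ x ∈ A, Q x = 0) : IsCompl A B := by
  constructor
  · rw [Submodule.disjoint_def]
    intro x hA hB
    rw [← hPQ x, hPB x hB, hQA x hA, add_zero]
  · rw [codisjoint_iff, Submodule.eq_top_iff']
    intro x
    rw [← hPQ x]
    exact Submodule.add_mem_sup (hP x) (hQ x)

/-- The dual superspace: `(V*)ᵢ = (Vᵢ)*`, i.e. the functionals vanishing on the component of
the other degree. -/
def dual (G : SuperGrading k V) : SuperGrading k (Module.Dual k V) where
  deg i := (G.deg (i + 1)).dualAnnihilator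
  isCompl := by
    refine isCompl_of_projections (G.proj 0).dualMap (G.proj 1).dualMap ?_ ?_ ?_ ?_ ?_
    · intro f
      ext x
      simp [← map_add, proj_zero_add_proj_one]
    · intro f
      rw [Submodule.mem_dualAnnihilator]
      intro x hx
      simp [G.proj_of_mem hx]
    · intro f
      rw [Submodule.mem_dualAnnihilator]
      intro x hx
      have h : (1 : ZMod 2) ≠ 1 + 1 := by decide
      simp [G.proj_of_mem hx, h]
    · intro f hf
      rw [Submodule.mem_dualAnnihilator] at hf
      ext x
      have h : (1 : ZMod 2) + 1 = 0 := by decide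
      exact hf _ (by rw [h]; exact G.proj_mem 0 x)
    · intro f hf
      rw [Submodule.mem_dualAnnihilator] at hf
      ext x
      exact hf _ (by simpa using G.proj_mem 1 x)

/-- The tensor product of superspaces: `(V ⊗ W)ₙ = ⨁_{i + j = n} Vᵢ ⊗ Wⱼ`. -/
def tensor (G : SuperGrading k V) (G' : SuperGrading k W) : SuperGrading k (V ⊗[k] W) where
  deg n := ⨆ i : ZMod 2, Submodule.map₂ (TensorProduct.mk k V W) (G.deg i) (G'.deg (n - i))
  isCompl := by
    have key : ∀ n : ZMod 2, ∀ x, (∑ i : ZMod 2, TensorProduct.map (G.proj i) (G'.proj (n - i))) x ∈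
        ⨆ i : ZMod 2, Submodule.map₂ (TensorProduct.mk k V W) (G.deg i) (G'.deg (n - i)) := by
      intro n x
      rw [LinearMap.sum_apply]
      refine Submodule.sum_mem _ fun i _ => ?_
      refine Submodule.mem_iSup_of_mem i ?_
      induction x with
      | zero => simp
      | add x y hx hy => rw [map_add]; exact add_mem hx hy
      | tmul a b => exact Submodule.apply_mem_map₂ _ (G.proj_mem i a) (G'.proj_mem _ b)
    have key' : ∀ n m : ZMod 2, n ≠ m → ∀ x ∈
        (⨆ i : ZMod 2, Submodule.map₂ (TensorProduct.mk k V W) (G.deg i) (G'.deg (m - i))),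
        (∑ i : ZMod 2, TensorProduct.map (G.proj i) (G'.proj (n - i))) x = 0 := by
      intro n m hnm x hx
      suffices hle : (⨆ i : ZMod 2, Submodule.map₂ (TensorProduct.mk k V W) (G.deg i)
          (G'.deg (m - i))) ≤ LinearMap.ker
            (∑ i : ZMod 2, TensorProduct.map (G.proj i) (G'.proj (n - i))) from hle hx
      refine iSup_le fun j => Submodule.map₂_le.2 fun a ha b hb => ?_
      rw [LinearMap.mem_ker, LinearMap.sum_apply]
      refine Finset.sum_eq_zero fun i _ => ?_
      rw [TensorProduct.mk_apply, TensorProduct.map_tmul, G.proj_of_mem ha, G'.proj_of_mem hb]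
      by_cases hij : i = j
      · subst hij
        simp [hnm]
      · simp [hij]
    refine isCompl_of_projections _ _ ?_ (key 0) (key 1) (key' 0 1 (by decide))
      (key' 1 0 (by decide))
    intro x
    induction x with
    | zero => simp
    | add x y hx hy => rw [map_add, map_add, add_add_add_comm, hx, hy]
    | tmul a b =>
      have e : ∀ f : ZMod 2 → (V ⊗[k] W), ∑ i, f i = f 0 + f 1 := fun f => Fin.sum_univ_two f
      have h1 : (0 : ZMod 2) - 1 = 1 := by decide
      conv_rhs => rw [← G.proj_zero_add_proj_one a, ← G'.proj_zero_add_proj_one b]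
      simp only [LinearMap.sum_apply, e, TensorProduct.map_tmul, sub_zero, sub_self, h1,
        TensorProduct.tmul_add, TensorProduct.add_tmul]
      abel

/-- The linear map `v ⊗ w ↦ (-1)^(|v| |w|) v ⊗ w`. -/
def signMap (G : SuperGrading k V) (G' : SuperGrading k W) : V ⊗[k] W →ₗ[k] V ⊗[k] W :=
  ∑ i : ZMod 2, ∑ j : ZMod 2, koszulSign k i j • TensorProduct.map (G.proj i) (G'.proj j)

theorem signMap_tmul (G : SuperGrading k V) (G' : SuperGrading k W) {i j : ZMod 2} {x : V} {y : W}
    (hx : x ∈ G.deg i) (hy : y ∈ G'.deg j) :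
    G.signMap G' (x ⊗ₜ y) = koszulSign k i j • (x ⊗ₜ y) := by
  simp only [signMap, LinearMap.sum_apply, LinearMap.smul_apply, TensorProduct.map_tmul,
    G.proj_of_mem hx, G'.proj_of_mem hy]
  rw [Finset.sum_eq_single i, Finset.sum_eq_single j]
  · simp
  · intro b _ hb
    simp [hb]
  · simp
  · intro b _ hb
    simp [hb]
  · simp

theorem signMap_signMap (G : SuperGrading k V) (G' : SuperGrading k W) :
    G.signMap G' ∘ₗ G.signMap G' = LinearMap.id := by
  have hs : ∀ i j : ZMod 2, koszulSign k i j * koszulSign k i j = 1 := by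
    intro i j
    rw [koszulSign, ← mul_pow]
    simp
  ext a b
  have h : ∀ i j : ZMod 2, G.signMap G' (G.signMap G' (G.proj i a ⊗ₜ G'.proj j b)) =
      G.proj i a ⊗ₜ G'.proj j b := by
    intro i j
    rw [signMap_tmul G G' (G.proj_mem i a) (G'.proj_mem j b), map_smul,
      signMap_tmul G G' (G.proj_mem i a) (G'.proj_mem j b), smul_smul, hs, one_smul]
  change G.signMap G' (G.signMap G' (a ⊗ₜ b)) = a ⊗ₜ b
  rw [← G.proj_zero_add_proj_one a, ← G'.proj_zero_add_proj_one b]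
  simp only [TensorProduct.tmul_add, TensorProduct.add_tmul, map_add, h]

def signEquiv (G : SuperGrading k V) (G' : SuperGrading k W) : V ⊗[k] W ≃ₗ[k] V ⊗[k] W :=
  LinearEquiv.ofLinearMap (G.signMap G') (G.signMap G') (signMap_signMap G G') (signMap_signMap G G')

/-- The flip `τ : V ⊗ W → W ⊗ V`, `v ⊗ w ↦ (-1)^(|v| |w|) w ⊗ v`. -/
def flip (G : SuperGrading k V) (G' : SuperGrading k W) : V ⊗[k] W →ₗ[k] W ⊗[k] V :=
  (TensorProduct.comm k V W).toLinearMap ∘ₗ G.signMap G'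

theorem flip_tmul (G : SuperGrading k V) (G' : SuperGrading k W) {i j : ZMod 2} {x : V} {y : W}
    (hx : x ∈ G.deg i) (hy : y ∈ G'.deg j) :
    G.flip G' (x ⊗ₜ y) = koszulSign k i j • (y ⊗ₜ x) := by
  simp [flip, signMap_tmul G G' hx hy]

/-- The isomorphism `λ : V* ⊗ W* → (V ⊗ W)*` of finite-dimensional superspaces, given by
`λ (f ⊗ g) (v ⊗ w) = (-1)^(|g| |v|) f v * g w`; see `dualDistrib_apply`. -/
def dualDistrib (G : SuperGrading k V) (G' : SuperGrading k W)
    [FiniteDimensional k V] [FiniteDimensional k W] :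
    Module.Dual k V ⊗[k] Module.Dual k W ≃ₗ[k] Module.Dual k (V ⊗[k] W) :=
  TensorProduct.dualDistribEquiv k V W ≪≫ₗ (G.signEquiv G').dualMap

theorem dualDistrib_apply (G : SuperGrading k V) (G' : SuperGrading k W)
    [FiniteDimensional k V] [FiniteDimensional k W] {i j : ZMod 2}
    (f : Module.Dual k V) {g : Module.Dual k W} (hg : g ∈ G'.dual.deg j)
    {x : V} (hx : x ∈ G.deg i) (y : W) :
    G.dualDistrib G' (f ⊗ₜ g) (x ⊗ₜ y) = koszulSign k j i * (f x * g y) := by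
  have hs : koszulSign k j i = koszulSign k i j := by rw [koszulSign, koszulSign, mul_comm]
  have hd : ∀ z : V ⊗[k] W, G.dualDistrib G' (f ⊗ₜ g) z =
      TensorProduct.dualDistrib k V W (f ⊗ₜ g) (G.signMap G' z) := fun z => rfl
  have hg' : ∀ y ∈ G'.deg (j + 1), g y = 0 := (Submodule.mem_dualAnnihilator g).1 hg
  have hy : y = G'.proj j y + G'.proj (j + 1) y :=
    (Submodule.projection_add_projection_eq_self (G'.isCompl_add_one j) y).symm.trans (by
      congr 1
      fin_cases j <;> rfl)
  rw [hd, hy, TensorProduct.tmul_add, map_add, signMap_tmul G G' hx (G'.proj_mem j y),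
    signMap_tmul G G' hx (G'.proj_mem (j + 1) y), hs]
  simp [hg' _ (G'.proj_mem (j + 1) y)]

end SuperGrading

section Reorder

variable {k : Type u} [Field k]
variable {A B C D : Type*} [AddCommGroup A] [Module k A] [AddCommGroup B] [Module k B]
  [AddCommGroup C] [Module k C] [AddCommGroup D] [Module k D]

/-- Apply a map to the two middle factors:
`(a ⊗ b) ⊗ (c ⊗ d) ↦ (a ⊗ c') ⊗ (b' ⊗ d)`, where `φ (b ⊗ c) = c' ⊗ b'`. -/
def midMap {C' B' : Type*} [AddCommGroup C'] [Module k C'] [AddCommGroup B'] [Module k B']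
    (φ : B ⊗[k] C →ₗ[k] C' ⊗[k] B') :
    (A ⊗[k] B) ⊗[k] (C ⊗[k] D) →ₗ[k] (A ⊗[k] C') ⊗[k] (B' ⊗[k] D) :=
  (TensorProduct.assoc k A C' (B' ⊗[k] D)).symm.toLinearMap ∘ₗ
    LinearMap.lTensor A
      ((TensorProduct.assoc k C' B' D).toLinearMap ∘ₗ LinearMap.rTensor D φ ∘ₗ
        (TensorProduct.assoc k B C D).symm.toLinearMap) ∘ₗ
    (TensorProduct.assoc k A B (C ⊗[k] D)).toLinearMap

end Reorder

/-- The data of a Hopf superalgebra on a vector space `V`: a `ℤ/2`-grading, a product, a unit,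
a coproduct, a counit and an antipode. The axioms are in `HopfSuperData.IsHopfSuperalgebra`. -/
structure HopfSuperData (k : Type u) (V : Type v) [Field k] [AddCommGroup V] [Module k V] where
  gr : SuperGrading k V
  mul : V ⊗[k] V →ₗ[k] V
  one : V
  comul : V →ₗ[k] V ⊗[k] V
  counit : V →ₗ[k] k
  antipode : V →ₗ[k] V

namespace HopfSuperData

variable {k : Type u} [Field k]
variable {V : Type v} [AddCommGroup V] [Module k V]
variable {W : Type w} [AddCommGroup W] [Module k W]

/-- The tensor product, with `(a ⊗ b) (c ⊗ d) = (-1)^(|b| |c|) a c ⊗ b d` and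
`Δ (a ⊗ b) = ∑ (-1)^(|a''| |b'|) (a' ⊗ b') ⊗ (a'' ⊗ b'')`. -/
def tensor (H : HopfSuperData k V) (G : HopfSuperData k W) : HopfSuperData k (V ⊗[k] W) where
  gr := H.gr.tensor G.gr
  mul := TensorProduct.map H.mul G.mul ∘ₗ midMap (G.gr.flip H.gr)
  one := H.one ⊗ₜ G.one
  comul := midMap (H.gr.flip G.gr) ∘ₗ TensorProduct.map H.comul G.comul
  counit := (TensorProduct.lid k k).toLinearMap ∘ₗ TensorProduct.map H.counit G.counit
  antipode := TensorProduct.map H.antipode G.antipode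

/-- `(V, mul, one)` is an associative unital superalgebra. -/
structure IsSuperalgebra (H : HopfSuperData k V) : Prop where
  mul_mem : ∀ (i j : ZMod 2), ∀ x ∈ H.gr.deg i, ∀ y ∈ H.gr.deg j,
    H.mul (x ⊗ₜ y) ∈ H.gr.deg (i + j)
  one_mem : H.one ∈ H.gr.deg 0
  mul_assoc : ∀ x y z : V, H.mul (H.mul (x ⊗ₜ y) ⊗ₜ z) = H.mul (x ⊗ₜ H.mul (y ⊗ₜ z))
  one_mul : ∀ x : V, H.mul (H.one ⊗ₜ x) = x
  mul_one : ∀ x : V, H.mul (x ⊗ₜ H.one) = x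

/-- `(V, comul, counit)` is a coassociative counital supercoalgebra. -/
structure IsSupercoalgebra (H : HopfSuperData k V) : Prop where
  comul_mem : ∀ (i : ZMod 2), ∀ x ∈ H.gr.deg i, H.comul x ∈ (H.gr.tensor H.gr).deg i
  counit_odd : ∀ x ∈ H.gr.deg 1, H.counit x = 0
  coassoc : (TensorProduct.assoc k V V V).toLinearMap ∘ₗ LinearMap.rTensor V H.comul ∘ₗ H.comul =
    LinearMap.lTensor V H.comul ∘ₗ H.comul
  counit_left : ∀ x : V, TensorProduct.lid k V (LinearMap.rTensor V H.counit (H.comul x)) = x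
  counit_right : ∀ x : V, TensorProduct.rid k V (LinearMap.lTensor V H.counit (H.comul x)) = x

/-- A superalgebra and supercoalgebra such that the coproduct and the counit are morphisms of
superalgebras, where `V ⊗ V` carries the product with signs. -/
structure IsSuperbialgebra (H : HopfSuperData k V) : Prop extends
    H.IsSuperalgebra, H.IsSupercoalgebra where
  comul_mul : ∀ x y : V,
    H.comul (H.mul (x ⊗ₜ y)) = (H.tensor H).mul (H.comul x ⊗ₜ H.comul y)
  comul_one : H.comul H.one = H.one ⊗ₜ H.one
  counit_mul : ∀ x y : V, H.counit (H.mul (x ⊗ₜ y)) = H.counit x * H.counit y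
  counit_one : H.counit H.one = 1

/-- A superbialgebra whose antipode is an even map satisfying
`∑ S(x') x'' = ε(x) 1 = ∑ x' S(x'')`. -/
structure IsHopfSuperalgebra (H : HopfSuperData k V) : Prop extends H.IsSuperbialgebra where
  antipode_mem : ∀ (i : ZMod 2), ∀ x ∈ H.gr.deg i, H.antipode x ∈ H.gr.deg i
  antipode_left : ∀ x : V,
    H.mul (LinearMap.rTensor V H.antipode (H.comul x)) = H.counit x • H.one
  antipode_right : ∀ x : V,
    H.mul (LinearMap.lTensor V H.antipode (H.comul x)) = H.counit x • H.one

/-- The inverse of a bijective antipode. -/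
def antipodeInv (H : HopfSuperData k V) (hS : Function.Bijective H.antipode) : V →ₗ[k] V :=
  (LinearEquiv.ofBijective H.antipode hS).symm.toLinearMap

/-- The opposite Hopf superalgebra `H^op`, with product `x ⊗ y ↦ (-1)^(|x| |y|) y x` and
antipode `S⁻¹`. -/
def op (H : HopfSuperData k V) (hS : Function.Bijective H.antipode) : HopfSuperData k V where
  gr := H.gr
  mul := H.mul ∘ₗ H.gr.flip H.gr
  one := H.one
  comul := H.comul
  counit := H.counit
  antipode := H.antipodeInv hS

/-- The dual Hopf superalgebra `H^*` of a finite-dimensional Hopf superalgebra, with product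
`Δ^* ∘ λ`, unit `ε`, coproduct `λ⁻¹ ∘ μ^*`, counit `f ↦ f 1` and antipode `S^*`. -/
def dual [FiniteDimensional k V] (H : HopfSuperData k V) :
    HopfSuperData k (Module.Dual k V) where
  gr := H.gr.dual
  mul := H.comul.dualMap ∘ₗ (H.gr.dualDistrib H.gr).toLinearMap
  one := H.counit
  comul := (H.gr.dualDistrib H.gr).symm.toLinearMap ∘ₗ H.mul.dualMap
  counit := Module.Dual.eval k V H.one
  antipode := H.antipode.dualMap

/-- The bicrossed product structure on `X ⊗ A` determined by maps `α : A ⊗ X → X`,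
`a ⊗ x ↦ a · x`, and `β : A ⊗ X → A`, `a ⊗ x ↦ a ^ x`:
* `(x ⊗ a) (y ⊗ b) = ∑ (-1)^(|a''| |y'|) x (a' · y') ⊗ (a'' ^ y'') b`;
* the unit, the coproduct and the counit are those of the tensor product;
* `S (x ⊗ a) = ∑ ± (S a'' · S x'') ⊗ (S a' ^ S x')`, where the sign is the Koszul sign of the
  permutation from `x' x'' a' a''` to `a'' x'' a' x'`. -/
def bicrossed (X : HopfSuperData k V) (A : HopfSuperData k W)
    (α : W ⊗[k] V →ₗ[k] V) (β : W ⊗[k] V →ₗ[k] W) : HopfSuperData k (V ⊗[k] W) where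
  gr := X.gr.tensor A.gr
  mul := TensorProduct.map X.mul A.mul ∘ₗ
    midMap (TensorProduct.map α β ∘ₗ (A.tensor X).comul)
  one := X.one ⊗ₜ A.one
  comul := (X.tensor A).comul
  counit := (X.tensor A).counit
  antipode := TensorProduct.map α β ∘ₗ
    TensorProduct.map (X.gr.flip A.gr) (X.gr.flip A.gr) ∘ₗ
    midMap (X.gr.flip A.gr) ∘ₗ
    TensorProduct.map (X.gr.flip X.gr) (A.gr.flip A.gr) ∘ₗ
    TensorProduct.map (TensorProduct.map X.antipode X.antipode)
      (TensorProduct.map A.antipode A.antipode) ∘ₗ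
    TensorProduct.map X.comul A.comul

section Double

variable (H : HopfSuperData k V) (hS : Function.Bijective H.antipode)

/-- `a ⊗ x ↦ ∑ (-1)^(|a'| |a''| + |a'| |x|) S⁻¹(a'') x a'`. -/
def conjAction : V ⊗[k] V →ₗ[k] V :=
  H.mul ∘ₗ LinearMap.rTensor V H.mul ∘ₗ
    LinearMap.rTensor V (LinearMap.rTensor V (H.antipodeInv hS)) ∘ₗ
    (TensorProduct.assoc k V V V).symm.toLinearMap ∘ₗ
    LinearMap.lTensor V (H.gr.flip H.gr) ∘ₗ
    (TensorProduct.assoc k V V V).toLinearMap ∘ₗ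
    LinearMap.rTensor V (H.gr.flip H.gr) ∘ₗ
    LinearMap.rTensor V H.comul

/-- `α : H ⊗ H^* → H^*`,
`α (a ⊗ f) (x) = ∑ (-1)^(|a| |f| + |a'| |a''| + |x| |a'|) f (S⁻¹(a'') x a')`. -/
def doubleLeftAction : V ⊗[k] Module.Dual k V →ₗ[k] Module.Dual k V :=
  TensorProduct.lift
    (LinearMap.lcomp k (Module.Dual k V) (TensorProduct.curry (H.conjAction hS)) ∘ₗ
      LinearMap.llcomp k V V k) ∘ₗ
    H.gr.flip H.gr.dual

/-- `a ↦ ∑ (-1)^(|a'''| (|a'| + |a''|)) S⁻¹(a''') a' ⊗ a''`. -/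
def conjCoaction : V →ₗ[k] V ⊗[k] V :=
  LinearMap.rTensor V H.mul ∘ₗ
    LinearMap.rTensor V (LinearMap.rTensor V (H.antipodeInv hS)) ∘ₗ
    (TensorProduct.assoc k V V V).symm.toLinearMap ∘ₗ
    (H.gr.tensor H.gr).flip H.gr ∘ₗ
    (TensorProduct.assoc k V V V).symm.toLinearMap ∘ₗ
    LinearMap.lTensor V H.comul ∘ₗ H.comul

/-- `β : H ⊗ H^* → H`,
`β (a ⊗ f) = ∑ (-1)^(|a| |f| + |a'''| (|a''| + |a'|)) f (S⁻¹(a''') a') a''`. -/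
def doubleRightAction : V ⊗[k] Module.Dual k V →ₗ[k] V :=
  (TensorProduct.lid k V).toLinearMap ∘ₗ
    LinearMap.rTensor V (contractLeft k V) ∘ₗ
    (TensorProduct.assoc k (Module.Dual k V) V V).symm.toLinearMap ∘ₗ
    LinearMap.lTensor (Module.Dual k V) (H.conjCoaction hS) ∘ₗ
    H.gr.flip H.gr.dual

/-- The quantum double `D(H) = (H^op)^* ⋈ H`. -/
def quantumDouble [FiniteDimensional k V] : HopfSuperData k (Module.Dual k V ⊗[k] V) :=
  (H.op hS).dual.bicrossed H (H.doubleLeftAction hS) (H.doubleRightAction hS)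

end Double

section Braided

variable (D : HopfSuperData k V) (R : V ⊗[k] V)

/-- The opposite coproduct `Δ^op = τ ∘ Δ`. -/
def comulOp : V →ₗ[k] V ⊗[k] V := D.gr.flip D.gr ∘ₗ D.comul

/-- `R₁₂ = R ⊗ 1`. -/
def leg12 : (V ⊗[k] V) ⊗[k] V := R ⊗ₜ D.one

/-- `R₂₃ = 1 ⊗ R`. -/
def leg23 : (V ⊗[k] V) ⊗[k] V := (TensorProduct.assoc k V V V).symm (D.one ⊗ₜ R)

/-- `R₁₃ = ∑ sᵢ ⊗ 1 ⊗ tᵢ` for `R = ∑ sᵢ ⊗ tᵢ`. -/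
def leg13 : (V ⊗[k] V) ⊗[k] V :=
  LinearMap.rTensor V ((TensorProduct.mk k V V).flip D.one) R

/-- `R` is a universal R-matrix for `D`: an invertible even element of the superalgebra `D ⊗ D`
with `Δ^op(x) = R Δ(x) R⁻¹` for all `x`. -/
def IsUniversalRMatrix : Prop :=
  R ∈ (D.gr.tensor D.gr).deg 0 ∧
  ∃ R' : V ⊗[k] V,
    (D.tensor D).mul (R ⊗ₜ R') = (D.tensor D).one ∧
    (D.tensor D).mul (R' ⊗ₜ R) = (D.tensor D).one ∧
    ∀ x : V, D.comulOp x = (D.tensor D).mul ((D.tensor D).mul (R ⊗ₜ D.comul x) ⊗ₜ R')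

/-- `(D, R)` is a braided (quasitriangular) Hopf superalgebra: a Hopf superalgebra with invertible
antipode and a universal R-matrix `R` such that `(Δ ⊗ id)(R) = R₁₃ R₂₃` and
`(id ⊗ Δ)(R) = R₁₃ R₁₂` in the superalgebra `D ⊗ D ⊗ D`. -/
structure IsBraided : Prop where
  isHopfSuperalgebra : D.IsHopfSuperalgebra
  antipode_bijective : Function.Bijective D.antipode
  isUniversalRMatrix : D.IsUniversalRMatrix R
  comul_left : LinearMap.rTensor V D.comul R =
    ((D.tensor D).tensor D).mul (D.leg13 R ⊗ₜ D.leg23 R)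
  comul_right : (TensorProduct.assoc k V V V).symm (LinearMap.lTensor V D.comul R) =
    ((D.tensor D).tensor D).mul (D.leg13 R ⊗ₜ D.leg12 R)

end Braided

end HopfSuperData

end

open scoped TensorProduct

/-! Write X = (H^op)^*. The evaluation ⟨x, f⟩ = (-1)^(|x||f|) f(x) is a skew pairing φ of H and X:
⟨x, fg⟩ splits through Δ(x), ⟨xy, f⟩ splits through the coproduct of f with x and y in reversed
order, and φ has the convolution inverse φ'(x ⊗ f) = ⟨S⁻¹x, f⟩. An invertible functional acts on the
linear maps of a coalgebra by conjugation f ↦ φ * f * φ', and a conjugate of a coalgebra morphism is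
again a coalgebra morphism (`IsConvInverse.isCoalgHom_conj`).

The link with the given formulas is that α and β are the conjugates by φ of the two projections of H
⊗ X (`doubleLeftAction_eq`, `doubleRightAction_eq`). Hence the exchange map a ⊗ f ↦ ∑ ± a'·f' ⊗
a''^f'' equals φ * τ * φ', and the product of D(H) is the product of the superalgebra X ⊗ H
conjugated by σ((f ⊗ a) ⊗ (g ⊗ b)) = ε(f) φ(a, g) ε(b). The coalgebra X ⊗ H is unchanged, so
compatibility of product and coproduct is automatic. Associativity is the 2-cocycle identity for σ,
a formal consequence of the two multiplicativity rules of φ (`IsSkewPairing.cocycle`). Both X and H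
embed in D(H) as algebras and coalgebras, and the identity of D(H) is the convolution product of the
projections to X and to H. Its convolution inverse is the product of the two antipodes in the other
order, which is the stated antipode (`IsSkewPairing.isHopfSuperalgebra_double`, `quantumDouble_eq`);
it is bijective because the exchange map is.

Let c = ∑ eᵢ ⊗ eⁱ, the tensor that represents the identity maps of H and of H^*, and let F and G be
the inclusions of H and X in D(H), so that R = (F ⊗ G)(c). By finite dimension, an element of M ⊗
H^* or of H ⊗ M is known from its evaluations, and evaluation turns products into convolution
products. This gives R⁻¹ = (F S ⊗ G)(c), and it reduces the two coproduct formulas for R to the fact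
that F and G are coalgebra morphisms. The relation R Δ(x) = Δ^op(x) R, for x in H as well as for x
in X, becomes the single exchange relation ∑ ± ⟨a', f'⟩ f'' a'' = ∑ ± a' f' ⟨a'', f''⟩, which is the
definition of the exchange map multiplied by φ on the right. The elements x satisfying the relation
are closed under products, hence exhaust D(H). -/

noncomputable section

/-- The sign `(-1)^i` for `i : ℤ/2`. -/
def paritySign (k : Type*) [Field k] (i : ZMod 2) : k := (-1) ^ i.val

theorem ZMod.two_eq_or : ∀ i : ZMod 2, i = 0 ∨ i = 1 := by decide

/-! ### Signs as characters of ℤ/2. -/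

section Sign

variable {k : Type*} [Field k]

theorem koszulSign_eq_paritySign (i j : ZMod 2) : koszulSign k i j = paritySign k (i * j) := by
  rcases ZMod.two_eq_or i with rfl | rfl <;> rcases ZMod.two_eq_or j with rfl | rfl <;>
    simp [koszulSign, paritySign, ZMod.val_one]

theorem paritySign_mul (i j : ZMod 2) :
    paritySign k i * paritySign k j = paritySign k (i + j) := by
  have h : (1 : ZMod 2) + 1 = 0 := by decide
  rcases ZMod.two_eq_or i with rfl | rfl <;> rcases ZMod.two_eq_or j with rfl | rfl <;>
    simp [paritySign, ZMod.val_one, h]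

@[simp]
theorem paritySign_zero : paritySign k 0 = 1 := by simp [paritySign]

end Sign

/-! ### Superspaces: homogeneous tensors, even maps and the super flip. -/

namespace SuperGrading

variable {k : Type*} [Field k]
variable {A : Type*} [AddCommGroup A] [Module k A]
variable {B : Type*} [AddCommGroup B] [Module k B]
variable {C : Type*} [AddCommGroup C] [Module k C]
variable {D : Type*} [AddCommGroup D] [Module k D]
variable {E : Type*} [AddCommGroup E] [Module k E]
variable {F : Type*} [AddCommGroup F] [Module k F]
variable {M : Type*} [AddCommGroup M] [Module k M]
variable (GA : SuperGrading k A) (GB : SuperGrading k B) (GC : SuperGrading k C)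
  (GD : SuperGrading k D) (GE : SuperGrading k E) (GF : SuperGrading k F) (GM : SuperGrading k M)

variable {GA GB} in
/-- A linear map of superspaces which preserves degrees. -/
def IsEven (GA : SuperGrading k A) (GB : SuperGrading k B) (f : A →ₗ[k] B) : Prop :=
  ∀ i, ∀ x ∈ GA.deg i, f x ∈ GB.deg i

/-- The ground field as a superspace of degree zero. -/
def scalar (k : Type*) [Field k] : SuperGrading k k where
  deg i := if i = 0 then ⊤ else ⊥
  isCompl := by simpa using isCompl_top_bot

@[simp]
theorem proj_proj (i j : ZMod 2) (x : A) :
    GA.proj i (GA.proj j x) = if i = j then GA.proj j x else 0 :=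
  GA.proj_of_mem (GA.proj_mem j x) i

variable {GA} in
theorem proj_eq_self {i : ZMod 2} {x : A} (hx : x ∈ GA.deg i) : GA.proj i x = x := by
  simp [GA.proj_of_mem hx]

/-- Homogeneous vectors span, so an identity with Koszul signs only has to be checked on tensors of
projections, where each flip is an explicit scalar. The versions with several factors follow by
currying; nearly all sign checks below have this shape. -/
theorem hom_ext {f g : A →ₗ[k] M} (h : ∀ i x, f (GA.proj i x) = g (GA.proj i x)) : f = g := by
  ext x
  rw [← GA.proj_zero_add_proj_one x, map_add, map_add, h, h]

theorem hom_ext₂ {f g : A ⊗[k] B →ₗ[k] M}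
    (h : ∀ i x j y, f (GA.proj i x ⊗ₜ GB.proj j y) = g (GA.proj i x ⊗ₜ GB.proj j y)) : f = g := by
  refine TensorProduct.ext (GA.hom_ext fun i x => GB.hom_ext fun j y => ?_)
  exact h i x j y

theorem hom_ext₃ {f g : (A ⊗[k] B) ⊗[k] C →ₗ[k] M}
    (h : ∀ i x j y l z, f ((GA.proj i x ⊗ₜ GB.proj j y) ⊗ₜ GC.proj l z) =
      g ((GA.proj i x ⊗ₜ GB.proj j y) ⊗ₜ GC.proj l z)) : f = g := by
  refine TensorProduct.ext (hom_ext₂ GA GB fun i x j y => GC.hom_ext fun l z => ?_)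
  exact h i x j y l z

theorem hom_ext₃' {f g : A ⊗[k] (B ⊗[k] C) →ₗ[k] M}
    (h : ∀ i x j y l z, f (GA.proj i x ⊗ₜ (GB.proj j y ⊗ₜ GC.proj l z)) =
      g (GA.proj i x ⊗ₜ (GB.proj j y ⊗ₜ GC.proj l z))) : f = g := by
  refine TensorProduct.ext (GA.hom_ext fun i x => hom_ext₂ GB GC fun j y l z => ?_)
  exact h i x j y l z

theorem hom_ext₄ {f g : (A ⊗[k] B) ⊗[k] (C ⊗[k] D) →ₗ[k] M}
    (h : ∀ i x j y l z m w,
      f ((GA.proj i x ⊗ₜ GB.proj j y) ⊗ₜ (GC.proj l z ⊗ₜ GD.proj m w)) =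
      g ((GA.proj i x ⊗ₜ GB.proj j y) ⊗ₜ (GC.proj l z ⊗ₜ GD.proj m w))) : f = g := by
  refine TensorProduct.ext (hom_ext₂ GA GB fun i x j y => hom_ext₂ GC GD fun l z m w => ?_)
  exact h i x j y l z m w

theorem hom_ext₆ {f g : ((A ⊗[k] B) ⊗[k] C) ⊗[k] ((D ⊗[k] E) ⊗[k] F) →ₗ[k] M}
    (h : ∀ i x j y l z i' x' j' y' l' z',
      f (((GA.proj i x ⊗ₜ GB.proj j y) ⊗ₜ GC.proj l z) ⊗ₜ
        ((GD.proj i' x' ⊗ₜ GE.proj j' y') ⊗ₜ GF.proj l' z')) =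
      g (((GA.proj i x ⊗ₜ GB.proj j y) ⊗ₜ GC.proj l z) ⊗ₜ
        ((GD.proj i' x' ⊗ₜ GE.proj j' y') ⊗ₜ GF.proj l' z'))) : f = g := by
  refine TensorProduct.ext (hom_ext₃ GA GB GC fun i x j y l z =>
    hom_ext₃ GD GE GF fun i' x' j' y' l' z' => ?_)
  exact h i x j y l z i' x' j' y' l' z'

variable {GA GB GC GD} in
theorem tmul_mem {i j : ZMod 2} {x : A} {y : B} (hx : x ∈ GA.deg i) (hy : y ∈ GB.deg j) :
    x ⊗ₜ[k] y ∈ (GA.tensor GB).deg (i + j) := by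
  refine Submodule.mem_iSup_of_mem i ?_
  rw [add_sub_cancel_left]
  exact Submodule.apply_mem_map₂ _ hx hy

theorem tensor_deg_le {n : ZMod 2} {P : Submodule k (A ⊗[k] B)}
    (h : ∀ i x j y, i + j = n → GA.proj i x ⊗ₜ[k] GB.proj j y ∈ P) :
    (GA.tensor GB).deg n ≤ P := by
  refine iSup_le fun i => Submodule.map₂_le.2 fun a ha b hb => ?_
  have := h i a (n - i) b (by ring)
  rwa [proj_eq_self ha, proj_eq_self hb] at this

/-- Meant for elements such as a coproduct Δ(f), which is not a single homogeneous tensor: its total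
degree alone allows it to be replaced by homogeneous tensors with i + j = n. -/
theorem eqOn_deg {n : ZMod 2} (f g : A ⊗[k] B →ₗ[k] M)
    (h : ∀ i x j y, i + j = n → f (GA.proj i x ⊗ₜ GB.proj j y) = g (GA.proj i x ⊗ₜ GB.proj j y))
    {t : A ⊗[k] B} (ht : t ∈ (GA.tensor GB).deg n) : f t = g t := by
  have : (GA.tensor GB).deg n ≤ LinearMap.ker (f - g) :=
    tensor_deg_le GA GB fun i x j y hij => sub_eq_zero.2 (h i x j y hij)
  exact sub_eq_zero.1 (this ht)

namespace IsEven

variable {GA GB GC GD GM}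

theorem map_proj {f : A →ₗ[k] B} (hf : IsEven GA GB f) (i : ZMod 2) (x : A) :
    f (GA.proj i x) = GB.proj i (f x) := by
  conv_rhs => rw [← GA.proj_zero_add_proj_one x]
  simp only [map_add, GB.proj_of_mem (hf _ _ (GA.proj_mem _ x))]
  rcases ZMod.two_eq_or i with rfl | rfl <;> simp

theorem id : IsEven GA GA LinearMap.id := fun _ _ h => h

theorem comp {f : A →ₗ[k] B} {g : B →ₗ[k] C} (hg : IsEven GB GC g) (hf : IsEven GA GB f) :
    IsEven GA GC (g ∘ₗ f) := fun i x hx => hg i _ (hf i x hx)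

theorem of_tmul {f : A ⊗[k] B →ₗ[k] M}
    (h : ∀ i x j y, f (GA.proj i x ⊗ₜ GB.proj j y) ∈ GM.deg (i + j)) :
    IsEven (GA.tensor GB) GM f := by
  intro n
  refine (tensor_deg_le GA GB (P := (GM.deg n).comap f) fun i x j y hij => ?_)
  subst hij
  exact h i x j y

theorem map {f : A →ₗ[k] B} {g : C →ₗ[k] D} (hf : IsEven GA GB f) (hg : IsEven GC GD g) :
    IsEven (GA.tensor GC) (GB.tensor GD) (TensorProduct.map f g) :=
  of_tmul fun i x j y => tmul_mem (hf _ _ (GA.proj_mem i x)) (hg _ _ (GC.proj_mem j y))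

theorem rTensor {f : A →ₗ[k] B} (hf : IsEven GA GB f) :
    IsEven (GA.tensor GC) (GB.tensor GC) (LinearMap.rTensor C f) := hf.map id

theorem lTensor {f : A →ₗ[k] B} (hf : IsEven GA GB f) :
    IsEven (GC.tensor GA) (GC.tensor GB) (LinearMap.lTensor C f) := (id (GA := GC)).map hf

theorem symm {f : A ≃ₗ[k] B} (hf : IsEven GA GB f.toLinearMap) :
    IsEven GB GA f.symm.toLinearMap := by
  intro i x hx
  have h1 := hf.map_proj i (f.symm x)
  have h2 : GB.proj i x = x := proj_eq_self hx
  have h3 : f (GA.proj i (f.symm x)) = x := by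
    simpa [h2] using h1
  have : f.symm x = GA.proj i (f.symm x) := by
    rw [LinearEquiv.symm_apply_eq, h3]
  change f.symm x ∈ _
  rw [this]
  exact GA.proj_mem _ _

theorem assoc : IsEven ((GA.tensor GB).tensor GC) (GA.tensor (GB.tensor GC))
    (TensorProduct.assoc k A B C).toLinearMap := by
  intro n
  suffices h : ((GA.tensor GB).tensor GC).deg n ≤ ((GA.tensor (GB.tensor GC)).deg n).comap
      (TensorProduct.assoc k A B C).toLinearMap from h
  refine iSup_le fun i => Submodule.map₂_le.2 fun a ha c hc => ?_
  have : (GA.tensor GB).deg i ≤ ((GA.tensor (GB.tensor GC)).deg n).comap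
      ((TensorProduct.assoc k A B C).toLinearMap ∘ₗ (TensorProduct.mk k _ _).flip c) := by
    refine tensor_deg_le GA GB fun p x q y h => ?_
    have := tmul_mem (GA.proj_mem p x) (tmul_mem (GB.proj_mem q y) hc)
    have e : p + (q + (n - i)) = n := by rw [← h]; ring
    rw [e] at this
    exact this
  exact this ha

theorem assoc_symm : IsEven (GA.tensor (GB.tensor GC)) ((GA.tensor GB).tensor GC)
    (TensorProduct.assoc k A B C).symm.toLinearMap := assoc.symm

end IsEven

@[simp]
theorem flip_proj (i j : ZMod 2) (x : A) (y : B) :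
    GA.flip GB (GA.proj i x ⊗ₜ GB.proj j y) =
      paritySign k (i * j) • (GB.proj j y ⊗ₜ GA.proj i x) := by
  rw [flip_tmul GA GB (GA.proj_mem i x) (GB.proj_mem j y), koszulSign_eq_paritySign]

@[simp]
theorem flip_tensor_left (i j l : ZMod 2) (x : A) (y : B) (z : C) :
    (GA.tensor GB).flip GC ((GA.proj i x ⊗ₜ GB.proj j y) ⊗ₜ GC.proj l z) =
      paritySign k ((i + j) * l) • (GC.proj l z ⊗ₜ (GA.proj i x ⊗ₜ GB.proj j y)) := by
  rw [flip_tmul _ GC (tmul_mem (GA.proj_mem i x) (GB.proj_mem j y)) (GC.proj_mem l z),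
    koszulSign_eq_paritySign]

@[simp]
theorem flip_tensor_right (i j l : ZMod 2) (x : A) (y : B) (z : C) :
    GC.flip (GA.tensor GB) (GC.proj l z ⊗ₜ (GA.proj i x ⊗ₜ GB.proj j y)) =
      paritySign k (l * (i + j)) • ((GA.proj i x ⊗ₜ GB.proj j y) ⊗ₜ GC.proj l z) := by
  rw [flip_tmul GC _ (GC.proj_mem l z) (tmul_mem (GA.proj_mem i x) (GB.proj_mem j y)),
    koszulSign_eq_paritySign]

@[simp]
theorem flip_tensor_tensor (i j l m : ZMod 2) (x : A) (y : B) (z : C) (w : D) :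
    (GA.tensor GB).flip (GC.tensor GD)
      ((GA.proj i x ⊗ₜ GB.proj j y) ⊗ₜ (GC.proj l z ⊗ₜ GD.proj m w)) =
      paritySign k ((i + j) * (l + m)) •
        ((GC.proj l z ⊗ₜ GD.proj m w) ⊗ₜ (GA.proj i x ⊗ₜ GB.proj j y)) := by
  rw [flip_tmul _ _ (tmul_mem (GA.proj_mem i x) (GB.proj_mem j y))
    (tmul_mem (GC.proj_mem l z) (GD.proj_mem m w)), koszulSign_eq_paritySign]

/-- Even maps preserve the degrees that determine the sign of the flip. Through `midMap_flip_map`,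
this naturality is what moves structure maps past exchanges of factors. -/
theorem flip_comp_map {f : A →ₗ[k] C} {g : B →ₗ[k] D} {GA : SuperGrading k A}
    {GB : SuperGrading k B} {GC : SuperGrading k C} {GD : SuperGrading k D}
    (hf : IsEven GA GC f) (hg : IsEven GB GD g) :
    GC.flip GD ∘ₗ TensorProduct.map f g = TensorProduct.map g f ∘ₗ GA.flip GB := by
  refine hom_ext₂ GA GB fun i x j y => ?_
  simp [hf.map_proj, hg.map_proj]

theorem flip_map {f : A →ₗ[k] C} {g : B →ₗ[k] D} {GA : SuperGrading k A}
    {GB : SuperGrading k B} {GC : SuperGrading k C} {GD : SuperGrading k D}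
    (hf : IsEven GA GC f) (hg : IsEven GB GD g) (t : A ⊗[k] B) :
    GC.flip GD (TensorProduct.map f g t) = TensorProduct.map g f (GA.flip GB t) :=
  LinearMap.congr_fun (flip_comp_map hf hg) t

@[simp]
theorem flip_flip (t : A ⊗[k] B) : GB.flip GA (GA.flip GB t) = t := by
  have : GB.flip GA ∘ₗ GA.flip GB = LinearMap.id := by
    refine hom_ext₂ GA GB fun i x j y => ?_
    simp [smul_smul, paritySign_mul, mul_comm, CharTwo.add_self_eq_zero]
  exact LinearMap.congr_fun this t

theorem IsEven.flip : IsEven (GA.tensor GB) (GB.tensor GA) (GA.flip GB) := by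
  refine IsEven.of_tmul fun i x j y => ?_
  rw [flip_proj, add_comm]
  exact Submodule.smul_mem _ _ (tmul_mem (GB.proj_mem j y) (GA.proj_mem i x))

variable {GA} in
theorem isEven_scalar_iff {f : A →ₗ[k] k} :
    IsEven GA (scalar k) f ↔ ∀ x ∈ GA.deg 1, f x = 0 := by
  constructor
  · intro h x hx
    simpa [scalar] using h 1 x hx
  · intro h i x hx
    rcases ZMod.two_eq_or i with rfl | rfl
    · simp [scalar]
    · simpa [scalar] using h x hx

end SuperGrading

/-! ### Maps applied to the two middle factors of a fourfold tensor. -/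

section MidMap

variable {k : Type*} [Field k]
variable {A B C D A' B' C' D' M N M' N' : Type*} [AddCommGroup A] [Module k A] [AddCommGroup B]
  [Module k B] [AddCommGroup C] [Module k C] [AddCommGroup D] [Module k D] [AddCommGroup A']
  [Module k A'] [AddCommGroup B'] [Module k B'] [AddCommGroup C'] [Module k C'] [AddCommGroup D']
  [Module k D'] [AddCommGroup M] [Module k M] [AddCommGroup N] [Module k N] [AddCommGroup M']
  [Module k M'] [AddCommGroup N'] [Module k N']

/-- Insert a tensor between two vectors: `(a, m ⊗ n, d) ↦ (a ⊗ m) ⊗ (n ⊗ d)`. -/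
def insertMid (a : A) (d : D) : M ⊗[k] N →ₗ[k] (A ⊗[k] M) ⊗[k] (N ⊗[k] D) :=
  TensorProduct.map (TensorProduct.mk k A M a) ((TensorProduct.mk k N D).flip d)

@[simp]
theorem insertMid_tmul (a : A) (d : D) (m : M) (n : N) :
    insertMid (k := k) a d (m ⊗ₜ n) = (a ⊗ₜ m) ⊗ₜ (n ⊗ₜ d) := rfl

@[simp]
theorem midMap_tmul (φ : B ⊗[k] C →ₗ[k] M ⊗[k] N) (a : A) (b : B) (c : C) (d : D) :
    midMap φ ((a ⊗ₜ b) ⊗ₜ (c ⊗ₜ d)) = insertMid a d (φ (b ⊗ₜ c)) := by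
  simp only [midMap, LinearMap.comp_apply, LinearEquiv.coe_coe, TensorProduct.assoc_tmul,
    LinearMap.lTensor_tmul, TensorProduct.assoc_symm_tmul, LinearMap.rTensor_tmul]
  induction φ (b ⊗ₜ c) with
  | zero => simp
  | add x y hx hy => simp only [map_add, TensorProduct.add_tmul, TensorProduct.tmul_add, hx, hy]
  | tmul m n => simp

theorem midMap_map {φ : B ⊗[k] C →ₗ[k] M ⊗[k] N} {ψ : B' ⊗[k] C' →ₗ[k] M' ⊗[k] N'}
    {b : B →ₗ[k] B'} {c : C →ₗ[k] C'} {m : M →ₗ[k] M'} {n : N →ₗ[k] N'}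
    (h : ψ ∘ₗ TensorProduct.map b c = TensorProduct.map m n ∘ₗ φ)
    (a : A →ₗ[k] A') (d : D →ₗ[k] D') (t : (A ⊗[k] B) ⊗[k] (C ⊗[k] D)) :
    midMap ψ (TensorProduct.map (TensorProduct.map a b) (TensorProduct.map c d) t) =
      TensorProduct.map (TensorProduct.map a m) (TensorProduct.map n d) (midMap φ t) := by
  have : midMap ψ ∘ₗ TensorProduct.map (TensorProduct.map a b) (TensorProduct.map c d) =
      TensorProduct.map (TensorProduct.map a m) (TensorProduct.map n d) ∘ₗ midMap φ := by
    ext x y z w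
    have h' := LinearMap.congr_fun h (y ⊗ₜ z)
    simp only [LinearMap.comp_apply, TensorProduct.map_tmul] at h'
    simp only [TensorProduct.AlgebraTensorModule.curry_apply, LinearMap.restrictScalars_self,
      TensorProduct.curry_apply, LinearMap.comp_apply, TensorProduct.map_tmul, midMap_tmul, h']
    induction φ (y ⊗ₜ z) with
    | zero => simp
    | add x y hx hy => simp only [map_add, hx, hy]
    | tmul m n => simp
  exact LinearMap.congr_fun this t

end MidMap

namespace SuperGrading

variable {k : Type*} [Field k]
variable {A B C D A' B' C' D' M N : Type*} [AddCommGroup A] [Module k A] [AddCommGroup B]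
  [Module k B] [AddCommGroup C] [Module k C] [AddCommGroup D] [Module k D] [AddCommGroup A']
  [Module k A'] [AddCommGroup B'] [Module k B'] [AddCommGroup C'] [Module k C'] [AddCommGroup D']
  [Module k D'] [AddCommGroup M] [Module k M] [AddCommGroup N] [Module k N]
variable {GA : SuperGrading k A} {GB : SuperGrading k B} {GC : SuperGrading k C}
  {GD : SuperGrading k D} {GB' : SuperGrading k B'} {GC' : SuperGrading k C'}
  {GM : SuperGrading k M} {GN : SuperGrading k N}

theorem IsEven.midMap {φ : B ⊗[k] C →ₗ[k] M ⊗[k] N} (hφ : IsEven (GB.tensor GC) (GM.tensor GN) φ) :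
    IsEven ((GA.tensor GB).tensor (GC.tensor GD)) ((GA.tensor GM).tensor (GN.tensor GD))
      (midMap φ) :=
  assoc_symm.comp ((lTensor ((assoc.comp hφ.rTensor).comp assoc_symm)).comp assoc)

theorem midMap_flip_map {b : B →ₗ[k] B'} {c : C →ₗ[k] C'} (hb : IsEven GB GB' b)
    (hc : IsEven GC GC' c) (a : A →ₗ[k] A') (d : D →ₗ[k] D') (t : (A ⊗[k] B) ⊗[k] (C ⊗[k] D)) :
    midMap (GB'.flip GC')
        (TensorProduct.map (TensorProduct.map a b) (TensorProduct.map c d) t) =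
      TensorProduct.map (TensorProduct.map a c) (TensorProduct.map b d)
        (midMap (GB.flip GC) t) :=
  midMap_map (flip_comp_map hb hc) a d t

end SuperGrading

/-! ### Tensor products of superalgebras and of supercoalgebras. -/

namespace HopfSuperData

open SuperGrading

variable {k : Type*} [Field k]
variable {V W U Y V' W' M N P Q : Type*} [AddCommGroup V] [Module k V] [AddCommGroup W] [Module k W]
  [AddCommGroup U] [Module k U] [AddCommGroup Y] [Module k Y]
  [AddCommGroup V'] [Module k V'] [AddCommGroup W'] [Module k W'] [AddCommGroup M] [Module k M]
  [AddCommGroup N] [Module k N] [AddCommGroup P] [Module k P] [AddCommGroup Q] [Module k Q]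
variable {A : HopfSuperData k V} {B : HopfSuperData k W} {C : HopfSuperData k U}
  {D : HopfSuperData k Y} {A' : HopfSuperData k V'} {B' : HopfSuperData k W'}

/-- An even linear map which preserves coproducts and counits. -/
structure IsCoalgHom (A : HopfSuperData k V) (B : HopfSuperData k W) (f : V →ₗ[k] W) : Prop where
  even : IsEven A.gr B.gr f
  comul : ∀ x, B.comul (f x) = TensorProduct.map f f (A.comul x)
  counit : ∀ x, B.counit (f x) = A.counit x

/-- An even linear map which preserves products and units. -/
structure IsAlgHom (A : HopfSuperData k V) (B : HopfSuperData k W) (f : V →ₗ[k] W) : Prop where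
  even : IsEven A.gr B.gr f
  mul : ∀ t, f (A.mul t) = B.mul (TensorProduct.map f f t)
  one : f A.one = B.one

theorem isEven_scalar_proj {G : SuperGrading k V} {φ : V →ₗ[k] k} (hφ : IsEven G (scalar k) φ)
    (i : ZMod 2) (x : V) : φ (G.proj i x) = if i = 0 then φ x else 0 := by
  rw [hφ.map_proj]
  have := (scalar k).proj_of_mem (i := 0) (x := φ x) (by simp [scalar]) i
  simpa using this

/-- An even functional vanishes on odd vectors, so a Koszul sign involving the degree of its
argument can be dropped. This is why signs disappear once a counit, or later the pairing, absorbs a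
tensor factor. -/
theorem paritySign_smul_of_even {G : SuperGrading k V} {φ : V →ₗ[k] k}
    (hφ : IsEven G (scalar k) φ) (i j : ZMod 2) (x : V) :
    paritySign k (i * j) * φ (G.proj i x) = φ (G.proj i x) := by
  rw [isEven_scalar_proj hφ]
  split_ifs with h <;> simp [h]

theorem paritySign_smul_of_even' {G : SuperGrading k V} {φ : V →ₗ[k] k}
    (hφ : IsEven G (scalar k) φ) (i j : ZMod 2) (x : V) :
    paritySign k (j * i) * φ (G.proj i x) = φ (G.proj i x) := by
  rw [mul_comm j i, paritySign_smul_of_even hφ]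

theorem IsSuperalgebra.mul_even (hA : A.IsSuperalgebra) :
    IsEven (A.gr.tensor A.gr) A.gr A.mul :=
  IsEven.of_tmul fun i x j y => hA.mul_mem i j _ (A.gr.proj_mem i x) _ (A.gr.proj_mem j y)

theorem IsSupercoalgebra.comul_even (hA : A.IsSupercoalgebra) :
    IsEven A.gr (A.gr.tensor A.gr) A.comul := hA.comul_mem

theorem IsSupercoalgebra.counit_even (hA : A.IsSupercoalgebra) :
    IsEven A.gr (scalar k) A.counit := isEven_scalar_iff.2 hA.counit_odd

theorem IsSupercoalgebra.coassoc_apply (hA : A.IsSupercoalgebra) (x : V) :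
    TensorProduct.assoc k V V V (TensorProduct.map A.comul LinearMap.id (A.comul x)) =
      TensorProduct.map LinearMap.id A.comul (A.comul x) :=
  LinearMap.congr_fun hA.coassoc x

theorem IsSuperalgebra.proj_one (hA : A.IsSuperalgebra) : A.gr.proj 0 A.one = A.one :=
  proj_eq_self hA.one_mem

section TensorAlgebra

theorem tensor_one : (A.tensor B).one = A.one ⊗ₜ[k] B.one := rfl

theorem tensor_mul_proj (i j l m : ZMod 2) (x : V) (y : W) (z : V) (w : W) :
    (A.tensor B).mul ((A.gr.proj i x ⊗ₜ B.gr.proj j y) ⊗ₜ (A.gr.proj l z ⊗ₜ B.gr.proj m w)) =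
      paritySign k (j * l) • (A.mul (A.gr.proj i x ⊗ₜ A.gr.proj l z) ⊗ₜ
        B.mul (B.gr.proj j y ⊗ₜ B.gr.proj m w)) := by
  simp [tensor]

theorem IsSuperalgebra.tensor (hA : A.IsSuperalgebra) (hB : B.IsSuperalgebra) :
    (A.tensor B).IsSuperalgebra where
  mul_mem i j x hx y hy := by
    have h : IsEven ((A.gr.tensor B.gr).tensor (A.gr.tensor B.gr)) (A.gr.tensor B.gr)
        (A.tensor B).mul :=
      (hA.mul_even.map hB.mul_even).comp (IsEven.flip _ _).midMap
    exact h _ _ (tmul_mem hx hy)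
  one_mem := by
    have := tmul_mem hA.one_mem hB.one_mem
    rwa [add_zero] at this
  mul_assoc := by
    -- Naturality of the flip lets both triple products be written with all exchanges first and all
    -- products last; the two bracketings then differ only by associativity in A and B and by a
    -- sign.
    have h1 : ∀ (s t u : V ⊗[k] W), (A.tensor B).mul ((A.tensor B).mul (s ⊗ₜ t) ⊗ₜ u) =
        TensorProduct.map A.mul B.mul (TensorProduct.map (TensorProduct.map A.mul LinearMap.id)
          (TensorProduct.map B.mul LinearMap.id) (midMap ((B.gr.tensor B.gr).flip A.gr)
            (midMap (B.gr.flip A.gr) (s ⊗ₜ t) ⊗ₜ u))) := by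
      intro s t u
      rw [← midMap_flip_map hB.mul_even IsEven.id]
      simp [HopfSuperData.tensor]
    have h2 : ∀ (s t u : V ⊗[k] W), (A.tensor B).mul (s ⊗ₜ (A.tensor B).mul (t ⊗ₜ u)) =
        TensorProduct.map A.mul B.mul (TensorProduct.map (TensorProduct.map LinearMap.id A.mul)
          (TensorProduct.map LinearMap.id B.mul) (midMap (B.gr.flip (A.gr.tensor A.gr))
            (s ⊗ₜ midMap (B.gr.flip A.gr) (t ⊗ₜ u)))) := by
      intro s t u
      rw [← midMap_flip_map IsEven.id hA.mul_even]
      simp [HopfSuperData.tensor]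
    intro s t u
    have h3 : (A.tensor B).mul ∘ₗ LinearMap.rTensor _ (A.tensor B).mul =
        (A.tensor B).mul ∘ₗ LinearMap.lTensor _ (A.tensor B).mul ∘ₗ
          (TensorProduct.assoc k _ _ _).toLinearMap := by
      refine TensorProduct.ext (hom_ext₄ A.gr B.gr A.gr B.gr fun i x j y l z m w =>
        hom_ext₂ A.gr B.gr fun p a q b => ?_)
      simp only [LinearMap.compr₂ₛₗ_apply, LinearMap.comp_apply, LinearMap.rTensor_tmul,
        LinearMap.lTensor_tmul, TensorProduct.mk_apply, LinearEquiv.coe_coe,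
        TensorProduct.assoc_tmul, h1, h2, midMap_tmul, flip_proj, map_smul, insertMid_tmul,
        ← TensorProduct.smul_tmul', TensorProduct.tmul_smul, TensorProduct.map_tmul, flip_tensor_left,
        flip_tensor_right, LinearMap.id_apply, smul_smul, paritySign_mul, hA.mul_assoc,
        hB.mul_assoc]
      congr 2
      ring
    exact LinearMap.congr_fun h3 ((s ⊗ₜ t) ⊗ₜ u)
  one_mul := by
    intro t
    have h3 : (A.tensor B).mul ∘ₗ TensorProduct.mk k _ _ (A.tensor B).one = LinearMap.id := by
      refine hom_ext₂ A.gr B.gr fun i x j y => ?_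
      have := tensor_mul_proj (A := A) (B := B) 0 0 i j A.one B.one x y
      simpa [hA.proj_one, hB.proj_one, hA.one_mul, hB.one_mul, tensor_one] using this
    exact LinearMap.congr_fun h3 t
  mul_one := by
    intro t
    have h3 : (A.tensor B).mul ∘ₗ (TensorProduct.mk k _ _).flip (A.tensor B).one =
        LinearMap.id := by
      refine hom_ext₂ A.gr B.gr fun i x j y => ?_
      have := tensor_mul_proj (A := A) (B := B) i j 0 0 x y A.one B.one
      simpa [hA.proj_one, hB.proj_one, hA.mul_one, hB.mul_one, tensor_one] using this
    exact LinearMap.congr_fun h3 t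

end TensorAlgebra

section TensorCoalgebra

theorem tensor_comul_tmul (x : V) (y : W) :
    (A.tensor B).comul (x ⊗ₜ y) = midMap (A.gr.flip B.gr) (A.comul x ⊗ₜ B.comul y) := rfl

@[simp]
theorem tensor_counit_tmul (x : V) (y : W) :
    (A.tensor B).counit (x ⊗ₜ y) = A.counit x * B.counit y := rfl

theorem IsSupercoalgebra.tensor (hA : A.IsSupercoalgebra) (hB : B.IsSupercoalgebra) :
    (A.tensor B).IsSupercoalgebra where
  comul_mem := (IsEven.flip _ _).midMap.comp (hA.comul_even.map hB.comul_even)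
  counit_odd := by
    refine isEven_scalar_iff.1 (IsEven.of_tmul (GA := A.gr) (GB := B.gr) fun i x j y => ?_)
    rw [tensor_counit_tmul, isEven_scalar_proj hA.counit_even, isEven_scalar_proj hB.counit_even]
    split_ifs with h1 h2
    · simp [h1, h2, scalar]
    all_goals simp
  coassoc := by
    have h1 : ∀ x y, TensorProduct.map (A.tensor B).comul LinearMap.id
        ((A.tensor B).comul (x ⊗ₜ y)) =
        TensorProduct.map (midMap (A.gr.flip B.gr)) LinearMap.id
          (midMap (A.gr.flip (B.gr.tensor B.gr))
            (TensorProduct.map A.comul LinearMap.id (A.comul x) ⊗ₜ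
              TensorProduct.map B.comul LinearMap.id (B.comul y))) := by
      intro x y
      rw [← TensorProduct.map_tmul, midMap_flip_map IsEven.id hB.comul_even, tensor_comul_tmul]
      simp [HopfSuperData.tensor, TensorProduct.map_map]
    have h2 : ∀ x y, TensorProduct.map LinearMap.id (A.tensor B).comul
        ((A.tensor B).comul (x ⊗ₜ y)) =
        TensorProduct.map LinearMap.id (midMap (A.gr.flip B.gr))
          (midMap ((A.gr.tensor A.gr).flip B.gr)
            (TensorProduct.map LinearMap.id A.comul (A.comul x) ⊗ₜ
              TensorProduct.map LinearMap.id B.comul (B.comul y))) := by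
      intro x y
      rw [← TensorProduct.map_tmul, midMap_flip_map hA.comul_even IsEven.id, tensor_comul_tmul]
      simp [HopfSuperData.tensor, TensorProduct.map_map]
    -- A statement about exchanges alone, with the iterated coproducts of the factors replaced by
    -- arbitrary triple tensors; coassociativity of A and B is inserted afterwards.
    have h3 : (TensorProduct.assoc k (V ⊗[k] W) (V ⊗[k] W) (V ⊗[k] W)).toLinearMap ∘ₗ
        TensorProduct.map (midMap (A.gr.flip B.gr)) LinearMap.id ∘ₗ
          midMap (A.gr.flip (B.gr.tensor B.gr)) =
        TensorProduct.map LinearMap.id (midMap (A.gr.flip B.gr)) ∘ₗ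
          midMap ((A.gr.tensor A.gr).flip B.gr) ∘ₗ
          TensorProduct.map (TensorProduct.assoc k V V V).toLinearMap
            (TensorProduct.assoc k W W W).toLinearMap := by
      refine hom_ext₆ A.gr A.gr A.gr B.gr B.gr B.gr fun i x j y l z i' x' j' y' l' z' => ?_
      simp only [LinearMap.comp_apply, midMap_tmul, flip_tensor_right, map_smul, insertMid_tmul,
        TensorProduct.map_tmul, flip_proj, LinearMap.id_apply, ← TensorProduct.smul_tmul',
        TensorProduct.tmul_smul, LinearEquiv.coe_coe, TensorProduct.assoc_tmul, flip_tensor_left,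
        smul_smul, paritySign_mul]
      congr 2
      ring
    ext x y
    have := LinearMap.congr_fun h3 (TensorProduct.map A.comul LinearMap.id (A.comul x) ⊗ₜ
              TensorProduct.map B.comul LinearMap.id (B.comul y))
    simp only [LinearMap.comp_apply, TensorProduct.map_tmul, LinearEquiv.coe_coe,
      hA.coassoc_apply, hB.coassoc_apply, ← h1, ← h2] at this
    exact this
  counit_left := by
    have h3 : (TensorProduct.lid k (V ⊗[k] W)).toLinearMap ∘ₗ
        LinearMap.rTensor (V ⊗[k] W) (A.tensor B).counit ∘ₗ midMap (A.gr.flip B.gr) =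
        TensorProduct.map ((TensorProduct.lid k V).toLinearMap ∘ₗ LinearMap.rTensor V A.counit)
          ((TensorProduct.lid k W).toLinearMap ∘ₗ LinearMap.rTensor W B.counit) := by
      refine hom_ext₄ A.gr A.gr B.gr B.gr fun i x j y l z m w => ?_
      simp only [LinearMap.comp_apply, midMap_tmul, flip_proj, map_smul, insertMid_tmul,
        LinearMap.rTensor_tmul, tensor_counit_tmul, LinearEquiv.coe_coe, TensorProduct.lid_tmul,
        TensorProduct.map_tmul, smul_smul, ← TensorProduct.smul_tmul', TensorProduct.tmul_smul]
      congr 1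
      linear_combination (A.counit (A.gr.proj i x)) *
        paritySign_smul_of_even' hB.counit_even l j z
    intro t
    have : (TensorProduct.lid k (V ⊗[k] W)).toLinearMap ∘ₗ
        LinearMap.rTensor (V ⊗[k] W) (A.tensor B).counit ∘ₗ (A.tensor B).comul = LinearMap.id := by
      ext x y
      have := LinearMap.congr_fun h3 (A.comul x ⊗ₜ B.comul y)
      simp only [LinearMap.comp_apply, TensorProduct.map_tmul, LinearEquiv.coe_coe,
        hA.counit_left, hB.counit_left] at this
      exact this
    exact LinearMap.congr_fun this t
  counit_right := by
    have h3 : (TensorProduct.rid k (V ⊗[k] W)).toLinearMap ∘ₗ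
        LinearMap.lTensor (V ⊗[k] W) (A.tensor B).counit ∘ₗ midMap (A.gr.flip B.gr) =
        TensorProduct.map ((TensorProduct.rid k V).toLinearMap ∘ₗ LinearMap.lTensor V A.counit)
          ((TensorProduct.rid k W).toLinearMap ∘ₗ LinearMap.lTensor W B.counit) := by
      refine hom_ext₄ A.gr A.gr B.gr B.gr fun i x j y l z m w => ?_
      simp only [LinearMap.comp_apply, midMap_tmul, flip_proj, map_smul, insertMid_tmul,
        LinearMap.lTensor_tmul, tensor_counit_tmul, LinearEquiv.coe_coe, TensorProduct.rid_tmul,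
        TensorProduct.map_tmul, smul_smul, ← TensorProduct.smul_tmul', TensorProduct.tmul_smul]
      congr 1
      linear_combination (B.counit (B.gr.proj m w)) *
        paritySign_smul_of_even hA.counit_even j l y
    intro t
    have : (TensorProduct.rid k (V ⊗[k] W)).toLinearMap ∘ₗ
        LinearMap.lTensor (V ⊗[k] W) (A.tensor B).counit ∘ₗ (A.tensor B).comul = LinearMap.id := by
      ext x y
      have := LinearMap.congr_fun h3 (A.comul x ⊗ₜ B.comul y)
      simp only [LinearMap.comp_apply, TensorProduct.map_tmul, LinearEquiv.coe_coe,
        hA.counit_right, hB.counit_right] at this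
      exact this
    exact LinearMap.congr_fun this t

end TensorCoalgebra

end HopfSuperData

/-! ### Morphisms of supercoalgebras and the counital projections of a tensor product. -/

namespace HopfSuperData

open SuperGrading

variable {k : Type*} [Field k]
variable {V W U Y V' W' M N P Q M' N' : Type*} [AddCommGroup V] [Module k V] [AddCommGroup W]
  [Module k W] [AddCommGroup U] [Module k U] [AddCommGroup Y] [Module k Y]
  [AddCommGroup V'] [Module k V'] [AddCommGroup W'] [Module k W'] [AddCommGroup M] [Module k M]
  [AddCommGroup N] [Module k N] [AddCommGroup P] [Module k P] [AddCommGroup Q] [Module k Q]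
  [AddCommGroup M'] [Module k M'] [AddCommGroup N'] [Module k N']
variable {A : HopfSuperData k V} {B : HopfSuperData k W} {C : HopfSuperData k U}
  {D : HopfSuperData k Y} {A' : HopfSuperData k V'} {B' : HopfSuperData k W'}

namespace IsCoalgHom

theorem id : IsCoalgHom A A LinearMap.id := ⟨IsEven.id, fun x => by simp, fun _ => rfl⟩

theorem comp {g : W →ₗ[k] U} {f : V →ₗ[k] W} (hg : IsCoalgHom B C g) (hf : IsCoalgHom A B f) :
    IsCoalgHom A C (g ∘ₗ f) where
  even := hg.even.comp hf.even
  comul x := by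
    rw [LinearMap.comp_apply, hg.comul, hf.comul, TensorProduct.map_comp, LinearMap.comp_apply]
  counit x := by rw [LinearMap.comp_apply, hg.counit, hf.counit]

theorem symm {f : V ≃ₗ[k] W} (hf : IsCoalgHom A B f.toLinearMap) :
    IsCoalgHom B A f.symm.toLinearMap where
  even := hf.even.symm
  comul x := by
    have h := hf.comul (f.symm x)
    simp only [LinearEquiv.coe_coe, LinearEquiv.apply_symm_apply] at h
    rw [h, TensorProduct.map_map]
    simp
  counit x := by
    have h := hf.counit (f.symm x)
    simp only [LinearEquiv.coe_coe, LinearEquiv.apply_symm_apply] at h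
    exact h.symm

theorem map {f : V →ₗ[k] V'} {g : W →ₗ[k] W'} (hf : IsCoalgHom A A' f) (hg : IsCoalgHom B B' g) :
    IsCoalgHom (A.tensor B) (A'.tensor B') (TensorProduct.map f g) where
  even := hf.even.map hg.even
  comul t := by
    have : (A'.tensor B').comul ∘ₗ TensorProduct.map f g =
        TensorProduct.map (TensorProduct.map f g) (TensorProduct.map f g) ∘ₗ
          (A.tensor B).comul := by
      ext x y
      simp only [TensorProduct.AlgebraTensorModule.curry_apply, LinearMap.restrictScalars_self,
        TensorProduct.curry_apply, LinearMap.comp_apply, TensorProduct.map_tmul,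
        tensor_comul_tmul, hf.comul, hg.comul]
      rw [← TensorProduct.map_tmul, midMap_flip_map hf.even hg.even]
    exact LinearMap.congr_fun this t
  counit t := by
    have : (A'.tensor B').counit ∘ₗ TensorProduct.map f g = (A.tensor B).counit := by
      ext x y
      simp [hf.counit, hg.counit]
    exact LinearMap.congr_fun this t

theorem lTensor {f : V →ₗ[k] V'} (hf : IsCoalgHom A A' f) :
    IsCoalgHom (B.tensor A) (B.tensor A') (LinearMap.lTensor W f) := (id (A := B)).map hf

theorem rTensor {f : V →ₗ[k] V'} (hf : IsCoalgHom A A' f) :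
    IsCoalgHom (A.tensor B) (A'.tensor B) (LinearMap.rTensor W f) := hf.map id

theorem assoc : IsCoalgHom ((A.tensor B).tensor C) (A.tensor (B.tensor C))
    (TensorProduct.assoc k V W U).toLinearMap where
  even := IsEven.assoc
  comul t := by
    have h : midMap (A.gr.flip (B.gr.tensor C.gr)) ∘ₗ
          LinearMap.lTensor (V ⊗[k] V) (midMap (B.gr.flip C.gr)) =
        TensorProduct.map (TensorProduct.assoc k V W U).toLinearMap
            (TensorProduct.assoc k V W U).toLinearMap ∘ₗ
          midMap ((A.gr.tensor B.gr).flip C.gr) ∘ₗ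
          LinearMap.rTensor (U ⊗[k] U) (midMap (A.gr.flip B.gr)) ∘ₗ
          (TensorProduct.assoc k (V ⊗[k] V) (W ⊗[k] W) (U ⊗[k] U)).symm.toLinearMap := by
      refine TensorProduct.ext (hom_ext₂ A.gr A.gr fun i x i' x' =>
        hom_ext₄ B.gr B.gr C.gr C.gr fun j y j' y' l z l' z' => ?_)
      simp only [LinearMap.compr₂ₛₗ_apply, LinearMap.comp_apply, LinearMap.rTensor_tmul,
        LinearMap.lTensor_tmul, TensorProduct.mk_apply, LinearEquiv.coe_coe,
        TensorProduct.assoc_tmul, TensorProduct.assoc_symm_tmul, midMap_tmul, flip_proj, map_smul,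
        insertMid_tmul, ← TensorProduct.smul_tmul', TensorProduct.tmul_smul,
        TensorProduct.map_tmul, flip_tensor_left, flip_tensor_right, smul_smul, paritySign_mul]
      congr 2
      ring
    have : (A.tensor (B.tensor C)).comul ∘ₗ (TensorProduct.assoc k V W U).toLinearMap =
        TensorProduct.map (TensorProduct.assoc k V W U).toLinearMap
          (TensorProduct.assoc k V W U).toLinearMap ∘ₗ ((A.tensor B).tensor C).comul := by
      ext x y z
      exact LinearMap.congr_fun h (A.comul x ⊗ₜ (B.comul y ⊗ₜ C.comul z))
    exact LinearMap.congr_fun this t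
  counit t := by
    have : (A.tensor (B.tensor C)).counit ∘ₗ (TensorProduct.assoc k V W U).toLinearMap =
        ((A.tensor B).tensor C).counit := by
      ext x y z
      simp [mul_assoc]
    exact LinearMap.congr_fun this t

theorem assoc_symm : IsCoalgHom (A.tensor (B.tensor C)) ((A.tensor B).tensor C)
    (TensorProduct.assoc k V W U).symm.toLinearMap := assoc.symm

/-- The definition of `midMap` is a composite of associators and one-sided tensorings of φ, each of
which is a coalgebra morphism. -/
theorem midMap {φ : W ⊗[k] U →ₗ[k] V' ⊗[k] W'}
    (hφ : IsCoalgHom (B.tensor C) (A'.tensor B') φ) :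
    IsCoalgHom ((A.tensor B).tensor (C.tensor D)) ((A.tensor A').tensor (B'.tensor D))
      (midMap φ) :=
  assoc_symm.comp ((lTensor ((assoc.comp hφ.rTensor).comp assoc_symm)).comp assoc)

theorem flip (hA : A.IsSupercoalgebra) (hB : B.IsSupercoalgebra) :
    IsCoalgHom (A.tensor B) (B.tensor A) (A.gr.flip B.gr) where
  even := IsEven.flip _ _
  comul t := by
    have h : _root_.midMap (B.gr.flip A.gr) ∘ₗ (A.gr.tensor A.gr).flip (B.gr.tensor B.gr) =
        TensorProduct.map (A.gr.flip B.gr) (A.gr.flip B.gr) ∘ₗ _root_.midMap (A.gr.flip B.gr) := by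
      refine hom_ext₄ A.gr A.gr B.gr B.gr fun i x j y l z m w => ?_
      simp only [LinearMap.comp_apply, midMap_tmul, flip_proj, map_smul, insertMid_tmul,
        flip_tensor_tensor, TensorProduct.map_tmul, smul_smul, ← TensorProduct.smul_tmul',
        TensorProduct.tmul_smul, paritySign_mul]
      congr 2
      revert i j l m
      decide
    have : (B.tensor A).comul ∘ₗ A.gr.flip B.gr =
        TensorProduct.map (A.gr.flip B.gr) (A.gr.flip B.gr) ∘ₗ (A.tensor B).comul := by
      ext x y
      have h1 := flip_map hA.comul_even hB.comul_even (x ⊗ₜ y)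
      have h2 := LinearMap.congr_fun h (A.comul x ⊗ₜ B.comul y)
      rw [TensorProduct.map_tmul] at h1
      rw [LinearMap.comp_apply, h1] at h2
      exact h2
    exact LinearMap.congr_fun this t
  counit t := by
    have : (B.tensor A).counit ∘ₗ A.gr.flip B.gr = (A.tensor B).counit := by
      refine hom_ext₂ A.gr B.gr fun i x j y => ?_
      simp only [LinearMap.comp_apply, flip_proj, map_smul, tensor_counit_tmul, smul_eq_mul]
      linear_combination (B.counit (B.gr.proj j y)) *
        paritySign_smul_of_even hA.counit_even i j x
    exact LinearMap.congr_fun this t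

end IsCoalgHom

/-- The projection `a ⊗ b ↦ ε(b) a`. -/
def fstHom (V : Type*) [AddCommGroup V] [Module k V] (B : HopfSuperData k W) : V ⊗[k] W →ₗ[k] V :=
  (TensorProduct.rid k V).toLinearMap ∘ₗ LinearMap.lTensor V B.counit

/-- The projection `a ⊗ b ↦ ε(a) b`. -/
def sndHom (A : HopfSuperData k V) (W : Type*) [AddCommGroup W] [Module k W] : V ⊗[k] W →ₗ[k] W :=
  (TensorProduct.lid k W).toLinearMap ∘ₗ LinearMap.rTensor W A.counit

@[simp]
theorem fstHom_tmul (x : V) (y : W) : fstHom V B (x ⊗ₜ y) = B.counit y • x := by simp [fstHom]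

@[simp]
theorem sndHom_tmul (x : V) (y : W) : sndHom A W (x ⊗ₜ y) = A.counit x • y := by simp [sndHom]

theorem IsSupercoalgebra.sndHom_comul (hA : A.IsSupercoalgebra) (x : V) :
    sndHom A V (A.comul x) = x := hA.counit_left x

theorem IsSupercoalgebra.fstHom_comul (hA : A.IsSupercoalgebra) (x : V) :
    fstHom V A (A.comul x) = x := hA.counit_right x

theorem IsSupercoalgebra.counit_sndHom_comul (hA : A.IsSupercoalgebra) (x : V) :
    (TensorProduct.lid k k) (TensorProduct.map A.counit A.counit (A.comul x)) = A.counit x := by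
  conv_rhs => rw [← hA.sndHom_comul x]
  generalize A.comul x = t
  induction t with
  | zero => simp
  | add x y hx hy => simp only [map_add, hx, hy]
  | tmul a b => simp

theorem isCoalgHom_fstHom (hB : B.IsSupercoalgebra) :
    IsCoalgHom (A.tensor B) A (fstHom V B) where
  even := by
    refine IsEven.of_tmul fun i x j y => ?_
    rw [fstHom_tmul, isEven_scalar_proj hB.counit_even]
    split_ifs with h
    · subst h
      rw [add_zero]
      exact Submodule.smul_mem _ _ (A.gr.proj_mem _ _)
    · simp
  comul t := by
    have h : TensorProduct.map (fstHom V B) (fstHom V B) ∘ₗ midMap (A.gr.flip B.gr) =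
        (TensorProduct.rid k _).toLinearMap ∘ₗ TensorProduct.map LinearMap.id
          ((TensorProduct.lid k k).toLinearMap ∘ₗ TensorProduct.map B.counit B.counit) := by
      refine hom_ext₄ A.gr A.gr B.gr B.gr fun i x j y l z m w => ?_
      simp only [LinearMap.comp_apply, midMap_tmul, flip_proj, map_smul, insertMid_tmul,
        LinearEquiv.coe_coe, TensorProduct.lid_tmul, TensorProduct.rid_tmul, fstHom_tmul,
        TensorProduct.map_tmul, smul_smul, ← TensorProduct.smul_tmul', TensorProduct.tmul_smul,
        LinearMap.id_apply, smul_eq_mul]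
      congr 1
      linear_combination (B.counit (B.gr.proj m w)) *
        paritySign_smul_of_even' hB.counit_even l j z
    have : A.comul ∘ₗ fstHom V B =
        TensorProduct.map (fstHom V B) (fstHom V B) ∘ₗ (A.tensor B).comul := by
      ext x y
      have := LinearMap.congr_fun h (A.comul x ⊗ₜ B.comul y)
      simp only [LinearMap.comp_apply, TensorProduct.map_tmul, LinearEquiv.coe_coe,
        hB.counit_sndHom_comul, TensorProduct.rid_tmul, LinearMap.id_apply] at this
      simp [tensor_comul_tmul, this]
    exact LinearMap.congr_fun this t
  counit t := by
    have : A.counit ∘ₗ fstHom V B = (A.tensor B).counit := by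
      ext x y
      simp [mul_comm]
    exact LinearMap.congr_fun this t

theorem isCoalgHom_sndHom (hA : A.IsSupercoalgebra) :
    IsCoalgHom (A.tensor B) B (sndHom A W) where
  even := by
    refine IsEven.of_tmul fun i x j y => ?_
    rw [sndHom_tmul, isEven_scalar_proj hA.counit_even]
    split_ifs with h
    · subst h
      rw [zero_add]
      exact Submodule.smul_mem _ _ (B.gr.proj_mem _ _)
    · simp
  comul t := by
    have h : TensorProduct.map (sndHom A W) (sndHom A W) ∘ₗ midMap (A.gr.flip B.gr) =
        (TensorProduct.lid k _).toLinearMap ∘ₗ TensorProduct.map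
          ((TensorProduct.lid k k).toLinearMap ∘ₗ TensorProduct.map A.counit A.counit)
          LinearMap.id := by
      refine hom_ext₄ A.gr A.gr B.gr B.gr fun i x j y l z m w => ?_
      simp only [LinearMap.comp_apply, midMap_tmul, flip_proj, map_smul, insertMid_tmul,
        LinearEquiv.coe_coe, TensorProduct.lid_tmul, sndHom_tmul,
        TensorProduct.map_tmul, smul_smul, ← TensorProduct.smul_tmul', TensorProduct.tmul_smul,
        LinearMap.id_apply, smul_eq_mul]
      congr 1
      linear_combination (A.counit (A.gr.proj i x)) *
        paritySign_smul_of_even hA.counit_even j l y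
    have : B.comul ∘ₗ sndHom A W =
        TensorProduct.map (sndHom A W) (sndHom A W) ∘ₗ (A.tensor B).comul := by
      ext x y
      have := LinearMap.congr_fun h (A.comul x ⊗ₜ B.comul y)
      simp only [LinearMap.comp_apply, TensorProduct.map_tmul, LinearEquiv.coe_coe,
        hA.counit_sndHom_comul, TensorProduct.lid_tmul, LinearMap.id_apply] at this
      simp [tensor_comul_tmul, this]
    exact LinearMap.congr_fun this t
  counit t := by
    have : B.counit ∘ₗ sndHom A W = (A.tensor B).counit := by
      ext x y
      simp
    exact LinearMap.congr_fun this t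

/-- The counits absorb the two inner factors of the coproduct. Consequently the identity of A ⊗ B,
and any product map on it, is a convolution of maps that factor through the two projections. -/
theorem map_fstHom_sndHom_comul (hA : A.IsSupercoalgebra) (hB : B.IsSupercoalgebra)
    (t : V ⊗[k] W) :
    TensorProduct.map (fstHom V B) (sndHom A W) ((A.tensor B).comul t) = t := by
  have h : TensorProduct.map (fstHom V B) (sndHom A W) ∘ₗ midMap (A.gr.flip B.gr) =
      TensorProduct.map (fstHom V A) (sndHom B W) := by
    refine hom_ext₄ A.gr A.gr B.gr B.gr fun i x j y l z m w => ?_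
    simp only [LinearMap.comp_apply, midMap_tmul, flip_proj, map_smul, insertMid_tmul,
      sndHom_tmul, fstHom_tmul,
      TensorProduct.map_tmul, smul_smul, ← TensorProduct.smul_tmul', TensorProduct.tmul_smul]
    congr 1
    linear_combination (B.counit (B.gr.proj l z)) *
      paritySign_smul_of_even hA.counit_even j l y
  have : TensorProduct.map (fstHom V B) (sndHom A W) ∘ₗ (A.tensor B).comul = LinearMap.id := by
    ext x y
    have := LinearMap.congr_fun h (A.comul x ⊗ₜ B.comul y)
    simp only [TensorProduct.map_tmul, hB.sndHom_comul, hA.fstHom_comul] at this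
    exact this
  exact LinearMap.congr_fun this t

/-- With the projections in the other order the counits absorb the outer factors, and the inner ones
remain, exchanged. This is the source of the order reversal by antipodes and by the skew pairing. -/
theorem map_sndHom_fstHom_comul (hA : A.IsSupercoalgebra) (hB : B.IsSupercoalgebra)
    (t : V ⊗[k] W) :
    TensorProduct.map (sndHom A W) (fstHom V B) ((A.tensor B).comul t) = A.gr.flip B.gr t := by
  have h : TensorProduct.map (sndHom A W) (fstHom V B) ∘ₗ midMap (A.gr.flip B.gr) =
      TensorProduct.map (fstHom W B) (sndHom A V) ∘ₗ (A.gr.tensor A.gr).flip (B.gr.tensor B.gr) := by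
    refine hom_ext₄ A.gr A.gr B.gr B.gr fun i x j y l z m w => ?_
    simp only [LinearMap.comp_apply, midMap_tmul, flip_proj, map_smul, insertMid_tmul,
      sndHom_tmul, fstHom_tmul, flip_tensor_tensor,
      TensorProduct.map_tmul, smul_smul, ← TensorProduct.smul_tmul', TensorProduct.tmul_smul]
    congr 1
    rw [isEven_scalar_proj hA.counit_even, isEven_scalar_proj hB.counit_even]
    split_ifs with h1 h2 <;> simp [*, mul_comm]
  have : TensorProduct.map (sndHom A W) (fstHom V B) ∘ₗ (A.tensor B).comul =
      A.gr.flip B.gr := by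
    ext x y
    have h1 := LinearMap.congr_fun h (A.comul x ⊗ₜ B.comul y)
    have h2 := flip_map hA.comul_even hB.comul_even (x ⊗ₜ y)
    rw [TensorProduct.map_tmul] at h2
    rw [LinearMap.comp_apply, LinearMap.comp_apply, h2, TensorProduct.map_map] at h1
    refine h1.trans ?_
    have e1 : fstHom W B ∘ₗ B.comul = LinearMap.id := LinearMap.ext hB.fstHom_comul
    have e2 : sndHom A V ∘ₗ A.comul = LinearMap.id := LinearMap.ext hA.sndHom_comul
    simp [e1, e2]
  exact LinearMap.congr_fun this t

end HopfSuperData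

namespace HopfSuperData

open SuperGrading

variable {k : Type*} [Field k]
variable {V W U Y V' W' M N P Q M' N' : Type*} [AddCommGroup V] [Module k V] [AddCommGroup W]
  [Module k W] [AddCommGroup U] [Module k U] [AddCommGroup Y] [Module k Y]
  [AddCommGroup V'] [Module k V'] [AddCommGroup W'] [Module k W'] [AddCommGroup M] [Module k M]
  [AddCommGroup N] [Module k N] [AddCommGroup P] [Module k P] [AddCommGroup Q] [Module k Q]
  [AddCommGroup M'] [Module k M'] [AddCommGroup N'] [Module k N']
variable {A : HopfSuperData k V} {B : HopfSuperData k W} {C : HopfSuperData k U}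
  {D : HopfSuperData k Y} {A' : HopfSuperData k V'} {B' : HopfSuperData k W'}

/-! ### Convolution, and the action of functionals on linear maps. -/

section Conv

/-- The convolution `x ↦ ∑ μ (f x' ⊗ g x'')` of two linear maps on a coalgebra. -/
def conv (A : HopfSuperData k V) (μ : M ⊗[k] N →ₗ[k] P) (f : V →ₗ[k] M) (g : V →ₗ[k] N) :
    V →ₗ[k] P :=
  μ ∘ₗ TensorProduct.map f g ∘ₗ A.comul

/-- The left action of a functional on a linear map by convolution. -/
def lact (A : HopfSuperData k V) (φ : V →ₗ[k] k) (f : V →ₗ[k] M) : V →ₗ[k] M :=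
  A.conv (TensorProduct.lid k M).toLinearMap φ f

/-- The right action of a functional on a linear map by convolution. -/
def ract (A : HopfSuperData k V) (f : V →ₗ[k] M) (φ : V →ₗ[k] k) : V →ₗ[k] M :=
  A.conv (TensorProduct.rid k M).toLinearMap f φ

/-- This is coassociativity. The four products are kept independent so that one statement covers
both convolution algebras and the two actions of functionals. -/
theorem conv_assoc (hA : A.IsSupercoalgebra) {μ₁ : P ⊗[k] Q →ₗ[k] M'} {μ₂ : M ⊗[k] N →ₗ[k] P}
    {μ₃ : M ⊗[k] N' →ₗ[k] M'} {μ₄ : N ⊗[k] Q →ₗ[k] N'}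
    (h : ∀ x y z, μ₁ (μ₂ (x ⊗ₜ y) ⊗ₜ z) = μ₃ (x ⊗ₜ μ₄ (y ⊗ₜ z)))
    (f : V →ₗ[k] M) (g : V →ₗ[k] N) (l : V →ₗ[k] Q) :
    A.conv μ₁ (A.conv μ₂ f g) l = A.conv μ₃ f (A.conv μ₄ g l) := by
  have h1 : μ₁ ∘ₗ TensorProduct.map (μ₂ ∘ₗ TensorProduct.map f g) l =
      μ₃ ∘ₗ TensorProduct.map f (μ₄ ∘ₗ TensorProduct.map g l) ∘ₗ
        (TensorProduct.assoc k V V V).toLinearMap := by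
    ext x y z
    simp [h]
  ext x
  have h2 := LinearMap.congr_fun h1 (TensorProduct.map A.comul LinearMap.id (A.comul x))
  simp only [LinearMap.comp_apply, LinearEquiv.coe_coe, hA.coassoc_apply,
    TensorProduct.map_map] at h2
  exact h2

theorem IsCoalgHom.conv_comp {h : V →ₗ[k] W} (hh : IsCoalgHom A B h) (μ : M ⊗[k] N →ₗ[k] P)
    (f : W →ₗ[k] M) (g : W →ₗ[k] N) :
    B.conv μ f g ∘ₗ h = A.conv μ (f ∘ₗ h) (g ∘ₗ h) := by
  ext x
  simp [conv, hh.comul, TensorProduct.map_map]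

theorem comp_lact (L : M →ₗ[k] N) (φ : V →ₗ[k] k) (f : V →ₗ[k] M) :
    L ∘ₗ A.lact φ f = A.lact φ (L ∘ₗ f) := by
  have : L ∘ₗ (TensorProduct.lid k M).toLinearMap ∘ₗ TensorProduct.map φ f =
      (TensorProduct.lid k N).toLinearMap ∘ₗ TensorProduct.map φ (L ∘ₗ f) := by
    ext; simp
  exact congrArg (· ∘ₗ A.comul) this

theorem comp_ract (L : M →ₗ[k] N) (f : V →ₗ[k] M) (φ : V →ₗ[k] k) :
    L ∘ₗ A.ract f φ = A.ract (L ∘ₗ f) φ := by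
  have : L ∘ₗ (TensorProduct.rid k M).toLinearMap ∘ₗ TensorProduct.map f φ =
      (TensorProduct.rid k N).toLinearMap ∘ₗ TensorProduct.map (L ∘ₗ f) φ := by
    ext; simp
  exact congrArg (· ∘ₗ A.comul) this

theorem IsCoalgHom.lact_comp {h : V →ₗ[k] W} (hh : IsCoalgHom A B h)
    (φ : W →ₗ[k] k) (f : W →ₗ[k] M) : B.lact φ f ∘ₗ h = A.lact (φ ∘ₗ h) (f ∘ₗ h) :=
  hh.conv_comp _ _ _

theorem IsCoalgHom.ract_comp {h : V →ₗ[k] W} (hh : IsCoalgHom A B h)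
    (f : W →ₗ[k] M) (φ : W →ₗ[k] k) : B.ract f φ ∘ₗ h = A.ract (f ∘ₗ h) (φ ∘ₗ h) :=
  hh.conv_comp _ _ _

/-- On functionals both actions are the convolution product of the dual algebra, which is written
`lact` from here on. -/
theorem ract_scalar (φ ψ : V →ₗ[k] k) : A.ract φ ψ = A.lact φ ψ := by
  have : (TensorProduct.rid k k).toLinearMap = (TensorProduct.lid k k).toLinearMap := by
    ext; simp
  rw [ract, lact, this]

theorem counit_lact (hA : A.IsSupercoalgebra) (f : V →ₗ[k] M) : A.lact A.counit f = f := by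
  have : (TensorProduct.lid k M).toLinearMap ∘ₗ TensorProduct.map A.counit f =
      f ∘ₗ sndHom A V := by
    ext; simp
  ext x
  have := LinearMap.congr_fun this (A.comul x)
  rw [LinearMap.comp_apply, LinearMap.comp_apply, hA.sndHom_comul] at this
  exact this

theorem ract_counit (hA : A.IsSupercoalgebra) (f : V →ₗ[k] M) : A.ract f A.counit = f := by
  have : (TensorProduct.rid k M).toLinearMap ∘ₗ TensorProduct.map f A.counit =
      f ∘ₗ fstHom V A := by
    ext; simp
  ext x
  have := LinearMap.congr_fun this (A.comul x)
  rw [LinearMap.comp_apply, LinearMap.comp_apply, hA.fstHom_comul] at this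
  exact this

theorem lact_counit (hA : A.IsSupercoalgebra) (φ : V →ₗ[k] k) : A.lact φ A.counit = φ := by
  rw [← ract_scalar, ract_counit hA]

/-- Together with the following lemmas: the linear maps from a coalgebra to a vector space form a
bimodule over the convolution algebra of functionals, and convolution products are balanced bimodule
maps. -/
theorem conv_lact (hA : A.IsSupercoalgebra) (μ : M ⊗[k] N →ₗ[k] P) (φ : V →ₗ[k] k)
    (f : V →ₗ[k] M) (g : V →ₗ[k] N) : A.conv μ (A.lact φ f) g = A.lact φ (A.conv μ f g) :=
  conv_assoc hA (fun x y z => by simp [← TensorProduct.smul_tmul']) _ _ _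

theorem conv_ract_left (hA : A.IsSupercoalgebra) (μ : M ⊗[k] N →ₗ[k] P) (φ : V →ₗ[k] k)
    (f : V →ₗ[k] M) (g : V →ₗ[k] N) : A.conv μ (A.ract f φ) g = A.conv μ f (A.lact φ g) :=
  conv_assoc hA (fun x y z => by simp [← TensorProduct.smul_tmul']) _ _ _

theorem conv_ract (hA : A.IsSupercoalgebra) (μ : M ⊗[k] N →ₗ[k] P) (φ : V →ₗ[k] k)
    (f : V →ₗ[k] M) (g : V →ₗ[k] N) : A.conv μ f (A.ract g φ) = A.ract (A.conv μ f g) φ :=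
  (conv_assoc hA (fun x y z => by simp) _ _ _).symm

theorem lact_lact (hA : A.IsSupercoalgebra) (φ ψ : V →ₗ[k] k) (f : V →ₗ[k] M) :
    A.lact (A.lact φ ψ) f = A.lact φ (A.lact ψ f) := conv_lact hA _ _ _ _

theorem ract_lact (hA : A.IsSupercoalgebra) (φ ψ : V →ₗ[k] k) (f : V →ₗ[k] M) :
    A.ract (A.lact φ f) ψ = A.lact φ (A.ract f ψ) := conv_lact hA _ _ _ _

theorem ract_ract (hA : A.IsSupercoalgebra) (φ ψ : V →ₗ[k] k) (f : V →ₗ[k] M) :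
    A.ract (A.ract f φ) ψ = A.ract f (A.lact φ ψ) := conv_ract_left hA _ _ _ _

theorem isEven_lid (G : SuperGrading k M) :
    IsEven ((scalar k).tensor G) G (TensorProduct.lid k M).toLinearMap := by
  refine IsEven.of_tmul fun i c j x => ?_
  simp only [LinearEquiv.coe_coe, TensorProduct.lid_tmul]
  have h := (scalar k).proj_of_mem (i := 0) (x := c) (by simp [scalar]) i
  rw [h]
  split_ifs with hi
  · subst hi
    rw [zero_add]
    exact Submodule.smul_mem _ _ (G.proj_mem _ _)
  · simp

theorem isEven_rid (G : SuperGrading k M) :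
    IsEven (G.tensor (scalar k)) G (TensorProduct.rid k M).toLinearMap := by
  refine IsEven.of_tmul fun j x i c => ?_
  simp only [LinearEquiv.coe_coe, TensorProduct.rid_tmul]
  have h := (scalar k).proj_of_mem (i := 0) (x := c) (by simp [scalar]) i
  rw [h]
  split_ifs with hi
  · subst hi
    rw [add_zero]
    exact Submodule.smul_mem _ _ (G.proj_mem _ _)
  · simp

theorem IsSupercoalgebra.conv_even (hA : A.IsSupercoalgebra) {GM : SuperGrading k M}
    {GN : SuperGrading k N} {GP : SuperGrading k P} {μ : M ⊗[k] N →ₗ[k] P} {f : V →ₗ[k] M}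
    {g : V →ₗ[k] N} (hμ : IsEven (GM.tensor GN) GP μ) (hf : IsEven A.gr GM f)
    (hg : IsEven A.gr GN g) : IsEven A.gr GP (A.conv μ f g) :=
  hμ.comp ((hf.map hg).comp hA.comul_even)

end Conv

/-! ### Conjugation by convolution-invertible even functionals. -/

section Inverse

/-- Two functionals on a coalgebra which are inverse to each other for the convolution. -/
structure IsConvInverse (A : HopfSuperData k V) (φ φ' : V →ₗ[k] k) : Prop where
  even : IsEven A.gr (scalar k) φ
  even_inv : IsEven A.gr (scalar k) φ'
  mul_inv : A.lact φ φ' = A.counit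
  inv_mul : A.lact φ' φ = A.counit

variable {φ φ' ψ ψ' : V →ₗ[k] k}

theorem IsConvInverse.lact_inv (h : IsConvInverse A φ φ') (hA : A.IsSupercoalgebra)
    (f : V →ₗ[k] M) : A.lact φ (A.lact φ' f) = f := by
  rw [← lact_lact hA, h.mul_inv, counit_lact hA]

theorem IsConvInverse.inv_lact (h : IsConvInverse A φ φ') (hA : A.IsSupercoalgebra)
    (f : V →ₗ[k] M) : A.lact φ' (A.lact φ f) = f := by
  rw [← lact_lact hA, h.inv_mul, counit_lact hA]

theorem IsConvInverse.comp {φ φ' : W →ₗ[k] k} (h : IsConvInverse B φ φ') {f : V →ₗ[k] W}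
    (hf : IsCoalgHom A B f) : IsConvInverse A (φ ∘ₗ f) (φ' ∘ₗ f) where
  even := h.even.comp hf.even
  even_inv := h.even_inv.comp hf.even
  mul_inv := by rw [← hf.lact_comp, h.mul_inv]; exact LinearMap.ext hf.counit
  inv_mul := by rw [← hf.lact_comp, h.inv_mul]; exact LinearMap.ext hf.counit

theorem IsConvInverse.mul (h : IsConvInverse A φ φ') (h' : IsConvInverse A ψ ψ')
    (hA : A.IsSupercoalgebra) : IsConvInverse A (A.lact φ ψ) (A.lact ψ' φ') where
  even := hA.conv_even (isEven_lid _) h.even h'.even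
  even_inv := hA.conv_even (isEven_lid _) h'.even_inv h.even_inv
  mul_inv := by rw [lact_lact hA, h'.lact_inv hA, h.mul_inv]
  inv_mul := by rw [lact_lact hA, h.inv_lact hA, h'.inv_mul]

theorem IsConvInverse.unique (h : IsConvInverse A φ φ') (h' : IsConvInverse A φ ψ')
    (hA : A.IsSupercoalgebra) : φ' = ψ' := by
  rw [← h.inv_lact hA ψ', h'.mul_inv, lact_counit hA]

/-- The conjugate `φ * f * φ'` of a linear map on a coalgebra by functionals. -/
def conj (A : HopfSuperData k V) (φ : V →ₗ[k] k) (f : V →ₗ[k] M) (φ' : V →ₗ[k] k) : V →ₗ[k] M :=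
  A.lact φ (A.ract f φ')

theorem comp_conj (L : M →ₗ[k] N) (φ φ' : V →ₗ[k] k) (f : V →ₗ[k] M) :
    L ∘ₗ A.conj φ f φ' = A.conj φ (L ∘ₗ f) φ' := by
  rw [conj, comp_lact, comp_ract, conj]

theorem IsCoalgHom.conj_comp {h : V →ₗ[k] W} (hh : IsCoalgHom A B h)
    (φ φ' : W →ₗ[k] k) (f : W →ₗ[k] M) :
    B.conj φ f φ' ∘ₗ h = A.conj (φ ∘ₗ h) (f ∘ₗ h) (φ' ∘ₗ h) := by
  rw [conj, hh.lact_comp, hh.ract_comp, conj]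

/-- The inner factors φ' * φ cancel. Since f is compatible with coproducts exactly when Δ ∘ f is the
convolution of f with itself, this is what makes conjugates of coalgebra morphisms coalgebra
morphisms. -/
theorem IsConvInverse.conv_conj (h : IsConvInverse A φ φ') (hA : A.IsSupercoalgebra)
    (μ : M ⊗[k] N →ₗ[k] P) (f : V →ₗ[k] M) (g : V →ₗ[k] N) :
    A.conv μ (A.conj φ f φ') (A.conj φ g φ') = A.conj φ (A.conv μ f g) φ' := by
  simp only [conj]
  rw [conv_lact hA, conv_ract_left hA, h.inv_lact hA, conv_ract hA]

theorem IsConvInverse.conj_counit (h : IsConvInverse A φ φ') (hA : A.IsSupercoalgebra) :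
    A.conj φ A.counit φ' = A.counit := by
  rw [conj, ract_scalar, counit_lact hA, h.mul_inv]

theorem IsConvInverse.conj_even (h : IsConvInverse A φ φ') (hA : A.IsSupercoalgebra)
    {GM : SuperGrading k M} {f : V →ₗ[k] M} (hf : IsEven A.gr GM f) :
    IsEven A.gr GM (A.conj φ f φ') :=
  hA.conv_even (isEven_lid _) h.even (hA.conv_even (isEven_rid _) hf h.even_inv)

/-- A conjugate of a coalgebra morphism by an invertible functional is a coalgebra morphism. -/
theorem IsConvInverse.isCoalgHom_conj (h : IsConvInverse A φ φ') (hA : A.IsSupercoalgebra)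
    {f : V →ₗ[k] W} (hf : IsCoalgHom A B f) : IsCoalgHom A B (A.conj φ f φ') where
  even := h.conj_even hA hf.even
  comul x := by
    have h1 : B.comul ∘ₗ f = A.conv LinearMap.id f f := LinearMap.ext hf.comul
    have h2 : B.comul ∘ₗ A.conj φ f φ' =
        A.conv LinearMap.id (A.conj φ f φ') (A.conj φ f φ') := by
      rw [comp_conj, h1, h.conv_conj hA]
    exact LinearMap.congr_fun h2 x
  counit x := by
    have h1 : B.counit ∘ₗ f = A.counit := LinearMap.ext hf.counit
    have h2 : B.counit ∘ₗ A.conj φ f φ' = A.counit := by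
      rw [comp_conj, h1, h.conj_counit hA]
    exact LinearMap.congr_fun h2 x

end Inverse

/-! ### Conjugation on one factor of a tensor product. -/

section Tensor

variable {φ : W →ₗ[k] k}

/-- A functional on one factor acts on the tensor product through the counital projection. Evenness
of φ is needed for `lTensor_lact` and `rTensor_ract`, where the argument of φ is exchanged with a
vector of the other factor; in the other two cases only the argument of a counit is exchanged. -/
theorem lTensor_lact (hA : A.IsSupercoalgebra) (hφ : IsEven B.gr (scalar k) φ) (f : W →ₗ[k] M) :
    LinearMap.lTensor V (B.lact φ f) =
      (A.tensor B).lact (φ ∘ₗ sndHom A W) (LinearMap.lTensor V f) := by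
  have h : (TensorProduct.lid k (V ⊗[k] M)).toLinearMap ∘ₗ
      TensorProduct.map (φ ∘ₗ sndHom A W) (LinearMap.lTensor V f) ∘ₗ midMap (A.gr.flip B.gr) =
      TensorProduct.map (sndHom A V) ((TensorProduct.lid k M).toLinearMap ∘ₗ
        TensorProduct.map φ f) := by
    refine hom_ext₄ A.gr A.gr B.gr B.gr fun i x j y l z m w => ?_
    simp only [LinearMap.comp_apply, midMap_tmul, flip_proj, map_smul, insertMid_tmul,
      sndHom_tmul, TensorProduct.map_tmul, smul_smul, ← TensorProduct.smul_tmul',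
      TensorProduct.tmul_smul, LinearEquiv.coe_coe, TensorProduct.lid_tmul,
      LinearMap.lTensor_tmul, smul_eq_mul]
    congr 1
    linear_combination (A.counit (A.gr.proj i x)) * paritySign_smul_of_even' hφ l j z
  ext x y
  have h1 := LinearMap.congr_fun h (A.comul x ⊗ₜ B.comul y)
  rw [TensorProduct.map_tmul, hA.sndHom_comul] at h1
  exact h1.symm

theorem lTensor_ract (hA : A.IsSupercoalgebra) (f : W →ₗ[k] M) :
    LinearMap.lTensor V (B.ract f φ) =
      (A.tensor B).ract (LinearMap.lTensor V f) (φ ∘ₗ sndHom A W) := by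
  have h : (TensorProduct.rid k (V ⊗[k] M)).toLinearMap ∘ₗ
      TensorProduct.map (LinearMap.lTensor V f) (φ ∘ₗ sndHom A W) ∘ₗ midMap (A.gr.flip B.gr) =
      TensorProduct.map (fstHom V A) ((TensorProduct.rid k M).toLinearMap ∘ₗ
        TensorProduct.map f φ) := by
    refine hom_ext₄ A.gr A.gr B.gr B.gr fun i x j y l z m w => ?_
    simp only [LinearMap.comp_apply, midMap_tmul, flip_proj, map_smul, insertMid_tmul,
      sndHom_tmul, fstHom_tmul, TensorProduct.map_tmul, smul_smul, ← TensorProduct.smul_tmul',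
      TensorProduct.tmul_smul, LinearEquiv.coe_coe, TensorProduct.rid_tmul,
      LinearMap.lTensor_tmul, smul_eq_mul]
    congr 1
    linear_combination (φ (B.gr.proj m w)) * paritySign_smul_of_even hA.counit_even j l y
  ext x y
  have h1 := LinearMap.congr_fun h (A.comul x ⊗ₜ B.comul y)
  rw [TensorProduct.map_tmul, hA.fstHom_comul] at h1
  exact h1.symm

theorem rTensor_lact (hA : A.IsSupercoalgebra) (f : W →ₗ[k] M) :
    LinearMap.rTensor V (B.lact φ f) =
      (B.tensor A).lact (φ ∘ₗ fstHom W A) (LinearMap.rTensor V f) := by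
  have h : (TensorProduct.lid k (M ⊗[k] V)).toLinearMap ∘ₗ
      TensorProduct.map (φ ∘ₗ fstHom W A) (LinearMap.rTensor V f) ∘ₗ midMap (B.gr.flip A.gr) =
      TensorProduct.map ((TensorProduct.lid k M).toLinearMap ∘ₗ
        TensorProduct.map φ f) (sndHom A V) := by
    refine hom_ext₄ B.gr B.gr A.gr A.gr fun i x j y l z m w => ?_
    simp only [LinearMap.comp_apply, midMap_tmul, flip_proj, map_smul, insertMid_tmul,
      sndHom_tmul, fstHom_tmul, TensorProduct.map_tmul, smul_smul, ← TensorProduct.smul_tmul',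
      TensorProduct.tmul_smul, LinearEquiv.coe_coe, TensorProduct.lid_tmul,
      LinearMap.rTensor_tmul, smul_eq_mul]
    congr 1
    linear_combination (φ (B.gr.proj i x)) * paritySign_smul_of_even' hA.counit_even l j z
  ext x y
  have h1 := LinearMap.congr_fun h (B.comul x ⊗ₜ A.comul y)
  rw [TensorProduct.map_tmul, hA.sndHom_comul] at h1
  exact h1.symm

theorem rTensor_ract (hA : A.IsSupercoalgebra) (hφ : IsEven B.gr (scalar k) φ) (f : W →ₗ[k] M) :
    LinearMap.rTensor V (B.ract f φ) =
      (B.tensor A).ract (LinearMap.rTensor V f) (φ ∘ₗ fstHom W A) := by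
  have h : (TensorProduct.rid k (M ⊗[k] V)).toLinearMap ∘ₗ
      TensorProduct.map (LinearMap.rTensor V f) (φ ∘ₗ fstHom W A) ∘ₗ midMap (B.gr.flip A.gr) =
      TensorProduct.map ((TensorProduct.rid k M).toLinearMap ∘ₗ
        TensorProduct.map f φ) (fstHom V A) := by
    refine hom_ext₄ B.gr B.gr A.gr A.gr fun i x j y l z m w => ?_
    simp only [LinearMap.comp_apply, midMap_tmul, flip_proj, map_smul, insertMid_tmul,
      fstHom_tmul, TensorProduct.map_tmul, smul_smul, ← TensorProduct.smul_tmul',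
      TensorProduct.tmul_smul, LinearEquiv.coe_coe, TensorProduct.rid_tmul,
      LinearMap.rTensor_tmul, smul_eq_mul]
    congr 1
    linear_combination (A.counit (A.gr.proj m w)) * paritySign_smul_of_even hφ j l y
  ext x y
  have h1 := LinearMap.congr_fun h (B.comul x ⊗ₜ A.comul y)
  rw [TensorProduct.map_tmul, hA.fstHom_comul] at h1
  exact h1.symm

theorem IsConvInverse.lTensor_conj {φ φ' : W →ₗ[k] k} (h : IsConvInverse B φ φ')
    (hA : A.IsSupercoalgebra) (f : W →ₗ[k] M) :
    LinearMap.lTensor V (B.conj φ f φ') = (A.tensor B).conj (φ ∘ₗ sndHom A W)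
      (LinearMap.lTensor V f) (φ' ∘ₗ sndHom A W) := by
  rw [conj, lTensor_lact hA h.even, lTensor_ract hA, conj]

theorem IsConvInverse.rTensor_conj {φ φ' : W →ₗ[k] k} (h : IsConvInverse B φ φ')
    (hA : A.IsSupercoalgebra) (f : W →ₗ[k] M) :
    LinearMap.rTensor V (B.conj φ f φ') = (B.tensor A).conj (φ ∘ₗ fstHom W A)
      (LinearMap.rTensor V f) (φ' ∘ₗ fstHom W A) := by
  rw [conj, rTensor_lact hA, rTensor_ract hA h.even_inv, conj]

/-- Conjugation passes through each stage of the construction of `midMap`, and the functional ends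
up acting on the middle factors, with counits on the outer ones. This is what will turn the
bicrossed product into a product conjugated by a functional. -/
theorem IsConvInverse.midMap_conj {φ φ' : W ⊗[k] U →ₗ[k] k} (h : IsConvInverse (B.tensor C) φ φ')
    (hA : A.IsSupercoalgebra) (hD : D.IsSupercoalgebra) (f : W ⊗[k] U →ₗ[k] M ⊗[k] N) :
    midMap (A := V) (D := Y) ((B.tensor C).conj φ f φ') =
      ((A.tensor B).tensor (C.tensor D)).conj
        (φ ∘ₗ TensorProduct.map (sndHom A W) (fstHom U D)) (midMap f)
        (φ' ∘ₗ TensorProduct.map (sndHom A W) (fstHom U D)) := by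
  have e : fstHom (W ⊗[k] U) D ∘ₗ (TensorProduct.assoc k W U Y).symm.toLinearMap ∘ₗ
      sndHom A (W ⊗[k] (U ⊗[k] Y)) ∘ₗ (TensorProduct.assoc k V W (U ⊗[k] Y)).toLinearMap =
      TensorProduct.map (sndHom A W) (fstHom U D) := by
    ext x y z w
    simp [← TensorProduct.smul_tmul', TensorProduct.tmul_smul, smul_smul, mul_comm]
  have hs : IsCoalgHom (B.tensor (C.tensor D)) ((B.tensor C).tensor D)
      (TensorProduct.assoc k W U Y).symm.toLinearMap := IsCoalgHom.assoc_symm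
  have hf : IsCoalgHom ((B.tensor C).tensor D) (B.tensor C) (fstHom (W ⊗[k] U) D) :=
    isCoalgHom_fstHom hD
  have h1 : IsConvInverse (B.tensor (C.tensor D))
      ((φ ∘ₗ fstHom (W ⊗[k] U) D) ∘ₗ (TensorProduct.assoc k W U Y).symm.toLinearMap)
      ((φ' ∘ₗ fstHom (W ⊗[k] U) D) ∘ₗ (TensorProduct.assoc k W U Y).symm.toLinearMap) :=
    (h.comp hf).comp hs
  have ha : IsCoalgHom ((A.tensor B).tensor (C.tensor D)) (A.tensor (B.tensor (C.tensor D)))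
      (TensorProduct.assoc k V W (U ⊗[k] Y)).toLinearMap := IsCoalgHom.assoc
  rw [midMap, h.rTensor_conj hD, hs.conj_comp, comp_conj, h1.lTensor_conj hA, ha.conj_comp,
    comp_conj, ← e]
  rfl

end Tensor

end HopfSuperData

namespace HopfSuperData

open SuperGrading

variable {k : Type*} [Field k]
variable {V W U Y V' W' M N P Q M' N' : Type*} [AddCommGroup V] [Module k V] [AddCommGroup W]
  [Module k W] [AddCommGroup U] [Module k U] [AddCommGroup Y] [Module k Y]
  [AddCommGroup V'] [Module k V'] [AddCommGroup W'] [Module k W'] [AddCommGroup M] [Module k M]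
  [AddCommGroup N] [Module k N] [AddCommGroup P] [Module k P] [AddCommGroup Q] [Module k Q]
  [AddCommGroup M'] [Module k M'] [AddCommGroup N'] [Module k N']
variable {A : HopfSuperData k V} {B : HopfSuperData k W} {C : HopfSuperData k U}
  {D : HopfSuperData k Y} {A' : HopfSuperData k V'} {B' : HopfSuperData k W'}

/-! ### Superbialgebras in terms of coalgebra morphisms. -/

section Bialgebra

theorem IsSuperbialgebra.isCoalgHom_mul (hA : A.IsSuperbialgebra) :
    IsCoalgHom (A.tensor A) A A.mul where
  even := hA.mul_even
  comul t := by
    have : A.comul ∘ₗ A.mul = TensorProduct.map A.mul A.mul ∘ₗ (A.tensor A).comul := by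
      ext x y
      exact hA.comul_mul x y
    exact LinearMap.congr_fun this t
  counit t := by
    have : A.counit ∘ₗ A.mul = (A.tensor A).counit := by
      ext x y
      exact hA.counit_mul x y
    exact LinearMap.congr_fun this t

/-- Multiplicativity of Δ and ε says that the product is a coalgebra morphism. In this form the
axiom is stable under composition and conjugation. -/
theorem IsSuperbialgebra.of_isCoalgHom (h₁ : A.IsSuperalgebra) (h₂ : A.IsSupercoalgebra)
    (h : IsCoalgHom (A.tensor A) A A.mul) (hc : A.comul A.one = A.one ⊗ₜ A.one)
    (he : A.counit A.one = 1) : A.IsSuperbialgebra where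
  toIsSuperalgebra := h₁
  toIsSupercoalgebra := h₂
  comul_mul x y := h.comul (x ⊗ₜ y)
  comul_one := hc
  counit_mul x y := h.counit (x ⊗ₜ y)
  counit_one := he

theorem IsSuperbialgebra.isAlgHom_comul (hA : A.IsSuperbialgebra) :
    IsAlgHom A (A.tensor A) A.comul where
  even := hA.comul_even
  mul t := by
    have : A.comul ∘ₗ A.mul = (A.tensor A).mul ∘ₗ TensorProduct.map A.comul A.comul := by
      ext x y
      exact hA.comul_mul x y
    exact LinearMap.congr_fun this t
  one := hA.comul_one

theorem tensor_comul_one (hA : A.IsSuperbialgebra) (hB : B.IsSuperbialgebra) :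
    (A.tensor B).comul (A.tensor B).one = (A.tensor B).one ⊗ₜ (A.tensor B).one := by
  have := flip_proj A.gr B.gr 0 0 A.one B.one
  simp only [hA.proj_one, hB.proj_one, mul_zero, paritySign_zero, one_smul] at this
  simp [tensor_one, tensor_comul_tmul, hA.comul_one, hB.comul_one, this]

theorem IsSuperbialgebra.tensor (hA : A.IsSuperbialgebra) (hB : B.IsSuperbialgebra) :
    (A.tensor B).IsSuperbialgebra :=
  .of_isCoalgHom (hA.toIsSuperalgebra.tensor hB.toIsSuperalgebra)
    (hA.toIsSupercoalgebra.tensor hB.toIsSupercoalgebra)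
    ((hA.isCoalgHom_mul.map hB.isCoalgHom_mul).comp
      (IsCoalgHom.flip hB.toIsSupercoalgebra hA.toIsSupercoalgebra).midMap)
    (tensor_comul_one hA hB) (by simp [tensor_one, hA.counit_one, hB.counit_one])

end Bialgebra

/-! ### The convolution algebra with values in a superalgebra. -/

section ConvAlgebra

/-- The unit `x ↦ ε(x) 1` of the convolution product. -/
def convOne (A : HopfSuperData k V) (B : HopfSuperData k W) : V →ₗ[k] W :=
  A.counit.smulRight B.one

theorem IsAlgHom.comp_conv {h : W →ₗ[k] U} (hh : IsAlgHom B C h) (f g : V →ₗ[k] W) :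
    h ∘ₗ A.conv B.mul f g = A.conv C.mul (h ∘ₗ f) (h ∘ₗ g) := by
  ext x
  simp [conv, hh.mul, TensorProduct.map_map]

theorem IsAlgHom.comp_convOne {h : W →ₗ[k] U} (hh : IsAlgHom B C h) :
    h ∘ₗ A.convOne B = A.convOne C := by
  ext x
  simp [convOne, hh.one]

theorem IsCoalgHom.convOne_comp {h : V →ₗ[k] W} (hh : IsCoalgHom A B h) :
    B.convOne C ∘ₗ h = A.convOne C := by
  ext x
  simp [convOne, hh.counit]

theorem convOne_conv (hA : A.IsSupercoalgebra) (hB : B.IsSuperalgebra) (f : V →ₗ[k] W) :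
    A.conv B.mul (A.convOne B) f = f := by
  have h : B.mul ∘ₗ TensorProduct.map (A.convOne B) f =
      (TensorProduct.lid k W).toLinearMap ∘ₗ TensorProduct.map A.counit f := by
    ext x y
    simp [convOne, ← TensorProduct.smul_tmul', hB.one_mul]
  exact (congrArg (· ∘ₗ A.comul) h).trans (counit_lact hA f)

theorem conv_convOne (hA : A.IsSupercoalgebra) (hB : B.IsSuperalgebra) (f : V →ₗ[k] W) :
    A.conv B.mul f (A.convOne B) = f := by
  have h : B.mul ∘ₗ TensorProduct.map f (A.convOne B) =
      (TensorProduct.rid k W).toLinearMap ∘ₗ TensorProduct.map f A.counit := by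
    ext x y
    simp [convOne, hB.mul_one]
  exact (congrArg (· ∘ₗ A.comul) h).trans (ract_counit hA f)

theorem conv_mul_assoc (hA : A.IsSupercoalgebra) (hB : B.IsSuperalgebra) (f g h : V →ₗ[k] W) :
    A.conv B.mul (A.conv B.mul f g) h = A.conv B.mul f (A.conv B.mul g h) :=
  conv_assoc hA hB.mul_assoc f g h

theorem conv_inverse_unique (hA : A.IsSupercoalgebra) (hB : B.IsSuperalgebra) {f g h : V →ₗ[k] W}
    (h₁ : A.conv B.mul g f = A.convOne B) (h₂ : A.conv B.mul f h = A.convOne B) : g = h := by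
  rw [← conv_convOne hA hB g, ← h₂, ← conv_mul_assoc hA hB, h₁, convOne_conv hA hB]

/-- If `g` and `g'` are right inverses of `f` and `f'`, then `g' * g` is one of `f * f'`. -/
theorem conv_mul_inverse (hA : A.IsSupercoalgebra) (hB : B.IsSuperalgebra)
    {f g f' g' : V →ₗ[k] W}
    (h₁ : A.conv B.mul f g = A.convOne B) (h₂ : A.conv B.mul f' g' = A.convOne B) :
    A.conv B.mul (A.conv B.mul f f') (A.conv B.mul g' g) = A.convOne B := by
  rw [conv_mul_assoc hA hB, ← conv_mul_assoc hA hB f', h₂, convOne_conv hA hB, h₁]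

end ConvAlgebra

/-! ### The two inclusions into a tensor product. -/

section Inclusion

theorem mul_inl_inr (hA : A.IsSuperalgebra) (hB : B.IsSuperalgebra) (x : V) (y : W) :
    (A.tensor B).mul ((x ⊗ₜ B.one) ⊗ₜ (A.one ⊗ₜ y)) = x ⊗ₜ y := by
  have := flip_proj B.gr A.gr 0 0 B.one A.one
  simp only [hA.proj_one, hB.proj_one, mul_zero, paritySign_zero, one_smul] at this
  simp [HopfSuperData.tensor, this, hA.mul_one, hB.one_mul]

theorem mul_inr_inl (hA : A.IsSuperalgebra) (hB : B.IsSuperalgebra) (t : W ⊗[k] V) :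
    (A.tensor B).mul (TensorProduct.map (TensorProduct.mk k V W A.one)
      ((TensorProduct.mk k V W).flip B.one) t) = B.gr.flip A.gr t := by
  have h : (A.tensor B).mul ∘ₗ TensorProduct.map (TensorProduct.mk k V W A.one)
      ((TensorProduct.mk k V W).flip B.one) = B.gr.flip A.gr := by
    ext x y
    have : ∀ t : V ⊗[k] W, TensorProduct.map A.mul B.mul (insertMid A.one B.one t) = t := by
      intro t
      induction t with
      | zero => simp
      | add x y hx hy => rw [map_add, map_add, hx, hy]
      | tmul a b => simp [hA.one_mul, hB.mul_one]
    simp [HopfSuperData.tensor, this]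
  exact LinearMap.congr_fun h t

theorem isAlgHom_inl (hB : B.IsSuperalgebra) :
    IsAlgHom A (A.tensor B) ((TensorProduct.mk k V W).flip B.one) where
  even i x hx := by
    have := tmul_mem hx hB.one_mem
    rwa [add_zero] at this
  mul t := by
    have h : (TensorProduct.mk k V W).flip B.one ∘ₗ A.mul = (A.tensor B).mul ∘ₗ
        TensorProduct.map ((TensorProduct.mk k V W).flip B.one)
          ((TensorProduct.mk k V W).flip B.one) := by
      refine hom_ext₂ A.gr A.gr fun i x j y => ?_
      have := tensor_mul_proj (A := A) (B := B) i 0 j 0 x B.one y B.one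
      simp only [hB.proj_one, hB.one_mul, zero_mul, paritySign_zero, one_smul] at this
      exact this.symm
    exact LinearMap.congr_fun h t
  one := rfl

theorem isAlgHom_inr (hA : A.IsSuperalgebra) :
    IsAlgHom B (A.tensor B) (TensorProduct.mk k V W A.one) where
  even i x hx := by
    have := tmul_mem hA.one_mem hx
    rwa [zero_add] at this
  mul t := by
    have h : TensorProduct.mk k V W A.one ∘ₗ B.mul = (A.tensor B).mul ∘ₗ
        TensorProduct.map (TensorProduct.mk k V W A.one) (TensorProduct.mk k V W A.one) := by
      refine hom_ext₂ B.gr B.gr fun i x j y => ?_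
      have := tensor_mul_proj (A := A) (B := B) 0 i 0 j A.one x A.one y
      simp only [hA.proj_one, hA.one_mul, mul_zero, paritySign_zero, one_smul] at this
      exact this.symm
    exact LinearMap.congr_fun h t
  one := rfl

theorem isCoalgHom_inl (hB : B.IsSuperbialgebra) :
    IsCoalgHom A (A.tensor B) ((TensorProduct.mk k V W).flip B.one) where
  even i x hx := by
    have := tmul_mem hx hB.one_mem
    rwa [add_zero] at this
  comul x := by
    have h : midMap (A.gr.flip B.gr) ∘ₗ (TensorProduct.mk k (V ⊗[k] V) (W ⊗[k] W)).flip
        (B.one ⊗ₜ B.one) = TensorProduct.map ((TensorProduct.mk k V W).flip B.one)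
          ((TensorProduct.mk k V W).flip B.one) := by
      refine hom_ext₂ A.gr A.gr fun i x j y => ?_
      have := flip_proj A.gr B.gr j 0 y B.one
      rw [hB.proj_one, mul_zero, paritySign_zero, one_smul] at this
      simp [this]
    have := LinearMap.congr_fun h (A.comul x)
    simpa [tensor_comul_tmul, hB.comul_one] using this
  counit x := by simp [hB.counit_one]

theorem isCoalgHom_inr (hA : A.IsSuperbialgebra) :
    IsCoalgHom B (A.tensor B) (TensorProduct.mk k V W A.one) where
  even i x hx := by
    have := tmul_mem hA.one_mem hx
    rwa [zero_add] at this
  comul x := by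
    have h : midMap (A.gr.flip B.gr) ∘ₗ (TensorProduct.mk k (V ⊗[k] V) (W ⊗[k] W))
        (A.one ⊗ₜ A.one) = TensorProduct.map (TensorProduct.mk k V W A.one)
          (TensorProduct.mk k V W A.one) := by
      refine hom_ext₂ B.gr B.gr fun i x j y => ?_
      have := flip_proj A.gr B.gr 0 i A.one x
      rw [hA.proj_one, zero_mul, paritySign_zero, one_smul] at this
      simp [this]
    have := LinearMap.congr_fun h (B.comul x)
    simpa [tensor_comul_tmul, hA.comul_one] using this
  counit x := by simp [hA.counit_one]

end Inclusion

/-! ### The antipode reverses products and coproducts. -/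

section Antipode

theorem IsHopfSuperalgebra.antipode_even (hA : A.IsHopfSuperalgebra) :
    IsEven A.gr A.gr A.antipode := hA.antipode_mem

theorem IsHopfSuperalgebra.antipode_conv_id (hA : A.IsHopfSuperalgebra) :
    A.conv A.mul A.antipode LinearMap.id = A.convOne A := LinearMap.ext hA.antipode_left

theorem IsHopfSuperalgebra.id_conv_antipode (hA : A.IsHopfSuperalgebra) :
    A.conv A.mul LinearMap.id A.antipode = A.convOne A := LinearMap.ext hA.antipode_right

theorem IsHopfSuperalgebra.conv_antipode (hA : A.IsHopfSuperalgebra) {f : W →ₗ[k] V}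
    (hf : IsCoalgHom B A f) : B.conv A.mul f (A.antipode ∘ₗ f) = B.convOne A := by
  rw [← hf.convOne_comp, ← hA.id_conv_antipode, hf.conv_comp, LinearMap.id_comp]

theorem IsHopfSuperalgebra.antipode_conv (hA : A.IsHopfSuperalgebra) {f : W →ₗ[k] V}
    (hf : IsCoalgHom B A f) : B.conv A.mul (A.antipode ∘ₗ f) f = B.convOne A := by
  rw [← hf.convOne_comp, ← hA.antipode_conv_id, hf.conv_comp, LinearMap.id_comp]

theorem IsHopfSuperalgebra.conv_comp_antipode (hA : A.IsHopfSuperalgebra) {f : V →ₗ[k] W}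
    (hf : IsAlgHom A B f) : A.conv B.mul f (f ∘ₗ A.antipode) = A.convOne B := by
  rw [← hf.comp_convOne, ← hA.id_conv_antipode, hf.comp_conv, LinearMap.comp_id]

theorem IsHopfSuperalgebra.comp_antipode_conv (hA : A.IsHopfSuperalgebra) {f : V →ₗ[k] W}
    (hf : IsAlgHom A B f) : A.conv B.mul (f ∘ₗ A.antipode) f = A.convOne B := by
  rw [← hf.comp_convOne, ← hA.antipode_conv_id, hf.comp_conv, LinearMap.comp_id]

/-- The antipode reverses products. -/
theorem IsHopfSuperalgebra.antipode_mul (hA : A.IsHopfSuperalgebra) (t : V ⊗[k] V) :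
    A.antipode (A.mul t) =
      A.mul (TensorProduct.map A.antipode A.antipode (A.gr.flip A.gr t)) := by
  have hc := hA.toIsSupercoalgebra
  have hcc := hc.tensor hc
  -- The product is the convolution of the two projections, so it has a right inverse obtained by
  -- composing these with S and reversing the order. Its left inverse S ∘ μ must coincide with it.
  have h1 : (A.tensor A).conv A.mul (fstHom V A) (sndHom A V) = A.mul := by
    ext x y
    exact congrArg A.mul (map_fstHom_sndHom_comul hc hc (x ⊗ₜ y))
  have h2 := conv_mul_inverse hcc hA.toIsSuperalgebra
    (hA.conv_antipode (isCoalgHom_fstHom (A := A) hc))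
    (hA.conv_antipode (isCoalgHom_sndHom (B := A) hc))
  rw [h1] at h2
  have h3 := conv_inverse_unique hcc hA.toIsSuperalgebra
    (hA.antipode_conv hA.isCoalgHom_mul) h2
  refine (LinearMap.congr_fun h3 t).trans ?_
  rw [← map_sndHom_fstHom_comul hc hc, TensorProduct.map_map]
  rfl

/-- The antipode reverses coproducts. -/
theorem IsHopfSuperalgebra.comul_antipode (hA : A.IsHopfSuperalgebra) (x : V) :
    A.comul (A.antipode x) =
      A.gr.flip A.gr (TensorProduct.map A.antipode A.antipode (A.comul x)) := by
  have hc := hA.toIsSupercoalgebra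
  have ha := hA.toIsSuperalgebra
  have haa := ha.tensor ha
  -- Dually, Δ is the convolution of the inclusions x ↦ x ⊗ 1 and x ↦ 1 ⊗ x, and Δ ∘ S is compared
  -- with the product of their inverses in reversed order.
  have h1 : A.conv (A.tensor A).mul ((TensorProduct.mk k V V).flip A.one)
      (TensorProduct.mk k V V A.one) = A.comul := by
    have : (A.tensor A).mul ∘ₗ TensorProduct.map ((TensorProduct.mk k V V).flip A.one)
      (TensorProduct.mk k V V A.one) = LinearMap.id := by
      ext x y
      exact mul_inl_inr ha ha x y
    rw [conv, ← LinearMap.comp_assoc, this, LinearMap.id_comp]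
  have h2 := conv_mul_inverse hc haa (hA.conv_comp_antipode (isAlgHom_inl ha))
    (hA.conv_comp_antipode (isAlgHom_inr ha))
  rw [h1] at h2
  have h3 := conv_inverse_unique hc haa (hA.comp_antipode_conv hA.isAlgHom_comul) h2
  refine (LinearMap.congr_fun h3 x).trans ?_
  rw [← mul_inr_inl ha ha, TensorProduct.map_map]
  rfl

theorem IsHopfSuperalgebra.antipode_one (hA : A.IsHopfSuperalgebra) :
    A.antipode A.one = A.one := by
  have := hA.antipode_left A.one
  rwa [hA.comul_one, LinearMap.rTensor_tmul, hA.mul_one, hA.counit_one, one_smul] at this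

end Antipode

/-! ### The opposite Hopf superalgebra. -/

section Opposite

variable (hS : Function.Bijective A.antipode)

theorem antipode_antipodeInv (x : V) : A.antipode (A.antipodeInv hS x) = x :=
  LinearEquiv.apply_symm_apply (LinearEquiv.ofBijective A.antipode hS) x

theorem IsHopfSuperalgebra.antipodeInv_even (hA : A.IsHopfSuperalgebra) :
    IsEven A.gr A.gr (A.antipodeInv hS) :=
  IsEven.symm (f := LinearEquiv.ofBijective A.antipode hS) hA.antipode_even

theorem op_mul (t : V ⊗[k] V) : (A.op hS).mul t = A.mul (A.gr.flip A.gr t) := rfl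

theorem IsHopfSuperalgebra.op (hA : A.IsHopfSuperalgebra) : (A.op hS).IsHopfSuperalgebra := by
  have hone : ∀ x, A.gr.flip A.gr (A.one ⊗ₜ x) = x ⊗ₜ A.one := by
    intro x
    have : A.gr.flip A.gr ∘ₗ TensorProduct.mk k V V A.one =
        (TensorProduct.mk k V V).flip A.one := by
      refine hom_ext A.gr fun i x => ?_
      have := flip_proj A.gr A.gr 0 i A.one x
      simpa [hA.proj_one] using this
    exact LinearMap.congr_fun this x
  have hone' : ∀ x, A.gr.flip A.gr (x ⊗ₜ A.one) = A.one ⊗ₜ x := by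
    intro x
    rw [← hone, SuperGrading.flip_flip]
  have ha : (A.op hS).IsSuperalgebra :=
    { mul_mem := fun i j x hx y hy =>
        (hA.mul_even.comp (IsEven.flip _ _)) _ _ (tmul_mem hx hy)
      one_mem := hA.one_mem
      mul_assoc := by
        have h1 : ∀ i x j y l z, A.gr.flip A.gr (A.mul (A.gr.proj i x ⊗ₜ A.gr.proj j y) ⊗ₜ
            A.gr.proj l z) = paritySign k ((i + j) * l) •
              (A.gr.proj l z ⊗ₜ A.mul (A.gr.proj i x ⊗ₜ A.gr.proj j y)) := by
          intro i x j y l z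
          rw [flip_tmul _ _ (hA.mul_mem _ _ _ (A.gr.proj_mem i x) _ (A.gr.proj_mem j y))
            (A.gr.proj_mem l z), koszulSign_eq_paritySign]
        have h2 : ∀ i x j y l z, A.gr.flip A.gr (A.gr.proj l z ⊗ₜ
            A.mul (A.gr.proj i x ⊗ₜ A.gr.proj j y)) = paritySign k (l * (i + j)) •
              (A.mul (A.gr.proj i x ⊗ₜ A.gr.proj j y) ⊗ₜ A.gr.proj l z) := by
          intro i x j y l z
          rw [flip_tmul _ _ (A.gr.proj_mem l z)
            (hA.mul_mem _ _ _ (A.gr.proj_mem i x) _ (A.gr.proj_mem j y)),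
            koszulSign_eq_paritySign]
        have h3 : (A.op hS).mul ∘ₗ LinearMap.rTensor V (A.op hS).mul = (A.op hS).mul ∘ₗ
            LinearMap.lTensor V (A.op hS).mul ∘ₗ (TensorProduct.assoc k V V V).toLinearMap := by
          refine hom_ext₃ A.gr A.gr A.gr fun i x j y l z => ?_
          simp only [LinearMap.comp_apply, LinearMap.rTensor_tmul, LinearMap.lTensor_tmul,
            LinearEquiv.coe_coe, TensorProduct.assoc_tmul, op_mul, h1, h2, flip_proj, map_smul,
            ← TensorProduct.smul_tmul', TensorProduct.tmul_smul, smul_smul, paritySign_mul,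
            hA.mul_assoc]
          congr 2
          ring
        exact fun x y z => LinearMap.congr_fun h3 ((x ⊗ₜ y) ⊗ₜ z)
      one_mul := fun x => by
        rw [op_mul]
        change A.mul (A.gr.flip A.gr (A.one ⊗ₜ x)) = x
        rw [hone, hA.mul_one]
      mul_one := fun x => by
        rw [op_mul]
        change A.mul (A.gr.flip A.gr (x ⊗ₜ A.one)) = x
        rw [hone', hA.one_mul] }
  have hc : (A.op hS).IsSupercoalgebra :=
    { comul_mem := hA.comul_mem
      counit_odd := hA.counit_odd
      coassoc := hA.coassoc
      counit_left := hA.counit_left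
      counit_right := hA.counit_right }
  have hm : IsCoalgHom (A.tensor A) A (A.op hS).mul :=
    hA.isCoalgHom_mul.comp (IsCoalgHom.flip hA.toIsSupercoalgebra hA.toIsSupercoalgebra)
  have hinj := hS.1
  exact
    { toIsSuperbialgebra := .of_isCoalgHom ha hc ⟨hm.even, hm.comul, hm.counit⟩
        hA.comul_one hA.counit_one
      antipode_mem := hA.antipodeInv_even hS
      -- Since S is injective, it may be applied to both sides. It reverses the product, which
      -- cancels the flip of the opposite product, and what remains is the antipode axiom of H on
      -- the other side.
      antipode_left := fun x => by
        apply hinj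
        change A.antipode (A.mul (A.gr.flip A.gr (TensorProduct.map (A.antipodeInv hS)
          LinearMap.id (A.comul x)))) = A.antipode (A.counit x • A.one)
        rw [hA.antipode_mul, SuperGrading.flip_flip, TensorProduct.map_map, map_smul, hA.antipode_one,
          ← hA.antipode_right]
        congr 2
        ext x
        simp [antipode_antipodeInv]
      antipode_right := fun x => by
        apply hinj
        change A.antipode (A.mul (A.gr.flip A.gr (TensorProduct.map LinearMap.id
          (A.antipodeInv hS) (A.comul x)))) = A.antipode (A.counit x • A.one)
        rw [hA.antipode_mul, SuperGrading.flip_flip, TensorProduct.map_map, map_smul, hA.antipode_one,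
          ← hA.antipode_left]
        congr 2
        ext x
        simp [antipode_antipodeInv] }

end Opposite

end HopfSuperData

namespace SuperGrading

/-! ### The isomorphism λ : V^* ⊗ W^* → (V ⊗ W)^*. -/

section DualDistrib

variable {k : Type*} [Field k]
variable {A B C D A' B' : Type*} [AddCommGroup A] [Module k A] [AddCommGroup B] [Module k B]
  [AddCommGroup C] [Module k C] [AddCommGroup D] [Module k D] [AddCommGroup A'] [Module k A']
  [AddCommGroup B'] [Module k B']
variable (GA : SuperGrading k A) (GB : SuperGrading k B) (GC : SuperGrading k C)
  (GD : SuperGrading k D) {GA' : SuperGrading k A'} {GB' : SuperGrading k B'}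

theorem dual_proj_apply (i : ZMod 2) (f : Module.Dual k A) (x : A) :
    GA.dual.proj i f x = f (GA.proj i x) := by
  have hmem : ∀ j, (GA.proj j).dualMap f ∈ GA.dual.deg j := by
    intro j
    refine (Submodule.mem_dualAnnihilator _).2 fun y hy => ?_
    have : j ≠ j + 1 := by simp
    simp [GA.proj_of_mem hy, this]
  have hsum : (GA.proj 0).dualMap f + (GA.proj 1).dualMap f = f := by
    ext y
    simp [← map_add, GA.proj_zero_add_proj_one]
  have h : GA.dual.proj i f = (GA.proj i).dualMap f := by
    conv_lhs => rw [← hsum]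
    rw [map_add, GA.dual.proj_of_mem (hmem 0), GA.dual.proj_of_mem (hmem 1)]
    rcases ZMod.two_eq_or i with rfl | rfl <;> simp
  rw [h]
  rfl

theorem dual_proj_proj (i j : ZMod 2) (f : Module.Dual k A) (x : A) :
    GA.dual.proj i f (GA.proj j x) = if i = j then f (GA.proj j x) else 0 := by
  rw [dual_proj_apply, proj_proj]
  split_ifs <;> simp

theorem IsEven.dualMap {GA : SuperGrading k A} {f : A →ₗ[k] A'} (hf : IsEven GA GA' f) :
    IsEven GA'.dual GA.dual f.dualMap := by
  intro i φ hφ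
  refine (Submodule.mem_dualAnnihilator _).2 fun y hy => ?_
  exact (Submodule.mem_dualAnnihilator _).1 hφ _ (hf _ _ hy)

variable [FiniteDimensional k A] [FiniteDimensional k B] [FiniteDimensional k C]
  [FiniteDimensional k D] [FiniteDimensional k A'] [FiniteDimensional k B']

theorem dualDistrib_proj (f : Module.Dual k A) (j : ZMod 2) (g : Module.Dual k B) (i : ZMod 2)
    (x : A) (y : B) :
    GA.dualDistrib GB (f ⊗ₜ GB.dual.proj j g) (GA.proj i x ⊗ₜ y) =
      paritySign k (j * i) * (f (GA.proj i x) * GB.dual.proj j g y) := by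
  rw [dualDistrib_apply GA GB f (GB.dual.proj_mem j g) (GA.proj_mem i x),
    koszulSign_eq_paritySign]

theorem dualDistrib_even : IsEven (GA.dual.tensor GB.dual) (GA.tensor GB).dual
    (GA.dualDistrib GB).toLinearMap := by
  refine IsEven.of_tmul fun i f j g => ?_
  refine (Submodule.mem_dualAnnihilator _).2 ?_
  suffices h : (GA.tensor GB).deg (i + j + 1) ≤ LinearMap.ker
      (GA.dualDistrib GB (GA.dual.proj i f ⊗ₜ GB.dual.proj j g)) from fun x hx => h hx
  refine tensor_deg_le GA GB fun p x q y hpq => ?_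
  rw [LinearMap.mem_ker, dualDistrib_proj, dual_proj_proj, dual_proj_proj]
  split_ifs with h1 h2
  · subst h1 h2
    exact absurd hpq (by revert i j; decide)
  all_goals simp

theorem dualDistrib_map {GA : SuperGrading k A} {GB : SuperGrading k B} {f : A →ₗ[k] A'}
    {g : B →ₗ[k] B'} (hf : IsEven GA GA' f) (hg : IsEven GB GB' g)
    (t : Module.Dual k A' ⊗[k] Module.Dual k B') (s : A ⊗[k] B) :
    GA.dualDistrib GB (TensorProduct.map f.dualMap g.dualMap t) s =
      GA'.dualDistrib GB' t (TensorProduct.map f g s) := by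
  have h : (GA.dualDistrib GB).toLinearMap ∘ₗ TensorProduct.map f.dualMap g.dualMap =
      (TensorProduct.map f g).dualMap ∘ₗ (GA'.dualDistrib GB').toLinearMap := by
    refine hom_ext₂ GA'.dual GB'.dual fun i φ j ψ => hom_ext₂ GA GB fun p x q y => ?_
    simp only [LinearMap.comp_apply, TensorProduct.map_tmul, LinearEquiv.coe_coe,
      LinearMap.dualMap_apply, hg.dualMap.map_proj, dualDistrib_proj, hf.map_proj]
    rw [← hg.dualMap.map_proj, LinearMap.dualMap_apply]
  exact LinearMap.congr_fun (LinearMap.congr_fun h t) s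

/-- Compatibility of the isomorphisms `V* ⊗ W* ≃ (V ⊗ W)*` with associativity. -/
theorem dualDistrib_assoc
    (t : (Module.Dual k A ⊗[k] Module.Dual k B) ⊗[k] Module.Dual k C) (s : (A ⊗[k] B) ⊗[k] C) :
    GA.dualDistrib (GB.tensor GC) (TensorProduct.map LinearMap.id
      (GB.dualDistrib GC).toLinearMap (TensorProduct.assoc k _ _ _ t))
        (TensorProduct.assoc k A B C s) =
      (GA.tensor GB).dualDistrib GC (TensorProduct.map (GA.dualDistrib GB).toLinearMap
        LinearMap.id t) s := by
  have h : (TensorProduct.assoc k A B C).toLinearMap.dualMap ∘ₗ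
      (GA.dualDistrib (GB.tensor GC)).toLinearMap ∘ₗ TensorProduct.map LinearMap.id
        (GB.dualDistrib GC).toLinearMap ∘ₗ (TensorProduct.assoc k (Module.Dual k A)
          (Module.Dual k B) (Module.Dual k C)).toLinearMap =
      ((GA.tensor GB).dualDistrib GC).toLinearMap ∘ₗ
        TensorProduct.map (GA.dualDistrib GB).toLinearMap LinearMap.id := by
    refine hom_ext₃ GA.dual GB.dual GC.dual fun i f j g l h =>
      hom_ext₃ GA GB GC fun p x q y r z => ?_
    have e1 := dualDistrib_apply GA (GB.tensor GC) (GA.dual.proj i f)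
      (dualDistrib_even GB GC _ _ (tmul_mem (GB.dual.proj_mem j g) (GC.dual.proj_mem l h)))
      (GA.proj_mem p x) (GB.proj q y ⊗ₜ GC.proj r z)
    have e2 := dualDistrib_apply (GA.tensor GB) GC
      (GA.dualDistrib GB (GA.dual.proj i f ⊗ₜ GB.dual.proj j g)) (GC.dual.proj_mem l h)
      (tmul_mem (GA.proj_mem p x) (GB.proj_mem q y)) (GC.proj r z)
    refine e1.trans (Eq.trans ?_ e2.symm)
    rw [LinearEquiv.coe_coe, dualDistrib_proj, dualDistrib_proj, koszulSign_eq_paritySign,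
      koszulSign_eq_paritySign]
    have e3 : paritySign k ((j + l) * p) * paritySign k (l * q) =
        paritySign k (l * (p + q)) * paritySign k (j * p) := by
      rw [paritySign_mul, paritySign_mul]
      congr 1
      ring
    linear_combination (GA.dual.proj i f (GA.proj p x) * GB.dual.proj j g (GB.proj q y) *
      GC.dual.proj l h (GC.proj r z)) * e3
  exact LinearMap.congr_fun (LinearMap.congr_fun h t) s

/-- Compatibility of the isomorphisms `V* ⊗ W* ≃ (V ⊗ W)*` with the exchange of factors. -/
theorem dualDistrib_midMap_flip
    (t : (Module.Dual k A ⊗[k] Module.Dual k B) ⊗[k] (Module.Dual k C ⊗[k] Module.Dual k D))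
    (s : (A ⊗[k] C) ⊗[k] (B ⊗[k] D)) :
    (GA.tensor GC).dualDistrib (GB.tensor GD) (TensorProduct.map
      (GA.dualDistrib GC).toLinearMap (GB.dualDistrib GD).toLinearMap
        (midMap (GB.dual.flip GC.dual) t)) s =
    (GA.tensor GB).dualDistrib (GC.tensor GD) (TensorProduct.map
      (GA.dualDistrib GB).toLinearMap (GC.dualDistrib GD).toLinearMap t)
        (midMap (GC.flip GB) s) := by
  have h : ((GA.tensor GC).dualDistrib (GB.tensor GD)).toLinearMap ∘ₗ TensorProduct.map
      (GA.dualDistrib GC).toLinearMap (GB.dualDistrib GD).toLinearMap ∘ₗ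
        midMap (GB.dual.flip GC.dual) =
      (midMap (GC.flip GB)).dualMap ∘ₗ ((GA.tensor GB).dualDistrib (GC.tensor GD)).toLinearMap ∘ₗ
      TensorProduct.map (GA.dualDistrib GB).toLinearMap (GC.dualDistrib GD).toLinearMap := by
    refine hom_ext₄ GA.dual GB.dual GC.dual GD.dual fun i a j b l c m d =>
      hom_ext₄ GA GC GB GD fun p x q y r z n w => ?_
    have e1 := dualDistrib_apply (GA.tensor GC) (GB.tensor GD)
      (GA.dualDistrib GC (GA.dual.proj i a ⊗ₜ GC.dual.proj l c))
      (dualDistrib_even GB GD _ _ (tmul_mem (GB.dual.proj_mem j b) (GD.dual.proj_mem m d)))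
      (tmul_mem (GA.proj_mem p x) (GC.proj_mem q y)) (GB.proj r z ⊗ₜ GD.proj n w)
    have e2 := dualDistrib_apply (GA.tensor GB) (GC.tensor GD)
      (GA.dualDistrib GB (GA.dual.proj i a ⊗ₜ GB.dual.proj j b))
      (dualDistrib_even GC GD _ _ (tmul_mem (GC.dual.proj_mem l c) (GD.dual.proj_mem m d)))
      (tmul_mem (GA.proj_mem p x) (GB.proj_mem r z)) (GC.proj q y ⊗ₜ GD.proj n w)
    simp only [LinearEquiv.coe_coe, dualDistrib_proj, koszulSign_eq_paritySign] at e1 e2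
    simp only [LinearMap.comp_apply, TensorProduct.map_tmul, LinearEquiv.coe_coe, midMap_tmul,
      flip_proj, map_smul, insertMid_tmul, LinearMap.smul_apply, LinearMap.dualMap_apply, e1, e2,
      smul_eq_mul]
    simp only [dual_proj_proj]
    -- Each functional kills vectors of the other degree, so both sides vanish unless all four
    -- degrees match; in the matching case only the signs are left to compare.
    by_cases h1 : i = p
    · by_cases h2 : j = r
      · by_cases h3 : l = q
        · by_cases h4 : m = n
          · subst h1 h2 h3 h4
            simp only [if_true]
            have e3 : paritySign k (j * l) * paritySign k ((j + m) * (i + l)) *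
                paritySign k (l * i) * paritySign k (m * j) =
                paritySign k (l * j) * paritySign k ((l + m) * (i + j)) *
                paritySign k (j * i) * paritySign k (m * l) := by
              simp only [paritySign_mul]
              congr 1
              ring
            linear_combination (a (GA.proj i x) * b (GB.proj j z) * c (GC.proj l y) *
              d (GD.proj m w)) * e3
          · simp [h4]
        · simp [h3]
      · simp [h2]
    · simp [h1]
  exact LinearMap.congr_fun (LinearMap.congr_fun h t) s

end DualDistrib

end SuperGrading

namespace HopfSuperData

open SuperGrading

variable {k : Type*} [Field k]
variable {V W U Y V' W' M N P Q M' N' : Type*} [AddCommGroup V] [Module k V] [AddCommGroup W]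
  [Module k W] [AddCommGroup U] [Module k U] [AddCommGroup Y] [Module k Y]
  [AddCommGroup V'] [Module k V'] [AddCommGroup W'] [Module k W'] [AddCommGroup M] [Module k M]
  [AddCommGroup N] [Module k N] [AddCommGroup P] [Module k P] [AddCommGroup Q] [Module k Q]
  [AddCommGroup M'] [Module k M'] [AddCommGroup N'] [Module k N']
variable {A : HopfSuperData k V} {B : HopfSuperData k W} {C : HopfSuperData k U}
  {D : HopfSuperData k Y} {A' : HopfSuperData k V'} {B' : HopfSuperData k W'}

/-! ### The dual Hopf superalgebra. -/

section Dual

theorem counit_mem_dual (hA : A.IsSupercoalgebra) : A.counit ∈ A.gr.dual.deg 0 := by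
  refine (Submodule.mem_dualAnnihilator _).2 fun x hx => ?_
  rw [zero_add] at hx
  exact hA.counit_odd x hx

variable [FiniteDimensional k V]

theorem dual_mul_apply (t : Module.Dual k V ⊗[k] Module.Dual k V) (x : V) :
    A.dual.mul t x = A.gr.dualDistrib A.gr t (A.comul x) := rfl

theorem dualDistrib_dual_comul (f : Module.Dual k V) (t : V ⊗[k] V) :
    A.gr.dualDistrib A.gr (A.dual.comul f) t = f (A.mul t) := by
  have : A.gr.dualDistrib A.gr (A.dual.comul f) = A.mul.dualMap f :=
    LinearEquiv.apply_symm_apply _ _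
  rw [this]
  rfl

theorem dualDistrib_counit_left (hA : A.IsSupercoalgebra) (f : Module.Dual k V) (t : V ⊗[k] V) :
    A.gr.dualDistrib A.gr (A.counit ⊗ₜ f) t = f (sndHom A V t) := by
  have h : (A.gr.dualDistrib A.gr).toLinearMap ∘ₗ TensorProduct.mk k _ _ A.counit =
      (sndHom A V).dualMap := by
    refine A.gr.dual.hom_ext fun j f => hom_ext₂ A.gr A.gr fun i x l y => ?_
    simp only [LinearMap.comp_apply, LinearEquiv.coe_coe, TensorProduct.mk_apply,
      dualDistrib_proj, LinearMap.dualMap_apply, sndHom_tmul, map_smul, smul_eq_mul]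
    linear_combination (A.gr.dual.proj j f (A.gr.proj l y)) *
      paritySign_smul_of_even' hA.counit_even i j x
  exact LinearMap.congr_fun (LinearMap.congr_fun h f) t

theorem dualDistrib_counit_right (hA : A.IsSupercoalgebra) (f : Module.Dual k V) (t : V ⊗[k] V) :
    A.gr.dualDistrib A.gr (f ⊗ₜ A.counit) t = f (fstHom V A t) := by
  have h : A.gr.dualDistrib A.gr (f ⊗ₜ A.counit) = f ∘ₗ fstHom V A := by
    refine hom_ext₂ A.gr A.gr fun i x l y => ?_
    rw [dualDistrib_apply A.gr A.gr f (counit_mem_dual hA) (A.gr.proj_mem i x),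
      koszulSign_eq_paritySign, zero_mul, paritySign_zero]
    simp [mul_comm]
  exact LinearMap.congr_fun h t

theorem dualDistrib_one_left (hA : A.IsSuperalgebra) (t : Module.Dual k V ⊗[k] Module.Dual k V)
    (y : V) : A.gr.dualDistrib A.gr t (A.one ⊗ₜ y) =
      (TensorProduct.lid k _ (LinearMap.rTensor _ A.dual.counit t)) y := by
  have h : (TensorProduct.mk k V V A.one).dualMap ∘ₗ (A.gr.dualDistrib A.gr).toLinearMap =
      (TensorProduct.lid k _).toLinearMap ∘ₗ LinearMap.rTensor _ A.dual.counit := by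
    refine hom_ext₂ A.gr.dual A.gr.dual fun i f j g => ?_
    ext y
    have := dualDistrib_proj A.gr A.gr (A.gr.dual.proj i f) j g 0 A.one y
    rw [hA.proj_one, mul_zero, paritySign_zero, one_mul] at this
    exact this
  exact LinearMap.congr_fun (LinearMap.congr_fun h t) y

theorem dualDistrib_one_right (hA : A.IsSuperalgebra) (t : Module.Dual k V ⊗[k] Module.Dual k V)
    (x : V) : A.gr.dualDistrib A.gr t (x ⊗ₜ A.one) =
      (TensorProduct.rid k _ (LinearMap.lTensor _ A.dual.counit t)) x := by
  have h : ((TensorProduct.mk k V V).flip A.one).dualMap ∘ₗ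
      (A.gr.dualDistrib A.gr).toLinearMap =
      (TensorProduct.rid k _).toLinearMap ∘ₗ LinearMap.lTensor _ A.dual.counit := by
    refine hom_ext₂ A.gr.dual A.gr.dual fun i f j g => A.gr.hom_ext fun p x => ?_
    have := dualDistrib_proj A.gr A.gr (A.gr.dual.proj i f) j g p x A.one
    rw [dual_proj_apply A.gr j] at this
    have h1 := A.gr.proj_of_mem hA.one_mem j
    rw [h1] at this
    refine this.trans ?_
    change _ = (A.gr.dual.proj j g) A.one • (A.gr.dual.proj i f) (A.gr.proj p x)
    rw [dual_proj_apply A.gr j, h1]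
    split_ifs with h2 <;> simp [h2, mul_comm]
  exact LinearMap.congr_fun (LinearMap.congr_fun h t) x

/-- The dual of a finite-dimensional Hopf superalgebra is a Hopf superalgebra. -/
theorem IsHopfSuperalgebra.dual (hA : A.IsHopfSuperalgebra) : A.dual.IsHopfSuperalgebra := by
  have hinj := (A.gr.dualDistrib A.gr).injective
  have hLD : (A.gr.dualDistrib A.gr).toLinearMap ∘ₗ A.dual.comul = A.mul.dualMap := by
    ext f : 1
    exact LinearMap.ext fun t => dualDistrib_dual_comul f t
  have hDL : A.dual.mul = A.comul.dualMap ∘ₗ (A.gr.dualDistrib A.gr).toLinearMap := rfl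
  have hmul : IsEven (A.gr.dual.tensor A.gr.dual) A.gr.dual A.dual.mul :=
    hA.comul_even.dualMap.comp (dualDistrib_even _ _)
  have hidd : (LinearMap.id : V →ₗ[k] V).dualMap = LinearMap.id := rfl
  have hcomul : IsEven A.gr.dual (A.gr.dual.tensor A.gr.dual) A.dual.comul :=
    (dualDistrib_even A.gr A.gr).symm.comp hA.mul_even.dualMap
  have ha : A.dual.IsSuperalgebra :=
    { mul_mem := fun i j x hx y hy => hmul _ _ (tmul_mem hx hy)
      one_mem := counit_mem_dual hA.toIsSupercoalgebra
      -- Naturality of λ rewrites each bracketing as an evaluation on an iterated coproduct of x;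
      -- `dualDistrib_assoc` together with coassociativity identifies the two.
      mul_assoc := fun f g h => by
        ext x
        have h1 := dualDistrib_map hA.comul_even (IsEven.id (GA := A.gr))
          (A.gr.dualDistrib A.gr (f ⊗ₜ g) ⊗ₜ h) (A.comul x)
        have h2 := dualDistrib_map (IsEven.id (GA := A.gr)) hA.comul_even
          (f ⊗ₜ A.gr.dualDistrib A.gr (g ⊗ₜ h)) (A.comul x)
        have h3 := dualDistrib_assoc A.gr A.gr A.gr ((f ⊗ₜ g) ⊗ₜ h)
          (TensorProduct.map A.comul LinearMap.id (A.comul x))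
        rw [hA.coassoc_apply] at h3
        exact h1.trans (h3.symm.trans h2.symm)
      one_mul := fun f => by
        ext x
        refine (dualDistrib_counit_left hA.toIsSupercoalgebra f _).trans ?_
        rw [hA.sndHom_comul]
      mul_one := fun f => by
        ext x
        refine (dualDistrib_counit_right hA.toIsSupercoalgebra f _).trans ?_
        rw [hA.fstHom_comul] }
  have hc : A.dual.IsSupercoalgebra :=
    { comul_mem := hcomul
      counit_odd := fun f hf => (Submodule.mem_dualAnnihilator _).1 hf _ hA.one_mem
      coassoc := by
        have h1 : ∀ f s, A.gr.dualDistrib (A.gr.tensor A.gr) (TensorProduct.map LinearMap.id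
            (A.gr.dualDistrib A.gr).toLinearMap (TensorProduct.map LinearMap.id A.dual.comul
              (A.dual.comul f))) s = f (A.mul (TensorProduct.map LinearMap.id A.mul s)) := by
          intro f s
          rw [TensorProduct.map_map, hLD, LinearMap.comp_id, ← hidd,
            dualDistrib_map IsEven.id hA.mul_even, dualDistrib_dual_comul]
        have h2 : ∀ f s, A.gr.dualDistrib (A.gr.tensor A.gr) (TensorProduct.map LinearMap.id
            (A.gr.dualDistrib A.gr).toLinearMap (TensorProduct.assoc k _ _ _
              (TensorProduct.map A.dual.comul LinearMap.id (A.dual.comul f))))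
              (TensorProduct.assoc k V V V s) =
            f (A.mul (TensorProduct.map A.mul LinearMap.id s)) := by
          intro f s
          rw [dualDistrib_assoc, TensorProduct.map_map, hLD, LinearMap.comp_id, ← hidd,
            dualDistrib_map hA.mul_even IsEven.id, dualDistrib_dual_comul]
        ext f : 1
        -- Triple tensors of functionals are determined by their values on H ⊗ H ⊗ H, where
        -- coassociativity of the dual becomes associativity of H.
        have hinj2 : Function.Injective (A.gr.dualDistrib (A.gr.tensor A.gr) ∘
            (TensorProduct.map LinearMap.id (A.gr.dualDistrib A.gr).toLinearMap)) :=
          (LinearEquiv.injective _).comp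
            (LinearEquiv.lTensor (Module.Dual k V) (A.gr.dualDistrib A.gr)).injective
        apply hinj2
        refine LinearMap.ext fun s => ?_
        obtain ⟨s, rfl⟩ := (TensorProduct.assoc k V V V).surjective s
        refine (h2 f s).trans (Eq.trans ?_ (h1 f _).symm)
        have h3 : A.mul ∘ₗ TensorProduct.map A.mul LinearMap.id = A.mul ∘ₗ
            TensorProduct.map LinearMap.id A.mul ∘ₗ
              (TensorProduct.assoc k V V V).toLinearMap := by
          ext x y z
          exact hA.mul_assoc x y z
        exact congrArg f (LinearMap.congr_fun h3 s)
      counit_left := fun f => by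
        ext y
        rw [← dualDistrib_one_left hA.toIsSuperalgebra, dualDistrib_dual_comul, hA.one_mul]
      counit_right := fun f => by
        ext y
        rw [← dualDistrib_one_right hA.toIsSuperalgebra, dualDistrib_dual_comul, hA.mul_one] }
  exact
    { toIsSuperalgebra := ha
      toIsSupercoalgebra := hc
      comul_mul := fun f g => by
        apply hinj
        refine TensorProduct.ext' fun x y => ?_
        rw [dualDistrib_dual_comul, dual_mul_apply, hA.comul_mul]
        -- Evaluated on x ⊗ y, the exchange of functionals in the product of H^* ⊗ H^* becomes the
        -- exchange of vectors in the product of H ⊗ H, so multiplicativity of Δ for H^* is that of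
        -- H.
        have h1 := dualDistrib_map hA.comul_even hA.comul_even
          (TensorProduct.map (A.gr.dualDistrib A.gr).toLinearMap
            (A.gr.dualDistrib A.gr).toLinearMap (midMap (A.gr.dual.flip A.gr.dual)
              (A.dual.comul f ⊗ₜ A.dual.comul g))) (x ⊗ₜ y)
        rw [dualDistrib_midMap_flip, TensorProduct.map_map, ← hDL, TensorProduct.map_tmul,
          TensorProduct.map_tmul] at h1
        refine Eq.trans ?_ h1.symm
        have h2 := dualDistrib_map hA.mul_even hA.mul_even (f ⊗ₜ g)
          (midMap (A.gr.flip A.gr) (A.comul x ⊗ₜ A.comul y))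
        refine h2.symm.trans ?_
        rw [TensorProduct.map_tmul]
        have h3 : ∀ f, A.mul.dualMap f = A.gr.dualDistrib A.gr (A.dual.comul f) := fun f =>
          (LinearMap.congr_fun hLD f).symm
        rw [h3, h3]
        rfl
      comul_one := by
        apply hinj
        refine TensorProduct.ext' fun x y => ?_
        rw [dualDistrib_dual_comul]
        refine Eq.trans ?_ (dualDistrib_counit_left hA.toIsSupercoalgebra A.counit _).symm
        rw [sndHom_tmul, map_smul]
        exact hA.counit_mul x y
      counit_mul := fun f g => by
        change A.gr.dualDistrib A.gr (f ⊗ₜ g) (A.comul A.one) = f A.one * g A.one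
        rw [hA.comul_one, dualDistrib_one_left hA.toIsSuperalgebra]
        rfl
      counit_one := hA.counit_one
      antipode_mem := hA.antipode_even.dualMap
      antipode_left := fun f => by
        ext x
        have h1 := dualDistrib_map hA.antipode_even (IsEven.id (GA := A.gr)) (A.dual.comul f)
          (A.comul x)
        refine h1.trans ?_
        rw [dualDistrib_dual_comul]
        refine (congrArg f (hA.antipode_left x)).trans ?_
        rw [map_smul, smul_eq_mul, mul_comm]
        rfl
      antipode_right := fun f => by
        ext x
        have h1 := dualDistrib_map (IsEven.id (GA := A.gr)) hA.antipode_even (A.dual.comul f)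
          (A.comul x)
        refine h1.trans ?_
        rw [dualDistrib_dual_comul]
        refine (congrArg f (hA.antipode_right x)).trans ?_
        rw [map_smul, smul_eq_mul, mul_comm]
        rfl }

end Dual

end HopfSuperData

namespace HopfSuperData

open SuperGrading

variable {k : Type*} [Field k]
variable {V W U Y V' W' M N P Q M' N' : Type*} [AddCommGroup V] [Module k V] [AddCommGroup W]
  [Module k W] [AddCommGroup U] [Module k U] [AddCommGroup Y] [Module k Y]
  [AddCommGroup V'] [Module k V'] [AddCommGroup W'] [Module k W'] [AddCommGroup M] [Module k M]
  [AddCommGroup N] [Module k N] [AddCommGroup P] [Module k P] [AddCommGroup Q] [Module k Q]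
  [AddCommGroup M'] [Module k M'] [AddCommGroup N'] [Module k N']
variable {A : HopfSuperData k V} {B : HopfSuperData k W} {C : HopfSuperData k U}
  {D : HopfSuperData k Y} {A' : HopfSuperData k V'} {B' : HopfSuperData k W'}

/-! ### The evaluation of H against X = (H^op)^* as a skew pairing. -/

section Pairing

theorem dual_gr [FiniteDimensional k V] : A.dual.gr = A.gr.dual := rfl

variable (H : HopfSuperData k V)

/-- The pairing `H ⊗ H* → k`, `x ⊗ f ↦ (-1)^(|x| |f|) f x`. -/
def pairing : V ⊗[k] Module.Dual k V →ₗ[k] k := contractLeft k V ∘ₗ H.gr.flip H.gr.dual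

theorem pairing_proj_proj (i j : ZMod 2) (x : V) (f : Module.Dual k V) :
    H.pairing (H.gr.proj i x ⊗ₜ H.gr.dual.proj j f) =
      if j = i then paritySign k i * f (H.gr.proj i x) else 0 := by
  rw [pairing, LinearMap.comp_apply, flip_proj, map_smul, contractLeft_apply, dual_proj_proj]
  split_ifs with h
  · subst h
    have : ∀ j : ZMod 2, j * j = j := by decide
    rw [this, smul_eq_mul]
  · simp

theorem pairing_proj_right (j : ZMod 2) (x : V) (f : Module.Dual k V) :
    H.pairing (x ⊗ₜ H.gr.dual.proj j f) = paritySign k j * H.gr.dual.proj j f x := by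
  have h : H.pairing ∘ₗ (TensorProduct.mk k _ _).flip (H.gr.dual.proj j f) =
      paritySign k j • H.gr.dual.proj j f := by
    refine H.gr.hom_ext fun i x => ?_
    refine (H.pairing_proj_proj i j x f).trans ?_
    rw [LinearMap.smul_apply, dual_proj_proj]
    split_ifs with h <;> simp [h]
  exact LinearMap.congr_fun h x

theorem pairing_even : IsEven (H.gr.tensor H.gr.dual) (scalar k) H.pairing := by
  refine IsEven.of_tmul fun i x j f => ?_
  rw [pairing_proj_proj]
  split_ifs with h
  · subst h
    have : ∀ j : ZMod 2, j + j = 0 := by decide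
    simp [scalar, this]
  · simp

/-- The pairing `(x ⊗ y) ⊗ (f ⊗ g) ↦ (-1)^(|y| |f|) ⟨x, f⟩ ⟨y, g⟩`. -/
def pairing₂ : (V ⊗[k] V) ⊗[k] (Module.Dual k V ⊗[k] Module.Dual k V) →ₗ[k] k :=
  (TensorProduct.lid k k).toLinearMap ∘ₗ TensorProduct.map H.pairing H.pairing ∘ₗ
    midMap (H.gr.flip H.gr.dual)

/-- The exchange in the middle supplies the sign of λ, and the signs of the two pairings give
(-1)^(j+l). So `pairing` and `pairing₂` differ from plain evaluation by the same factor (-1)^n on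
functionals of degree n, and identities for λ carry over to the pairing without a sign. -/
theorem pairing₂_proj (t : V ⊗[k] V) (j l : ZMod 2) (f g : Module.Dual k V)
    [FiniteDimensional k V] :
    H.pairing₂ (t ⊗ₜ (H.gr.dual.proj j f ⊗ₜ H.gr.dual.proj l g)) =
      paritySign k (j + l) *
        H.gr.dualDistrib H.gr (H.gr.dual.proj j f ⊗ₜ H.gr.dual.proj l g) t := by
  have h : H.pairing₂ ∘ₗ (TensorProduct.mk k _ _).flip
      (H.gr.dual.proj j f ⊗ₜ H.gr.dual.proj l g) = paritySign k (j + l) •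
        H.gr.dualDistrib H.gr (H.gr.dual.proj j f ⊗ₜ H.gr.dual.proj l g) := by
    refine hom_ext₂ H.gr H.gr fun p x q y => ?_
    simp only [pairing₂, LinearMap.comp_apply, LinearMap.flip_apply, TensorProduct.mk_apply,
      midMap_tmul, flip_proj, map_smul, insertMid_tmul, TensorProduct.map_tmul,
      LinearEquiv.coe_coe, TensorProduct.lid_tmul, pairing_proj_proj, LinearMap.smul_apply,
      dualDistrib_proj, dual_proj_proj, smul_eq_mul]
    by_cases h1 : j = p
    · by_cases h2 : l = q
      · subst h1 h2
        simp only [if_true]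
        have e : paritySign k (l * j) * paritySign k j * paritySign k l =
            paritySign k (j + l) * paritySign k (l * j) := by
          simp only [paritySign_mul]
          congr 1
          ring
        linear_combination (f (H.gr.proj j x) * g (H.gr.proj l y)) * e
      · simp [h2]
    · simp [h1]
  exact LinearMap.congr_fun h t

theorem pairing₂_of_mem {n : ZMod 2} [FiniteDimensional k V]
    {u : Module.Dual k V ⊗[k] Module.Dual k V} (hu : u ∈ (H.gr.dual.tensor H.gr.dual).deg n)
    (t : V ⊗[k] V) :
    H.pairing₂ (t ⊗ₜ u) = paritySign k n * H.gr.dualDistrib H.gr u t := by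
  suffices h : (H.gr.dual.tensor H.gr.dual).deg n ≤ LinearMap.ker
      (H.pairing₂ ∘ₗ TensorProduct.mk k _ _ t - paritySign k n •
        LinearMap.applyₗ t ∘ₗ (H.gr.dualDistrib H.gr).toLinearMap) from
    sub_eq_zero.1 (h hu)
  refine tensor_deg_le _ _ fun j f l g hjl => ?_
  subst hjl
  exact sub_eq_zero.2 (H.pairing₂_proj t j l f g)

variable {H}
variable [FiniteDimensional k V] (hH : H.IsHopfSuperalgebra) (hS : Function.Bijective H.antipode)

include hH in
-- The product of X is the transpose of Δ; being even, it preserves the factor (-1)^n by which both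
-- pairings differ from evaluation. The next lemma is the same for the coproduct of X and the
-- product of H^op.
theorem pairing_dual_mul (x : V) (t : Module.Dual k V ⊗[k] Module.Dual k V) :
    H.pairing (x ⊗ₜ (H.op hS).dual.mul t) = H.pairing₂ (H.comul x ⊗ₜ t) := by
  have h : H.pairing ∘ₗ TensorProduct.mk k _ _ x ∘ₗ (H.op hS).dual.mul =
      H.pairing₂ ∘ₗ TensorProduct.mk k _ _ (H.comul x) := by
    refine hom_ext₂ H.gr.dual H.gr.dual fun j f l g => ?_
    have hm := (hH.op hS).dual.mul_mem j l _ (H.gr.dual.proj_mem j f) _ (H.gr.dual.proj_mem l g)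
    refine (congrArg (fun y => H.pairing (x ⊗ₜ y)) (proj_eq_self hm).symm).trans ?_
    refine (H.pairing_proj_right (j + l) x _).trans ?_
    refine Eq.trans ?_ (H.pairing₂_proj (H.comul x) j l f g).symm
    congr 1
    exact congrArg (fun f : Module.Dual k V => f x) (proj_eq_self hm)
  exact LinearMap.congr_fun h t

include hH in
theorem pairing_op_mul (t : V ⊗[k] V) (f : Module.Dual k V) :
    H.pairing ((H.op hS).mul t ⊗ₜ f) = H.pairing₂ (t ⊗ₜ (H.op hS).dual.comul f) := by
  have h : H.pairing ∘ₗ TensorProduct.mk k _ _ ((H.op hS).mul t) =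
      H.pairing₂ ∘ₗ TensorProduct.mk k _ _ t ∘ₗ (H.op hS).dual.comul := by
    refine H.gr.dual.hom_ext fun n f => ?_
    refine (H.pairing_proj_right n _ f).trans ?_
    have hm := (hH.op hS).dual.comul_mem n _ (H.gr.dual.proj_mem n f)
    refine Eq.trans ?_ (H.pairing₂_of_mem hm t).symm
    congr 1
    exact (dualDistrib_dual_comul (A := H.op hS) (H.gr.dual.proj n f) t).symm
  exact LinearMap.congr_fun h f

include hH in
theorem pairing_one_left (f : Module.Dual k V) :
    H.pairing (H.one ⊗ₜ f) = (H.op hS).dual.counit f := by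
  have h : H.pairing ∘ₗ TensorProduct.mk k _ _ H.one = (H.op hS).dual.counit := by
    refine H.gr.dual.hom_ext fun n f => ?_
    have := H.pairing_proj_proj 0 n H.one f
    rw [hH.proj_one, paritySign_zero, one_mul] at this
    refine this.trans ?_
    change _ = H.gr.dual.proj n f H.one
    rw [dual_proj_apply, H.gr.proj_of_mem hH.one_mem]
    split_ifs <;> simp
  exact LinearMap.congr_fun h f

include hH in
theorem pairing_one_right (x : V) :
    H.pairing (x ⊗ₜ (H.op hS).dual.one) = H.counit x := by
  have h : H.pairing (x ⊗ₜ H.counit) = H.counit x := by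
    have h1 := H.pairing_proj_right 0 x H.counit
    rwa [paritySign_zero, one_mul,
      proj_eq_self (counit_mem_dual hH.toIsSupercoalgebra)] at h1
  exact h

/-- The inverse of the pairing for the convolution, `x ⊗ f ↦ ⟨S⁻¹ x, f⟩`. -/
def pairingInv : V ⊗[k] Module.Dual k V →ₗ[k] k :=
  H.pairing ∘ₗ LinearMap.rTensor (Module.Dual k V) (H.antipodeInv hS)

include hH in
-- The antipode of X is the transpose of S⁻¹, so the inverse pairing may be computed in either
-- variable. The variable f is the convenient one below.
theorem pairingInv_eq : H.pairingInv hS =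
    H.pairing ∘ₗ LinearMap.lTensor V (H.op hS).dual.antipode := by
  refine hom_ext₂ H.gr H.gr.dual fun i x j f => ?_
  simp only [pairingInv, LinearMap.comp_apply, LinearMap.rTensor_tmul, LinearMap.lTensor_tmul]
  rw [pairing_proj_right]
  have he : IsEven H.gr.dual H.gr.dual (H.op hS).dual.antipode :=
    (hH.antipodeInv_even hS).dualMap
  rw [he.map_proj, pairing_proj_right, ← he.map_proj]
  rfl

include hH in
-- By duality, φ * φ' sends x ⊗ f to ⟨x, ∑ f' S_X(f'')⟩ = f(1) ⟨x, 1_X⟩ = ε(x) f(1), and φ' * φ is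
-- treated alike. Both are the antipode axiom of X seen through the pairing.
theorem isConvInverse_pairing :
    IsConvInverse (H.tensor (H.op hS).dual) H.pairing (H.pairingInv hS) where
  even := H.pairing_even
  even_inv := H.pairing_even.comp (hH.antipodeInv_even hS).rTensor
  mul_inv := by
    ext x f
    have h1 := midMap_flip_map (IsEven.id (GA := H.gr)) (IsEven.id (GA := H.gr.dual))
      (LinearMap.id : V →ₗ[k] V) (H.op hS).dual.antipode
      (H.comul x ⊗ₜ (H.op hS).dual.comul f)
    have h2 := (pairing_dual_mul hH hS x (LinearMap.lTensor _ (H.op hS).dual.antipode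
      ((H.op hS).dual.comul f))).symm
    rw [(hH.op hS).dual.antipode_right] at h2
    rw [TensorProduct.map_tmul, TensorProduct.map_id, TensorProduct.map_id,
      LinearMap.id_apply] at h1
    rw [pairingInv_eq hH hS]
    simp only [pairing₂, LinearMap.comp_apply] at h2
    change (TensorProduct.lid k k).toLinearMap (TensorProduct.map H.pairing (H.pairing ∘ₗ _)
      (midMap _ _)) = _
    have h3 : TensorProduct.map H.pairing (H.pairing ∘ₗ LinearMap.lTensor V
        (H.op hS).dual.antipode) = TensorProduct.map H.pairing H.pairing ∘ₗ
          TensorProduct.map LinearMap.id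
            (TensorProduct.map LinearMap.id (H.op hS).dual.antipode) := by
      rw [← TensorProduct.map_comp, LinearMap.comp_id]
      rfl
    rw [h3, LinearMap.comp_apply]
    refine (congrArg (fun z => (TensorProduct.lid k k).toLinearMap
      (TensorProduct.map H.pairing H.pairing z)) h1.symm).trans (h2.trans ?_)
    rw [TensorProduct.tmul_smul, map_smul, pairing_one_right hH hS]
    simp [mul_comm]
  inv_mul := by
    ext x f
    have h1 := midMap_flip_map (IsEven.id (GA := H.gr)) (hH.op hS).dual.antipode_even
      (LinearMap.id : V →ₗ[k] V) (LinearMap.id : Module.Dual k V →ₗ[k] Module.Dual k V)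
      (H.comul x ⊗ₜ (H.op hS).dual.comul f)
    have h2 := (pairing_dual_mul hH hS x (LinearMap.rTensor _ (H.op hS).dual.antipode
      ((H.op hS).dual.comul f))).symm
    rw [(hH.op hS).dual.antipode_left] at h2
    rw [TensorProduct.map_tmul, TensorProduct.map_id, TensorProduct.map_id,
      LinearMap.id_apply] at h1
    rw [pairingInv_eq hH hS]
    simp only [pairing₂, LinearMap.comp_apply] at h2
    change (TensorProduct.lid k k).toLinearMap (TensorProduct.map (H.pairing ∘ₗ _) H.pairing
      (midMap _ _)) = _
    have h3 : TensorProduct.map (H.pairing ∘ₗ LinearMap.lTensor V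
        (H.op hS).dual.antipode) H.pairing = TensorProduct.map H.pairing H.pairing ∘ₗ
          TensorProduct.map
            (TensorProduct.map LinearMap.id (H.op hS).dual.antipode) LinearMap.id := by
      rw [← TensorProduct.map_comp, LinearMap.comp_id]
      rfl
    rw [h3, LinearMap.comp_apply]
    refine (congrArg (fun z => (TensorProduct.lid k k).toLinearMap
      (TensorProduct.map H.pairing H.pairing z)) h1.symm).trans (h2.trans ?_)
    rw [TensorProduct.tmul_smul, map_smul, pairing_one_right hH hS]
    simp [mul_comm]

include hH in
-- X is dual to H^op: the product xy is the opposite product of the flipped tensor, so y pairs with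
-- f' and x with f''. In `pairing_mul_right` the order is kept; this asymmetry makes the pairing
-- skew.
theorem pairing_mul_left : H.pairing ∘ₗ LinearMap.rTensor _ H.mul =
    ((H.tensor H).tensor (H.op hS).dual).lact
      (H.pairing ∘ₗ LinearMap.rTensor _ (sndHom H V))
      (H.pairing ∘ₗ LinearMap.rTensor _ (fstHom V H)) := by
  ext x y f
  have hc := hH.toIsSupercoalgebra
  have h1 := midMap_flip_map (isCoalgHom_fstHom (A := H) hc).even (IsEven.id (GA := H.gr.dual))
    (sndHom H V) LinearMap.id
    ((H.tensor H).comul (x ⊗ₜ y) ⊗ₜ (H.op hS).dual.comul f)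
  rw [TensorProduct.map_tmul, TensorProduct.map_id, LinearMap.id_apply,
    map_sndHom_fstHom_comul hc hc] at h1
  have h2 := pairing_op_mul hH hS (H.gr.flip H.gr (x ⊗ₜ y)) f
  rw [op_mul, SuperGrading.flip_flip] at h2
  refine h2.trans ?_
  refine (congrArg (fun z => (TensorProduct.lid k k).toLinearMap
      (TensorProduct.map H.pairing H.pairing z)) h1).trans ?_
  rw [TensorProduct.map_map]
  rfl

include hH in
theorem pairing_mul_right : H.pairing ∘ₗ LinearMap.lTensor _ (H.op hS).dual.mul =
    (H.tensor ((H.op hS).dual.tensor (H.op hS).dual)).lact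
      (H.pairing ∘ₗ LinearMap.lTensor _ (fstHom (Module.Dual k V) (H.op hS).dual))
      (H.pairing ∘ₗ LinearMap.lTensor _ (sndHom (H.op hS).dual (Module.Dual k V))) := by
  ext x f g
  have hc := (hH.op hS).dual.toIsSupercoalgebra
  have h1 := midMap_flip_map (D := Module.Dual k V ⊗[k] Module.Dual k V)
    (IsEven.id (GA := H.gr)) (isCoalgHom_fstHom (A := (H.op hS).dual) hc).even LinearMap.id (sndHom (H.op hS).dual (Module.Dual k V))
    (H.comul x ⊗ₜ ((H.op hS).dual.tensor (H.op hS).dual).comul (f ⊗ₜ g))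
  rw [TensorProduct.map_tmul, TensorProduct.map_id, LinearMap.id_apply,
    map_fstHom_sndHom_comul hc hc] at h1
  refine (pairing_dual_mul hH hS x (f ⊗ₜ g)).trans ?_
  refine (congrArg (fun z => (TensorProduct.lid k k).toLinearMap
      (TensorProduct.map H.pairing H.pairing z)) h1).trans ?_
  rw [TensorProduct.map_map]
  rfl

end Pairing

end HopfSuperData

namespace HopfSuperData

open SuperGrading

variable {k : Type*} [Field k]
variable {V W U Y V' W' M N P Q M' N' : Type*} [AddCommGroup V] [Module k V] [AddCommGroup W]
  [Module k W] [AddCommGroup U] [Module k U] [AddCommGroup Y] [Module k Y]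
  [AddCommGroup V'] [Module k V'] [AddCommGroup W'] [Module k W'] [AddCommGroup M] [Module k M]
  [AddCommGroup N] [Module k N] [AddCommGroup P] [Module k P] [AddCommGroup Q] [Module k Q]
  [AddCommGroup M'] [Module k M'] [AddCommGroup N'] [Module k N']
variable {A : HopfSuperData k V} {B : HopfSuperData k W} {C : HopfSuperData k U}
  {D : HopfSuperData k Y} {A' : HopfSuperData k V'} {B' : HopfSuperData k W'}

theorem _root_.SuperGrading.eqOn_deg₃ (GA : SuperGrading k M) (GB : SuperGrading k N)
    (GC : SuperGrading k P) {n : ZMod 2} (f g : M ⊗[k] (N ⊗[k] P) →ₗ[k] Q)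
    (h : ∀ i x j y l z, i + (j + l) = n → f (GA.proj i x ⊗ₜ (GB.proj j y ⊗ₜ GC.proj l z)) =
      g (GA.proj i x ⊗ₜ (GB.proj j y ⊗ₜ GC.proj l z)))
    {t : M ⊗[k] (N ⊗[k] P)} (ht : t ∈ (GA.tensor (GB.tensor GC)).deg n) : f t = g t :=
  eqOn_deg GA (GB.tensor GC) f g (fun i x m w him => eqOn_deg GB GC
    (f ∘ₗ TensorProduct.mk k _ _ (GA.proj i x)) (g ∘ₗ TensorProduct.mk k _ _ (GA.proj i x))
    (fun j y l z hjl => h i x j y l z (hjl.symm ▸ him)) ((GB.tensor GC).proj_mem m w)) ht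

/-! ### The two actions of the double as conjugates of projections. -/

section Actions

variable {H : HopfSuperData k V}

/-- When a counital projection is convolved with a functional, the counit undoes the coproduct of
the discarded factor, so only the other factor is split. -/
theorem ract_fstHom (hB : B.IsSupercoalgebra) (ψ : V ⊗[k] W →ₗ[k] k)
    (x : V) (y : W) : (A.tensor B).ract (fstHom V B) ψ (x ⊗ₜ y) =
      TensorProduct.rid k V (LinearMap.lTensor V ψ (TensorProduct.assoc k V V W (A.comul x ⊗ₜ y))) := by
  have h : (TensorProduct.rid k V).toLinearMap ∘ₗ TensorProduct.map (fstHom V B) ψ ∘ₗ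
      midMap (A.gr.flip B.gr) = (TensorProduct.rid k V).toLinearMap ∘ₗ LinearMap.lTensor V ψ ∘ₗ
        (TensorProduct.assoc k V V W).toLinearMap ∘ₗ LinearMap.lTensor (V ⊗[k] V) (sndHom B W) := by
    refine hom_ext₄ A.gr A.gr B.gr B.gr fun i x j y l z m w => ?_
    simp only [LinearMap.comp_apply, midMap_tmul, flip_proj, map_smul, insertMid_tmul,
      fstHom_tmul, sndHom_tmul, TensorProduct.map_tmul, smul_smul, ← TensorProduct.smul_tmul',
      TensorProduct.tmul_smul, LinearEquiv.coe_coe, TensorProduct.rid_tmul,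
      LinearMap.lTensor_tmul, TensorProduct.assoc_tmul]
    congr 1
    linear_combination (ψ (A.gr.proj j y ⊗ₜ[k] B.gr.proj m w)) *
      paritySign_smul_of_even' hB.counit_even l j z
  have := LinearMap.congr_fun h (A.comul x ⊗ₜ B.comul y)
  simp only [LinearMap.comp_apply, LinearMap.lTensor_tmul, hB.sndHom_comul] at this
  exact this

theorem ract_sndHom (hA : A.IsSupercoalgebra) (ψ : V ⊗[k] W →ₗ[k] k)
    (x : V) (y : W) : (A.tensor B).ract (sndHom A W) ψ (x ⊗ₜ y) =
      TensorProduct.rid k W (LinearMap.lTensor W ψ (TensorProduct.assoc k W V W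
        (LinearMap.rTensor W (A.gr.flip B.gr)
          ((TensorProduct.assoc k V W W).symm (x ⊗ₜ B.comul y))))) := by
  have h : (TensorProduct.rid k W).toLinearMap ∘ₗ TensorProduct.map (sndHom A W) ψ ∘ₗ
      midMap (A.gr.flip B.gr) = (TensorProduct.rid k W).toLinearMap ∘ₗ LinearMap.lTensor W ψ ∘ₗ
        (TensorProduct.assoc k W V W).toLinearMap ∘ₗ LinearMap.rTensor W (A.gr.flip B.gr) ∘ₗ
          (TensorProduct.assoc k V W W).symm.toLinearMap ∘ₗ
          LinearMap.rTensor (W ⊗[k] W) (sndHom A V) := by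
    refine hom_ext₄ A.gr A.gr B.gr B.gr fun i x j y l z m w => ?_
    simp only [LinearMap.comp_apply, midMap_tmul, flip_proj, map_smul, insertMid_tmul,
      sndHom_tmul, TensorProduct.map_tmul, smul_smul, ← TensorProduct.smul_tmul',
      LinearEquiv.coe_coe, TensorProduct.rid_tmul,
      LinearMap.lTensor_tmul, LinearMap.rTensor_tmul, TensorProduct.assoc_tmul,
      TensorProduct.assoc_symm_tmul]
    congr 1
    ring
  have := LinearMap.congr_fun h (A.comul x ⊗ₜ B.comul y)
  simp only [LinearMap.comp_apply, LinearMap.rTensor_tmul, hA.sndHom_comul] at this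
  exact this

variable [FiniteDimensional k V] (hH : H.IsHopfSuperalgebra) (hS : Function.Bijective H.antipode)

include hH in
/-- The right action of the double is `a ⊗ f ↦ ∑ ⟨a', f'⟩ a'' ⟨S⁻¹ a''', f''⟩`. -/
theorem doubleRightAction_eq : H.doubleRightAction hS =
    (H.tensor (H.op hS).dual).conj H.pairing (fstHom V (H.op hS).dual) (H.pairingInv hS) := by
  have hc := hH.toIsSupercoalgebra
  have hX := (hH.op hS).dual
  -- Both sides are expressed through the iterated coproduct of x, which `key` replaces by an
  -- arbitrary triple tensor T, so that homogeneous T suffice.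
  have h1 : ∀ x f, H.doubleRightAction hS (x ⊗ₜ f) =
      (TensorProduct.lid k V) (LinearMap.rTensor V (contractLeft k V)
        ((TensorProduct.assoc k (Module.Dual k V) V V).symm
          (LinearMap.lTensor (Module.Dual k V) (LinearMap.rTensor V H.mul ∘ₗ
            LinearMap.rTensor V (LinearMap.rTensor V (H.antipodeInv hS)) ∘ₗ
            (TensorProduct.assoc k V V V).symm.toLinearMap ∘ₗ
            (H.gr.tensor H.gr).flip H.gr ∘ₗ
            (TensorProduct.assoc k V V V).symm.toLinearMap)
          ((H.gr.tensor (H.gr.tensor H.gr)).flip H.gr.dual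
            (TensorProduct.map LinearMap.id H.comul (H.comul x) ⊗ₜ f))))) := by
    intro x f
    have h2 := flip_map ((IsEven.lTensor hc.comul_even).comp hc.comul_even)
      (IsEven.id (GA := H.gr.dual)) (x ⊗ₜ f)
    rw [TensorProduct.map_tmul] at h2
    refine Eq.trans ?_ (congrArg (fun z => (TensorProduct.lid k V)
      (LinearMap.rTensor V (contractLeft k V)
        ((TensorProduct.assoc k (Module.Dual k V) V V).symm
          (LinearMap.lTensor (Module.Dual k V) (LinearMap.rTensor V H.mul ∘ₗ
            LinearMap.rTensor V (LinearMap.rTensor V (H.antipodeInv hS)) ∘ₗ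
            (TensorProduct.assoc k V V V).symm.toLinearMap ∘ₗ
            (H.gr.tensor H.gr).flip H.gr ∘ₗ
            (TensorProduct.assoc k V V V).symm.toLinearMap) z)))) h2.symm)
    change _ = (TensorProduct.lid k V) (LinearMap.rTensor V (contractLeft k V)
        ((TensorProduct.assoc k (Module.Dual k V) V V).symm
          (LinearMap.lTensor _ _ (LinearMap.lTensor _ _ _))))
    rw [← LinearMap.comp_apply (LinearMap.lTensor _ _) (LinearMap.lTensor _ _),
      ← LinearMap.lTensor_comp]
    rfl
  have h2 : ∀ x f, (H.tensor (H.op hS).dual).conj H.pairing (fstHom V (H.op hS).dual)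
      (H.pairingInv hS) (x ⊗ₜ f) = (TensorProduct.lid k V) (TensorProduct.map H.pairing
        ((TensorProduct.rid k V).toLinearMap ∘ₗ LinearMap.lTensor V (H.pairingInv hS) ∘ₗ
          (TensorProduct.assoc k V V (Module.Dual k V)).toLinearMap)
        (midMap ((H.gr.tensor H.gr).flip H.gr.dual)
          (TensorProduct.map LinearMap.id H.comul (H.comul x) ⊗ₜ (H.op hS).dual.comul f))) := by
    intro x f
    have h3 : (H.tensor (H.op hS).dual).ract (fstHom V (H.op hS).dual) (H.pairingInv hS) =
        ((TensorProduct.rid k V).toLinearMap ∘ₗ LinearMap.lTensor V (H.pairingInv hS) ∘ₗ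
          (TensorProduct.assoc k V V (Module.Dual k V)).toLinearMap) ∘ₗ
            TensorProduct.map H.comul LinearMap.id :=
      TensorProduct.ext' fun x f => ract_fstHom hX.toIsSupercoalgebra _ x f
    have h4 := midMap_flip_map hc.comul_even (IsEven.id (GA := H.gr.dual))
      (LinearMap.id : V →ₗ[k] V) (LinearMap.id : Module.Dual k V →ₗ[k] Module.Dual k V)
      (H.comul x ⊗ₜ (H.op hS).dual.comul f)
    rw [TensorProduct.map_tmul, TensorProduct.map_id, TensorProduct.map_id,
      LinearMap.id_apply] at h4
    rw [h4, conj, h3, lact, conv, LinearMap.comp_apply, LinearMap.comp_apply,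
      TensorProduct.map_map, LinearMap.comp_id]
    rfl
  have key : ∀ T f, (TensorProduct.lid k V) (LinearMap.rTensor V (contractLeft k V)
        ((TensorProduct.assoc k (Module.Dual k V) V V).symm
          (LinearMap.lTensor (Module.Dual k V) (LinearMap.rTensor V H.mul ∘ₗ
            LinearMap.rTensor V (LinearMap.rTensor V (H.antipodeInv hS)) ∘ₗ
            (TensorProduct.assoc k V V V).symm.toLinearMap ∘ₗ
            (H.gr.tensor H.gr).flip H.gr ∘ₗ
            (TensorProduct.assoc k V V V).symm.toLinearMap)
          ((H.gr.tensor (H.gr.tensor H.gr)).flip H.gr.dual (T ⊗ₜ f))))) =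
      (TensorProduct.lid k V) (TensorProduct.map H.pairing
        ((TensorProduct.rid k V).toLinearMap ∘ₗ LinearMap.lTensor V (H.pairingInv hS) ∘ₗ
          (TensorProduct.assoc k V V (Module.Dual k V)).toLinearMap)
        (midMap ((H.gr.tensor H.gr).flip H.gr.dual) (T ⊗ₜ (H.op hS).dual.comul f))) := by
    have key' : (TensorProduct.lid k V).toLinearMap ∘ₗ LinearMap.rTensor V (contractLeft k V) ∘ₗ
        (TensorProduct.assoc k (Module.Dual k V) V V).symm.toLinearMap ∘ₗ
          LinearMap.lTensor (Module.Dual k V) (LinearMap.rTensor V H.mul ∘ₗ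
            LinearMap.rTensor V (LinearMap.rTensor V (H.antipodeInv hS)) ∘ₗ
            (TensorProduct.assoc k V V V).symm.toLinearMap ∘ₗ
            (H.gr.tensor H.gr).flip H.gr ∘ₗ
            (TensorProduct.assoc k V V V).symm.toLinearMap) ∘ₗ
          (H.gr.tensor (H.gr.tensor H.gr)).flip H.gr.dual =
        (TensorProduct.lid k V).toLinearMap ∘ₗ TensorProduct.map H.pairing
          ((TensorProduct.rid k V).toLinearMap ∘ₗ LinearMap.lTensor V (H.pairingInv hS) ∘ₗ
            (TensorProduct.assoc k V V (Module.Dual k V)).toLinearMap) ∘ₗ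
          midMap ((H.gr.tensor H.gr).flip H.gr.dual) ∘ₗ
            LinearMap.lTensor (V ⊗[k] (V ⊗[k] V)) (H.op hS).dual.comul := by
      refine TensorProduct.ext (hom_ext₃' H.gr H.gr H.gr fun p x q y r z =>
        H.gr.dual.hom_ext fun n f => ?_)
      have e1 : (H.gr.tensor (H.gr.tensor H.gr)).flip H.gr.dual
          ((H.gr.proj p x ⊗ₜ (H.gr.proj q y ⊗ₜ H.gr.proj r z)) ⊗ₜ H.gr.dual.proj n f) =
          paritySign k ((p + (q + r)) * n) • (H.gr.dual.proj n f ⊗ₜ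
            (H.gr.proj p x ⊗ₜ (H.gr.proj q y ⊗ₜ H.gr.proj r z))) := by
        rw [flip_tmul _ _ (tmul_mem (H.gr.proj_mem p x) (tmul_mem (H.gr.proj_mem q y)
          (H.gr.proj_mem r z))) (H.gr.dual.proj_mem n f), koszulSign_eq_paritySign]
      -- Up to sign, S⁻¹(a''') a' is the opposite product of a' and S⁻¹(a'''). By duality its
      -- evaluation against f is therefore a pairing with f' ⊗ f''.
      have e2 := pairing_op_mul hH hS (H.gr.proj p x ⊗ₜ H.gr.proj r (H.antipodeInv hS z))
        (H.gr.dual.proj n f)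
      rw [op_mul, flip_proj, map_smul, ← TensorProduct.smul_tmul', map_smul,
        pairing_proj_right] at e2
      have hm : (H.op hS).dual.comul (H.gr.dual.proj n f) ∈ (H.gr.dual.tensor H.gr.dual).deg n :=
        hX.comul_mem n _ (H.gr.dual.proj_mem n f)
      simp only [LinearMap.compr₂ₛₗ_apply, LinearMap.comp_apply, TensorProduct.mk_apply, e1,
        map_smul, LinearMap.lTensor_tmul, LinearEquiv.coe_coe, TensorProduct.assoc_symm_tmul,
        flip_tensor_left, LinearMap.rTensor_tmul, (hH.antipodeInv_even hS).map_proj,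
        TensorProduct.tmul_smul, contractLeft_apply,
        TensorProduct.lid_tmul]
      generalize (H.op hS).dual.comul (H.gr.dual.proj n f) = u at *
      generalize (H.gr.dual.proj n f) (H.mul (H.gr.proj r (H.antipodeInv hS z) ⊗ₜ
        H.gr.proj p x)) = c at *
      have e3 : c = paritySign k (n + p * r) * H.pairing₂
          ((H.gr.proj p x ⊗ₜ H.gr.proj r (H.antipodeInv hS z)) ⊗ₜ u) := by
        rw [← e2, smul_eq_mul, ← mul_assoc, ← mul_assoc, paritySign_mul, paritySign_mul,
          show n + p * r + p * r + n = 0 by grind, paritySign_zero, one_mul]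
      rw [e3]
      refine eqOn_deg H.gr.dual H.gr.dual
        (paritySign k ((p + (q + r)) * n) • paritySign k ((p + q) * r) •
          (LinearMap.toSpanSingleton k V (H.gr.proj q y) ∘ₗ (paritySign k (n + p * r) •
            H.pairing₂ ∘ₗ TensorProduct.mk k _ _
              (H.gr.proj p x ⊗ₜ H.gr.proj r (H.antipodeInv hS z)))))
        ((TensorProduct.lid k V).toLinearMap ∘ₗ TensorProduct.map H.pairing
          ((TensorProduct.rid k V).toLinearMap ∘ₗ LinearMap.lTensor V (H.pairingInv hS) ∘ₗ
            (TensorProduct.assoc k V V (Module.Dual k V)).toLinearMap) ∘ₗ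
          midMap ((H.gr.tensor H.gr).flip H.gr.dual) ∘ₗ TensorProduct.mk k _ _
            (H.gr.proj p x ⊗ₜ (H.gr.proj q y ⊗ₜ H.gr.proj r z)))
        (fun j g l h hjl => ?_) hm
      subst hjl
      simp only [LinearMap.comp_apply, LinearMap.smul_apply, TensorProduct.mk_apply, pairing₂,
        midMap_tmul, flip_proj, flip_tensor_left, map_smul, insertMid_tmul,
        TensorProduct.map_tmul, LinearEquiv.coe_coe, TensorProduct.lid_tmul,
        TensorProduct.rid_tmul, LinearMap.lTensor_tmul, TensorProduct.assoc_tmul, pairingInv,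
        LinearMap.rTensor_tmul, (hH.antipodeInv_even hS).map_proj, pairing_proj_proj,
        LinearMap.toSpanSingleton_apply, smul_smul, smul_eq_mul]
      by_cases h1 : j = p
      · by_cases h2 : l = r
        · subst h1 h2
          simp only [if_true, ← mul_assoc, paritySign_mul]
          have e : ∀ j q l : ZMod 2, (j + (q + l)) * (j + l) + (j + q) * l +
              (j + l + j * l + (l * j + j)) = (q + l) * j + j := by decide
          rw [e]
        · simp [h2]
      · simp [h1]
    exact fun T f => LinearMap.congr_fun key' (T ⊗ₜ f)
  refine TensorProduct.ext' fun x f => ?_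
  rw [h1, h2, key]

omit [FiniteDimensional k V] in
-- Brings S⁻¹(a'') x a' to the form a' · (x · S⁻¹(a'')) in H^op, the order in which the factors meet
-- f', f'' and f'''.
theorem IsSuperalgebra.mul_mul_eq_op_mul (hH : H.IsSuperalgebra) (i j l : ZMod 2) (x y z : V) :
    H.mul (H.mul (H.gr.proj i x ⊗ₜ H.gr.proj j y) ⊗ₜ H.gr.proj l z) =
      paritySign k (i * j + (i + j) * l) • (H.op hS).mul (H.gr.proj l z ⊗ₜ
        (H.op hS).mul (H.gr.proj j y ⊗ₜ H.gr.proj i x)) := by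
  have h := proj_eq_self (hH.mul_mem i j _ (H.gr.proj_mem i x) _ (H.gr.proj_mem j y))
  generalize hm : H.mul (H.gr.proj i x ⊗ₜ H.gr.proj j y) = m at h
  rw [op_mul, op_mul, flip_proj, map_smul, hm, TensorProduct.tmul_smul, map_smul, map_smul, ← h,
    flip_proj, map_smul, smul_smul, smul_smul, paritySign_mul, paritySign_mul]
  have : ∀ i j l : ZMod 2, i * j + (i + j) * l + j * i + l * (i + j) = 0 := by decide
  rw [this, paritySign_zero, one_smul]

include hH in
/-- The left action of the double is `a ⊗ f ↦ ∑ ⟨a', f'⟩ f'' ⟨S⁻¹ a'', f'''⟩`, up to signs. -/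
theorem doubleLeftAction_eq : H.doubleLeftAction hS =
    (H.tensor (H.op hS).dual).conj H.pairing (sndHom H (Module.Dual k V)) (H.pairingInv hS) := by
  have hc := hH.toIsSupercoalgebra
  have hX := (hH.op hS).dual
  -- `ca` is the conjugation with the coproduct of a replaced by a free tensor, and `la` evaluates a
  -- functional after `ca`. `ra` is the right action by the inverse pairing with the coproduct of
  -- the functional left free.
  let ca : (V ⊗[k] V) ⊗[k] V →ₗ[k] V := H.mul ∘ₗ LinearMap.rTensor V H.mul ∘ₗ
    LinearMap.rTensor V (LinearMap.rTensor V (H.antipodeInv hS)) ∘ₗ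
    (TensorProduct.assoc k V V V).symm.toLinearMap ∘ₗ
    LinearMap.lTensor V (H.gr.flip H.gr) ∘ₗ
    (TensorProduct.assoc k V V V).toLinearMap ∘ₗ
    LinearMap.rTensor V (H.gr.flip H.gr)
  let la : Module.Dual k V ⊗[k] (V ⊗[k] V) →ₗ[k] Module.Dual k V :=
    TensorProduct.lift (LinearMap.lcomp k (Module.Dual k V) (TensorProduct.curry ca) ∘ₗ
      LinearMap.llcomp k V V k)
  let ra : V ⊗[k] (Module.Dual k V ⊗[k] Module.Dual k V) →ₗ[k] Module.Dual k V :=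
    (TensorProduct.rid k _).toLinearMap ∘ₗ LinearMap.lTensor _ (H.pairingInv hS) ∘ₗ
        (TensorProduct.assoc k _ V _).toLinearMap ∘ₗ LinearMap.rTensor _ (H.gr.flip H.gr.dual) ∘ₗ
          (TensorProduct.assoc k V _ _).symm.toLinearMap
  have h1 : ∀ a f, H.doubleLeftAction hS (a ⊗ₜ f) =
      la ((H.gr.tensor H.gr).flip H.gr.dual (H.comul a ⊗ₜ f)) := by
    intro a f
    have h2 := flip_map hc.comul_even (IsEven.id (GA := H.gr.dual)) (a ⊗ₜ f)
    rw [TensorProduct.map_tmul, LinearMap.id_apply] at h2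
    rw [h2]
    have h3 : TensorProduct.lift
        (LinearMap.lcomp k (Module.Dual k V) (TensorProduct.curry (H.conjAction hS)) ∘ₗ
          LinearMap.llcomp k V V k) = la ∘ₗ TensorProduct.map LinearMap.id H.comul := by
      ext f a x
      rfl
    exact (LinearMap.congr_fun h3 (H.gr.flip H.gr.dual (a ⊗ₜ f)) :)
  have h2 : ∀ a f, (H.tensor (H.op hS).dual).conj H.pairing (sndHom H (Module.Dual k V))
      (H.pairingInv hS) (a ⊗ₜ f) = (TensorProduct.lid k _) (TensorProduct.map H.pairing ra
        (midMap (D := Module.Dual k V ⊗[k] Module.Dual k V) (H.gr.flip H.gr.dual) (H.comul a ⊗ₜ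
          TensorProduct.map (LinearMap.id : Module.Dual k V →ₗ[k] _) (H.op hS).dual.comul ((H.op hS).dual.comul f)))) := by
    intro a f
    have h3 : (H.tensor (H.op hS).dual).ract (sndHom H (Module.Dual k V)) (H.pairingInv hS) =
        ra ∘ₗ TensorProduct.map LinearMap.id (H.op hS).dual.comul :=
      TensorProduct.ext' fun x f => ract_sndHom hc _ x f
    have h4 := midMap_flip_map (D' := Module.Dual k V ⊗[k] Module.Dual k V) (IsEven.id (GA := H.gr)) (IsEven.id (GA := H.gr.dual))
      (LinearMap.id : V →ₗ[k] V) (H.op hS).dual.comul (H.comul a ⊗ₜ (H.op hS).dual.comul f)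
    rw [TensorProduct.map_tmul, TensorProduct.map_id, TensorProduct.map_id,
      LinearMap.id_apply] at h4
    rw [h4, conj, h3, lact, conv, LinearMap.comp_apply, LinearMap.comp_apply,
      TensorProduct.map_map, LinearMap.comp_id]
    rfl
  -- A product in H^op in the second slot splits the functional paired with it once more, which
  -- produces the third leg of the coproduct of f.
  have h3 : ∀ (a : V) (t : V ⊗[k] V) (u : Module.Dual k V ⊗[k] Module.Dual k V),
      H.pairing₂ ((a ⊗ₜ (H.op hS).mul t) ⊗ₜ u) = (TensorProduct.lid k k)
        (TensorProduct.map H.pairing H.pairing₂ (midMap (D := Module.Dual k V ⊗[k] Module.Dual k V)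
            ((H.gr.tensor H.gr).flip H.gr.dual)
          ((a ⊗ₜ t) ⊗ₜ TensorProduct.map LinearMap.id (H.op hS).dual.comul u))) := by
    intro a t u
    have h4 := midMap_flip_map (hH.op hS).mul_even (IsEven.id (GA := H.gr.dual))
      (LinearMap.id : V →ₗ[k] V) (LinearMap.id : Module.Dual k V →ₗ[k] _) ((a ⊗ₜ t) ⊗ₜ u)
    have h5 := midMap_flip_map (D' := Module.Dual k V ⊗[k] Module.Dual k V) (IsEven.id (GA := H.gr.tensor H.gr)) (IsEven.id (GA := H.gr.dual))
      (LinearMap.id : V →ₗ[k] V) (H.op hS).dual.comul ((a ⊗ₜ t) ⊗ₜ u)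
    have h6 : H.pairing ∘ₗ TensorProduct.map (H.op hS).mul LinearMap.id =
        H.pairing₂ ∘ₗ TensorProduct.map LinearMap.id (H.op hS).dual.comul :=
      TensorProduct.ext' fun t f => pairing_op_mul hH hS t f
    rw [TensorProduct.map_tmul, TensorProduct.map_id, TensorProduct.map_id,
      LinearMap.id_apply] at h5
    rw [TensorProduct.map_tmul, TensorProduct.map_tmul, TensorProduct.map_id,
      LinearMap.id_apply, LinearMap.id_apply] at h4
    rw [h5, TensorProduct.map_map, ← h6, LinearMap.comp_id]
    refine (congrArg (fun z => TensorProduct.lid k k (TensorProduct.map H.pairing H.pairing z))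
      h4).trans ?_
    rw [TensorProduct.map_map, TensorProduct.map_id, LinearMap.comp_id]
    rfl
  have key : ∀ T f, la ((H.gr.tensor H.gr).flip H.gr.dual (T ⊗ₜ f)) =
      (TensorProduct.lid k _) (TensorProduct.map H.pairing ra
        (midMap (D := Module.Dual k V ⊗[k] Module.Dual k V) (H.gr.flip H.gr.dual) (T ⊗ₜ
          TensorProduct.map (LinearMap.id : Module.Dual k V →ₗ[k] _) (H.op hS).dual.comul ((H.op hS).dual.comul f)))) := by
    have key' : la ∘ₗ (H.gr.tensor H.gr).flip H.gr.dual = (TensorProduct.lid k _).toLinearMap ∘ₗ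
        TensorProduct.map H.pairing ra ∘ₗ midMap (D := Module.Dual k V ⊗[k] Module.Dual k V) (H.gr.flip H.gr.dual) ∘ₗ
          LinearMap.lTensor _ (TensorProduct.map LinearMap.id (H.op hS).dual.comul ∘ₗ
            (H.op hS).dual.comul) := by
      refine hom_ext₃ H.gr H.gr H.gr.dual fun p a q b n f => H.gr.hom_ext fun i x => ?_
      have hm : TensorProduct.map (LinearMap.id : Module.Dual k V →ₗ[k] _) (H.op hS).dual.comul
          ((H.op hS).dual.comul (H.gr.dual.proj n f)) ∈
            (H.gr.dual.tensor (H.gr.dual.tensor H.gr.dual)).deg n :=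
        (IsEven.id.map hX.comul_even) n _ (hX.comul_mem n _ (H.gr.dual.proj_mem n f))
      have e1 : (H.gr.dual.proj n f) (ca ((H.gr.proj p a ⊗ₜ H.gr.proj q b) ⊗ₜ H.gr.proj i x)) =
          paritySign k (p * q + p * i + q * i + (q + i) * p + n) *
            H.pairing₂ ((H.gr.proj p a ⊗ₜ (H.op hS).mul (H.gr.proj i x ⊗ₜ
              H.gr.proj q (H.antipodeInv hS b))) ⊗ₜ (H.op hS).dual.comul (H.gr.dual.proj n f)) := by
        rw [← pairing_op_mul hH hS, pairing_proj_right]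
        have e3 : ca ((H.gr.proj p a ⊗ₜ H.gr.proj q b) ⊗ₜ H.gr.proj i x) =
            paritySign k (p * q + p * i) • H.mul (H.mul (H.gr.proj q (H.antipodeInv hS b) ⊗ₜ
              H.gr.proj i x) ⊗ₜ H.gr.proj p a) := by
          simp [ca, (hH.antipodeInv_even hS).map_proj, ← TensorProduct.smul_tmul', smul_smul,
            paritySign_mul]
        rw [e3, hH.mul_mul_eq_op_mul hS, map_smul, map_smul, smul_eq_mul, smul_eq_mul,
          ← mul_assoc, ← mul_assoc, paritySign_mul, paritySign_mul]
        congr 2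
        have : ∀ p q i n : ZMod 2, p * q + p * i + (q * i + (q + i) * p) =
          p * q + p * i + q * i + (q + i) * p + n + n := by decide
        exact this p q i n
      have e2 : (la ∘ₗ (H.gr.tensor H.gr).flip H.gr.dual)
          ((H.gr.proj p a ⊗ₜ H.gr.proj q b) ⊗ₜ H.gr.dual.proj n f) (H.gr.proj i x) = 
          paritySign k ((p + q) * n) * (H.gr.dual.proj n f)
            (ca ((H.gr.proj p a ⊗ₜ H.gr.proj q b) ⊗ₜ H.gr.proj i x)) := by
        rw [LinearMap.comp_apply, flip_tensor_left, map_smul]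
        rfl
      rw [h3] at e1
      rw [e2, e1]
      simp only [LinearMap.comp_apply, LinearMap.lTensor_tmul]
      generalize TensorProduct.map (LinearMap.id : Module.Dual k V →ₗ[k] _) (H.op hS).dual.comul
          ((H.op hS).dual.comul (H.gr.dual.proj n f)) = u at hm ⊢
      refine eqOn_deg₃ H.gr.dual H.gr.dual H.gr.dual
        (paritySign k ((p + q) * n) • paritySign k (p * q + p * i + q * i + (q + i) * p + n) •
          (TensorProduct.lid k k).toLinearMap ∘ₗ TensorProduct.map H.pairing H.pairing₂ ∘ₗ
            midMap (D := Module.Dual k V ⊗[k] Module.Dual k V)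
            ((H.gr.tensor H.gr).flip H.gr.dual) ∘ₗ TensorProduct.mk k _ _
              (H.gr.proj p a ⊗ₜ (H.gr.proj i x ⊗ₜ H.gr.proj q (H.antipodeInv hS b))))
        (LinearMap.applyₗ (H.gr.proj i x) ∘ₗ (TensorProduct.lid k _).toLinearMap ∘ₗ
          TensorProduct.map H.pairing ra ∘ₗ
            midMap (D := Module.Dual k V ⊗[k] Module.Dual k V) (H.gr.flip H.gr.dual) ∘ₗ
              TensorProduct.mk k _ _ (H.gr.proj p a ⊗ₜ H.gr.proj q b))
        (fun j g c u d v hn => ?_) hm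
      subst hn
      simp only [LinearMap.comp_apply, LinearMap.smul_apply, TensorProduct.mk_apply, pairing₂,
        midMap_tmul, flip_proj, flip_tensor_left, map_smul, insertMid_tmul,
        TensorProduct.map_tmul, LinearEquiv.coe_coe, TensorProduct.lid_tmul, ra,
        TensorProduct.assoc_symm_tmul, ← TensorProduct.smul_tmul', LinearMap.applyₗ_apply_apply,
        TensorProduct.rid_tmul, LinearMap.lTensor_tmul, TensorProduct.assoc_tmul, pairingInv,
        LinearMap.rTensor_tmul, (hH.antipodeInv_even hS).map_proj, pairing_proj_proj,
        dual_proj_proj, smul_smul, smul_eq_mul]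
      by_cases h1 : j = p
      · by_cases h2 : c = i
        · by_cases h3 : d = q
          · subst h1 h2 h3
            simp only [if_true]
            have e : paritySign k ((j + d) * (j + (c + d))) *
                paritySign k (j * d + j * c + d * c + (d + c) * j + (j + (c + d))) *
                paritySign k ((c + d) * j) * paritySign k c = paritySign k (d * j) := by
              rw [paritySign_mul, paritySign_mul, paritySign_mul]
              congr 1
              clear e1 e2 hm
              revert j c d
              decide
            rw [← e]
            ring
          · simp [h3]
        · simp [h2]
      · simp [h1]
    exact fun T f => LinearMap.congr_fun key' (T ⊗ₜ f)
  refine TensorProduct.ext' fun x f => ?_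
  rw [h1, h2, key]

end Actions

end HopfSuperData

namespace HopfSuperData

open SuperGrading

variable {k : Type*} [Field k]
variable {V W U Y V' W' M N P Q M' N' : Type*} [AddCommGroup V] [Module k V] [AddCommGroup W]
  [Module k W] [AddCommGroup U] [Module k U] [AddCommGroup Y] [Module k Y]
  [AddCommGroup V'] [Module k V'] [AddCommGroup W'] [Module k W'] [AddCommGroup M] [Module k M]
  [AddCommGroup N] [Module k N] [AddCommGroup P] [Module k P] [AddCommGroup Q] [Module k Q]
  [AddCommGroup M'] [Module k M'] [AddCommGroup N'] [Module k N']
variable {A : HopfSuperData k V} {B : HopfSuperData k W} {C : HopfSuperData k U}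
  {D : HopfSuperData k Y} {A' : HopfSuperData k V'} {B' : HopfSuperData k W'}

/-! ### Twisting the product of a superbialgebra by a 2-cocycle. -/

section Twist

variable {φ φ' ψ ψ' : V →ₗ[k] k}

/-- All adjacent factors φ' * φ cancel. It is used for iterated twisted products: the twist of the
outer product is pulled back along an inner product that is already conjugated. -/
theorem IsConvInverse.conj_conj_conj (h : IsConvInverse A φ φ') (hA : A.IsSupercoalgebra)
    (f : V →ₗ[k] M) : A.conj (A.conj φ ψ φ') (A.conj φ f φ') (A.conj φ ψ' φ') =
      A.conj (A.lact φ ψ) f (A.lact ψ' φ') := by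
  simp only [conj, ract_scalar, lact_lact hA, ract_lact hA, ract_ract hA, h.inv_lact hA]

theorem counit_conj_counit (hA : A.IsSupercoalgebra) (f : V →ₗ[k] M) :
    A.conj A.counit f A.counit = f := by
  rw [conj, counit_lact hA, ract_counit hA]

theorem isConvInverse_counit (hA : A.IsSupercoalgebra) : IsConvInverse A A.counit A.counit :=
  ⟨hA.counit_even, hA.counit_even, counit_lact hA _, counit_lact hA _⟩

theorem lact_fstHom_sndHom (hA : A.IsSupercoalgebra) (hB : B.IsSupercoalgebra)
    (φ : V →ₗ[k] k) (ψ : W →ₗ[k] k) :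
    (A.tensor B).lact (φ ∘ₗ fstHom V B) (ψ ∘ₗ sndHom A W) =
      (TensorProduct.lid k k).toLinearMap ∘ₗ TensorProduct.map φ ψ := by
  refine LinearMap.ext fun t => ?_
  have h := map_fstHom_sndHom_comul hA hB t
  simp only [lact, conv, LinearMap.comp_apply, TensorProduct.map_comp, h]

/-- Functionals on different tensor factors commute for convolution: exchanging the order introduces
a flip, whose sign is trivial because φ is even. -/
theorem lact_sndHom_fstHom (hA : A.IsSupercoalgebra) (hB : B.IsSupercoalgebra)
    {φ : V →ₗ[k] k} (ψ : W →ₗ[k] k) (hφ : IsEven A.gr (scalar k) φ) :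
    (A.tensor B).lact (ψ ∘ₗ sndHom A W) (φ ∘ₗ fstHom V B) =
      (A.tensor B).lact (φ ∘ₗ fstHom V B) (ψ ∘ₗ sndHom A W) := by
  rw [lact_fstHom_sndHom hA hB]
  refine LinearMap.ext fun t => ?_
  have h := map_sndHom_fstHom_comul hA hB t
  simp only [lact, conv, LinearMap.comp_apply, TensorProduct.map_comp, h]
  have h2 : (TensorProduct.lid k k).toLinearMap ∘ₗ TensorProduct.map ψ φ ∘ₗ A.gr.flip B.gr =
      (TensorProduct.lid k k).toLinearMap ∘ₗ TensorProduct.map φ ψ := by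
    refine hom_ext₂ A.gr B.gr fun i x j y => ?_
    simp only [LinearMap.comp_apply, flip_proj, map_smul, TensorProduct.map_tmul,
      LinearEquiv.coe_coe, TensorProduct.lid_tmul, smul_eq_mul]
    linear_combination (ψ (B.gr.proj j y)) * paritySign_smul_of_even hφ i j x
  exact LinearMap.congr_fun h2 t

/-- The product of `A` twisted by a functional `σ` on `A ⊗ A` with inverse `σ'`. -/
def twistMul (A : HopfSuperData k V) (σ σ' : V ⊗[k] V →ₗ[k] k) : V ⊗[k] V →ₗ[k] V :=
  (A.tensor A).conj σ A.mul σ'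

variable {σ σ' : V ⊗[k] V →ₗ[k] k}

/-- Each bracketing is the untwisted triple product conjugated by a product of two pullbacks of σ.
The hypothesis `hσ`, the 2-cocycle identity, says that the two conjugating functionals agree; their
inverses then agree by uniqueness. -/
theorem twistMul_assoc (hA : A.IsSuperbialgebra) (h : IsConvInverse (A.tensor A) σ σ')
    (hσ : ((A.tensor A).tensor A).lact (σ ∘ₗ fstHom (V ⊗[k] V) A)
        (σ ∘ₗ LinearMap.rTensor V A.mul) =
      ((A.tensor A).tensor A).lact (σ ∘ₗ sndHom A (V ⊗[k] V) ∘ₗ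
        (TensorProduct.assoc k V V V).toLinearMap)
        (σ ∘ₗ LinearMap.lTensor V A.mul ∘ₗ (TensorProduct.assoc k V V V).toLinearMap))
    (x y z : V) : A.twistMul σ σ' (A.twistMul σ σ' (x ⊗ₜ y) ⊗ₜ z) =
      A.twistMul σ σ' (x ⊗ₜ A.twistMul σ σ' (y ⊗ₜ z)) := by
  have hc := hA.toIsSupercoalgebra
  have hAA := hc.tensor hc
  have hT := hAA.tensor hc
  have hm := h.isCoalgHom_conj hAA hA.isCoalgHom_mul
  have hf : IsCoalgHom ((A.tensor A).tensor A) (A.tensor A) (fstHom (V ⊗[k] V) A) :=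
    isCoalgHom_fstHom hc
  have ha : IsCoalgHom ((A.tensor A).tensor A) (A.tensor (A.tensor A))
    (TensorProduct.assoc k V V V).toLinearMap := IsCoalgHom.assoc
  have hs : IsCoalgHom ((A.tensor A).tensor A) (A.tensor A) (sndHom A (V ⊗[k] V) ∘ₗ
      (TensorProduct.assoc k V V V).toLinearMap) := (isCoalgHom_sndHom hc).comp ha
  have hr : IsCoalgHom ((A.tensor A).tensor A) (A.tensor A) (LinearMap.rTensor V A.mul) :=
    hA.isCoalgHom_mul.rTensor
  have hl : IsCoalgHom ((A.tensor A).tensor A) (A.tensor A) (LinearMap.lTensor V A.mul ∘ₗ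
      (TensorProduct.assoc k V V V).toLinearMap) := hA.isCoalgHom_mul.lTensor.comp ha
  have h1 : A.twistMul σ σ' ∘ₗ LinearMap.rTensor V (A.twistMul σ σ') =
      ((A.tensor A).tensor A).conj (((A.tensor A).tensor A).lact (σ ∘ₗ fstHom (V ⊗[k] V) A)
        (σ ∘ₗ LinearMap.rTensor V A.mul)) (A.mul ∘ₗ LinearMap.rTensor V A.mul)
        (((A.tensor A).tensor A).lact (σ' ∘ₗ LinearMap.rTensor V A.mul)
          (σ' ∘ₗ fstHom (V ⊗[k] V) A)) := by
    rw [twistMul, hm.rTensor.conj_comp, h.rTensor_conj hc, comp_conj, comp_conj, comp_conj,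
      (h.comp hf).conj_conj_conj hT]
  have h2 : A.twistMul σ σ' ∘ₗ LinearMap.lTensor V (A.twistMul σ σ') ∘ₗ
        (TensorProduct.assoc k V V V).toLinearMap =
      ((A.tensor A).tensor A).conj (((A.tensor A).tensor A).lact (σ ∘ₗ sndHom A (V ⊗[k] V) ∘ₗ
        (TensorProduct.assoc k V V V).toLinearMap)
        (σ ∘ₗ LinearMap.lTensor V A.mul ∘ₗ (TensorProduct.assoc k V V V).toLinearMap))
        (A.mul ∘ₗ LinearMap.lTensor V A.mul ∘ₗ (TensorProduct.assoc k V V V).toLinearMap)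
        (((A.tensor A).tensor A).lact
          (σ' ∘ₗ LinearMap.lTensor V A.mul ∘ₗ (TensorProduct.assoc k V V V).toLinearMap)
          (σ' ∘ₗ sndHom A (V ⊗[k] V) ∘ₗ (TensorProduct.assoc k V V V).toLinearMap)) := by
    rw [twistMul, (hm.lTensor.comp ha).conj_comp, h.lTensor_conj hc, ha.conj_comp, comp_conj,
      comp_conj, comp_conj]
    exact (h.comp hs).conj_conj_conj hT _
  have i1 := (h.comp hf).mul (h.comp hr) hT
  have i2 := (h.comp hs).mul (h.comp hl) hT
  have e : A.mul ∘ₗ LinearMap.rTensor V A.mul =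
      A.mul ∘ₗ LinearMap.lTensor V A.mul ∘ₗ (TensorProduct.assoc k V V V).toLinearMap := by
    ext x y z
    exact hA.mul_assoc x y z
  rw [hσ, i1.unique (hσ ▸ i2) hT, e] at h1
  exact LinearMap.congr_fun (h1.trans h2.symm) ((x ⊗ₜ y) ⊗ₜ z)

/-- Along the coalgebra morphism x ↦ 1 ⊗ x the functional σ, and hence its inverse, restricts to the
counit, so the conjugation becomes trivial. -/
theorem twistMul_one_left (hA : A.IsSuperbialgebra) (h : IsConvInverse (A.tensor A) σ σ')
    (hσ : ∀ x, σ (A.one ⊗ₜ x) = A.counit x) (x : V) : A.twistMul σ σ' (A.one ⊗ₜ x) = x := by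
  have hi : IsCoalgHom A (A.tensor A) (TensorProduct.mk k V V A.one) := isCoalgHom_inr hA
  have h1 : σ ∘ₗ TensorProduct.mk k V V A.one = A.counit := LinearMap.ext hσ
  have h2 := h.comp hi
  rw [h1] at h2
  have h3 := h2.unique (isConvInverse_counit hA.toIsSupercoalgebra) hA.toIsSupercoalgebra
  have h4 := hi.conj_comp σ σ' A.mul
  rw [h1, h3, counit_conj_counit hA.toIsSupercoalgebra] at h4
  exact (LinearMap.congr_fun h4 x).trans (hA.one_mul x)

theorem twistMul_one_right (hA : A.IsSuperbialgebra) (h : IsConvInverse (A.tensor A) σ σ')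
    (hσ : ∀ x, σ (x ⊗ₜ A.one) = A.counit x) (x : V) : A.twistMul σ σ' (x ⊗ₜ A.one) = x := by
  have hi : IsCoalgHom A (A.tensor A) ((TensorProduct.mk k V V).flip A.one) := isCoalgHom_inl hA
  have h1 : σ ∘ₗ (TensorProduct.mk k V V).flip A.one = A.counit := LinearMap.ext hσ
  have h2 := h.comp hi
  rw [h1] at h2
  have h3 := h2.unique (isConvInverse_counit hA.toIsSupercoalgebra) hA.toIsSupercoalgebra
  have h4 := hi.conj_comp σ σ' A.mul
  rw [h1, h3, counit_conj_counit hA.toIsSupercoalgebra] at h4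
  exact (LinearMap.congr_fun h4 x).trans (hA.mul_one x)

/-- The coalgebra is untouched and the new product is a conjugate of a coalgebra morphism. The
conditions on σ enter only through associativity and the unit. -/
theorem IsSuperbialgebra.twist (hA : A.IsSuperbialgebra) (h : IsConvInverse (A.tensor A) σ σ')
    (hσ : ((A.tensor A).tensor A).lact (σ ∘ₗ fstHom (V ⊗[k] V) A)
        (σ ∘ₗ LinearMap.rTensor V A.mul) =
      ((A.tensor A).tensor A).lact (σ ∘ₗ sndHom A (V ⊗[k] V) ∘ₗ
        (TensorProduct.assoc k V V V).toLinearMap)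
        (σ ∘ₗ LinearMap.lTensor V A.mul ∘ₗ (TensorProduct.assoc k V V V).toLinearMap))
    (hl : ∀ x, σ (A.one ⊗ₜ x) = A.counit x) (hr : ∀ x, σ (x ⊗ₜ A.one) = A.counit x)
    (S : V →ₗ[k] V) :
    ({ A with mul := A.twistMul σ σ', antipode := S } : HopfSuperData k V).IsSuperbialgebra := by
  have hc := hA.toIsSupercoalgebra
  have hm := h.isCoalgHom_conj (hc.tensor hc) hA.isCoalgHom_mul
  exact .of_isCoalgHom
    { mul_mem := fun i j x hx y hy => hm.even _ _ (tmul_mem hx hy)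
      one_mem := hA.one_mem
      mul_assoc := twistMul_assoc hA h hσ
      one_mul := twistMul_one_left hA h hl
      mul_one := twistMul_one_right hA h hr }
    ⟨hA.comul_mem, hA.counit_odd, hA.coassoc, hA.counit_left, hA.counit_right⟩
    ⟨hm.even, hm.comul, hm.counit⟩ hA.comul_one hA.counit_one

end Twist

end HopfSuperData

/-! ### The double of two superbialgebras with a skew pairing. -/

namespace HopfSuperData

open SuperGrading

variable {k : Type*} [Field k]
variable {V W U Y V' W' M N P Q M' N' : Type*} [AddCommGroup V] [Module k V] [AddCommGroup W]
  [Module k W] [AddCommGroup U] [Module k U] [AddCommGroup Y] [Module k Y]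
  [AddCommGroup V'] [Module k V'] [AddCommGroup W'] [Module k W'] [AddCommGroup M] [Module k M]
  [AddCommGroup N] [Module k N] [AddCommGroup P] [Module k P] [AddCommGroup Q] [Module k Q]
  [AddCommGroup M'] [Module k M'] [AddCommGroup N'] [Module k N']
variable {A : HopfSuperData k V} {B : HopfSuperData k W} {C : HopfSuperData k U}
  {D : HopfSuperData k Y} {A' : HopfSuperData k V'} {B' : HopfSuperData k W'}

theorem fstHom_comp_flip (hB : B.IsSupercoalgebra) :
    fstHom V B ∘ₗ B.gr.flip A.gr = sndHom B V := by
  refine hom_ext₂ B.gr A.gr fun i x j y => ?_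
  simp only [LinearMap.comp_apply, flip_proj, map_smul, fstHom_tmul, sndHom_tmul, smul_smul]
  congr 1
  exact paritySign_smul_of_even hB.counit_even i j x

theorem sndHom_comp_flip (hA : A.IsSupercoalgebra) :
    sndHom A W ∘ₗ B.gr.flip A.gr = fstHom W A := by
  refine hom_ext₂ B.gr A.gr fun i x j y => ?_
  simp only [LinearMap.comp_apply, flip_proj, map_smul, fstHom_tmul, sndHom_tmul, smul_smul]
  congr 1
  rw [paritySign_smul_of_even' hA.counit_even j i y]

theorem sndHom_comp_mul (hB : B.IsSuperbialgebra) : sndHom B V ∘ₗ (B.tensor A).mul =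
    A.mul ∘ₗ TensorProduct.map (sndHom B V) (sndHom B V) := by
  refine hom_ext₄ B.gr A.gr B.gr A.gr fun i x j y l z m w => ?_
  simp only [LinearMap.comp_apply, tensor_mul_proj, map_smul, sndHom_tmul, TensorProduct.map_tmul,
    hB.counit_mul, smul_smul, ← TensorProduct.smul_tmul', TensorProduct.tmul_smul]
  congr 1
  linear_combination (B.counit (B.gr.proj i x)) *
    paritySign_smul_of_even' hB.counit_even l j z

theorem fstHom_comp_mul (hA : A.IsSuperbialgebra) : fstHom W A ∘ₗ (B.tensor A).mul =
    B.mul ∘ₗ TensorProduct.map (fstHom W A) (fstHom W A) := by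
  refine hom_ext₄ B.gr A.gr B.gr A.gr fun i x j y l z m w => ?_
  simp only [LinearMap.comp_apply, tensor_mul_proj, map_smul, fstHom_tmul, TensorProduct.map_tmul,
    hA.counit_mul, smul_smul, ← TensorProduct.smul_tmul', TensorProduct.tmul_smul]
  congr 1
  linear_combination (A.counit (A.gr.proj m w)) *
    paritySign_smul_of_even hA.counit_even j l y

/-- A functional on `A ⊗ B`, invertible for the convolution, which is multiplicative up to the
order of the factors in both variables. -/
structure IsSkewPairing (A : HopfSuperData k V) (B : HopfSuperData k W)
    (φ φ' : V ⊗[k] W →ₗ[k] k) : Prop extends IsConvInverse (A.tensor B) φ φ' where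
  mul_left : φ ∘ₗ LinearMap.rTensor W A.mul = ((A.tensor A).tensor B).lact
    (φ ∘ₗ LinearMap.rTensor W (sndHom A V)) (φ ∘ₗ LinearMap.rTensor W (fstHom V A))
  mul_right : φ ∘ₗ LinearMap.lTensor V B.mul = (A.tensor (B.tensor B)).lact
    (φ ∘ₗ LinearMap.lTensor V (fstHom W B)) (φ ∘ₗ LinearMap.lTensor V (sndHom B W))
  one_left : ∀ y, φ (A.one ⊗ₜ y) = B.counit y
  one_right : ∀ x, φ (x ⊗ₜ B.one) = A.counit x

section Double

variable {φ φ' : V ⊗[k] W →ₗ[k] k}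

/-- The exchange map `A ⊗ B → B ⊗ A`, `φ * τ * φ'`. -/
def exchange (A : HopfSuperData k V) (B : HopfSuperData k W) (φ φ' : V ⊗[k] W →ₗ[k] k) :
    V ⊗[k] W →ₗ[k] W ⊗[k] V :=
  (A.tensor B).conj φ (A.gr.flip B.gr) φ'

theorem IsConvInverse.isCoalgHom_exchange (h : IsConvInverse (A.tensor B) φ φ')
    (hA : A.IsSupercoalgebra) (hB : B.IsSupercoalgebra) :
    IsCoalgHom (A.tensor B) (B.tensor A) (A.exchange B φ φ') :=
  h.isCoalgHom_conj (hA.tensor hB) (IsCoalgHom.flip hA hB)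

/-- A coalgebra morphism into B ⊗ A is recovered from its two counital projections. For the exchange
map these are the conjugates of the projections of A ⊗ B, that is, the two actions of a bicrossed
product. -/
theorem IsConvInverse.exchange_eq (h : IsConvInverse (A.tensor B) φ φ')
    (hA : A.IsSupercoalgebra) (hB : B.IsSupercoalgebra) :
    TensorProduct.map ((A.tensor B).conj φ (sndHom A W) φ')
      ((A.tensor B).conj φ (fstHom V B) φ') ∘ₗ (A.tensor B).comul = A.exchange B φ φ' := by
  have h1 : (A.tensor B).conj φ (sndHom A W) φ' = fstHom W A ∘ₗ A.exchange B φ φ' := by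
    rw [exchange, comp_conj, fstHom_comp_flip hA]
  have h2 : (A.tensor B).conj φ (fstHom V B) φ' = sndHom B V ∘ₗ A.exchange B φ φ' := by
    rw [exchange, comp_conj, sndHom_comp_flip hB]
  refine LinearMap.ext fun t => ?_
  rw [LinearMap.comp_apply, h1, h2, TensorProduct.map_comp, LinearMap.comp_apply,
    ← (h.isCoalgHom_exchange hA hB).comul]
  exact map_fstHom_sndHom_comul hB hA _

/-- The double `B ⋈ A` of two Hopf superalgebras with a skew pairing. -/
def double (A : HopfSuperData k V) (B : HopfSuperData k W) (φ φ' : V ⊗[k] W →ₗ[k] k) :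
    HopfSuperData k (W ⊗[k] V) where
  gr := B.gr.tensor A.gr
  mul := TensorProduct.map B.mul A.mul ∘ₗ midMap (A.exchange B φ φ')
  one := B.one ⊗ₜ A.one
  comul := (B.tensor A).comul
  counit := (B.tensor A).counit
  antipode := A.exchange B φ φ' ∘ₗ TensorProduct.map A.antipode B.antipode ∘ₗ B.gr.flip A.gr

/-- The projection `(B ⊗ A) ⊗ (B ⊗ A) → A ⊗ B` to the middle factors. -/
def middle (A : HopfSuperData k V) (B : HopfSuperData k W) :
    (W ⊗[k] V) ⊗[k] (W ⊗[k] V) →ₗ[k] V ⊗[k] W :=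
  TensorProduct.map (sndHom B V) (fstHom W A)

theorem isCoalgHom_middle (hA : A.IsSupercoalgebra) (hB : B.IsSupercoalgebra) :
    IsCoalgHom ((B.tensor A).tensor (B.tensor A)) (A.tensor B) (A.middle B) :=
  (isCoalgHom_sndHom hB).map (isCoalgHom_fstHom hA)

/-- The conjugation defining the exchange map moves out of `midMap`, with counits on the outer
factors; so the double is the twist of B ⊗ A by σ((x ⊗ a) ⊗ (y ⊗ b)) = ε(x) φ(a, y) ε(b). -/
theorem IsConvInverse.double_mul (h : IsConvInverse (A.tensor B) φ φ')
    (hA : A.IsSupercoalgebra) (hB : B.IsSupercoalgebra) : (A.double B φ φ').mul =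
    (B.tensor A).twistMul (φ ∘ₗ A.middle B) (φ' ∘ₗ A.middle B) := by
  change TensorProduct.map B.mul A.mul ∘ₗ midMap (A.exchange B φ φ') = _
  rw [exchange, h.midMap_conj hB hA, comp_conj]
  rfl

/-- On (x ⊗ a) ⊗ (y ⊗ b) ⊗ (z ⊗ c) let φ₁₂, φ₂₃, φ₁₃ be φ of (a, y), (b, z), (a, z), with counits
elsewhere. The two multiplicativity rules turn the sides into φ₁₂ * (φ₂₃ * φ₁₃) and φ₂₃ * (φ₁₂ *
φ₁₃), and φ₁₂ commutes with φ₂₃ since they involve disjoint factors. -/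
theorem IsSkewPairing.cocycle (h : IsSkewPairing A B φ φ')
    (hA : A.IsSuperbialgebra) (hB : B.IsSuperbialgebra) :
    (((B.tensor A).tensor (B.tensor A)).tensor (B.tensor A)).lact
      ((φ ∘ₗ A.middle B) ∘ₗ fstHom ((W ⊗[k] V) ⊗[k] (W ⊗[k] V)) (B.tensor A))
      ((φ ∘ₗ A.middle B) ∘ₗ LinearMap.rTensor (W ⊗[k] V) (B.tensor A).mul) =
    (((B.tensor A).tensor (B.tensor A)).tensor (B.tensor A)).lact
      ((φ ∘ₗ A.middle B) ∘ₗ sndHom (B.tensor A) ((W ⊗[k] V) ⊗[k] (W ⊗[k] V)) ∘ₗ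
        (TensorProduct.assoc k _ _ _).toLinearMap)
      ((φ ∘ₗ A.middle B) ∘ₗ LinearMap.lTensor (W ⊗[k] V) (B.tensor A).mul ∘ₗ
        (TensorProduct.assoc k _ _ _).toLinearMap) := by
  have hA' := hA.toIsSupercoalgebra
  have hB' := hB.toIsSupercoalgebra
  have hE := hB'.tensor hA'
  have hT := (hE.tensor hE).tensor hE
  have hs : IsCoalgHom (B.tensor A) A (sndHom B V) := isCoalgHom_sndHom hB'
  have hf : IsCoalgHom (B.tensor A) B (fstHom W A) := isCoalgHom_fstHom hA'
  have ha : IsCoalgHom (((B.tensor A).tensor (B.tensor A)).tensor (B.tensor A))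
    ((B.tensor A).tensor ((B.tensor A).tensor (B.tensor A)))
    (TensorProduct.assoc k _ _ _).toLinearMap := IsCoalgHom.assoc
  have hr : IsCoalgHom (((B.tensor A).tensor (B.tensor A)).tensor (B.tensor A))
      ((A.tensor A).tensor B) (TensorProduct.map
        (TensorProduct.map (sndHom B V) (sndHom B V)) (fstHom W A)) := (hs.map hs).map hf
  have hl : IsCoalgHom (((B.tensor A).tensor (B.tensor A)).tensor (B.tensor A))
      (A.tensor (B.tensor B)) (TensorProduct.map (sndHom B V)
        (TensorProduct.map (fstHom W A) (fstHom W A)) ∘ₗ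
          (TensorProduct.assoc k _ _ _).toLinearMap) := (hs.map (hf.map hf)).comp ha
  -- This projection regroups the relevant factors as (a ⊗ y) ⊗ (b ⊗ z), which displays φ₁₂ and φ₂₃
  -- as functionals on different tensor factors.
  have hz : IsCoalgHom (((B.tensor A).tensor (B.tensor A)).tensor (B.tensor A))
      ((A.tensor B).tensor (A.tensor B)) ((TensorProduct.assoc k (V ⊗[k] W) V W).toLinearMap ∘ₗ
        LinearMap.rTensor W (TensorProduct.assoc k V W V).symm.toLinearMap ∘ₗ
          TensorProduct.map (LinearMap.rTensor (W ⊗[k] V) (sndHom B V)) (fstHom W A)) :=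
    IsCoalgHom.assoc.comp ((IsCoalgHom.assoc_symm).rTensor.comp (hs.rTensor.map hf))
  have e1 : (φ ∘ₗ A.middle B) ∘ₗ LinearMap.rTensor (W ⊗[k] V) (B.tensor A).mul =
      (φ ∘ₗ LinearMap.rTensor W A.mul) ∘ₗ TensorProduct.map
        (TensorProduct.map (sndHom B V) (sndHom B V)) (fstHom W A) := by
    have e := congrArg (φ ∘ₗ TensorProduct.map · (fstHom W A)) (sndHom_comp_mul (A := A) hB)
    refine Eq.trans ?_ (e.trans ?_) <;> exact TensorProduct.ext' fun _ _ => rfl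
  have e2 : (φ ∘ₗ A.middle B) ∘ₗ LinearMap.lTensor (W ⊗[k] V) (B.tensor A).mul ∘ₗ
        (TensorProduct.assoc k _ _ _).toLinearMap =
      (φ ∘ₗ LinearMap.lTensor V B.mul) ∘ₗ TensorProduct.map (sndHom B V)
        (TensorProduct.map (fstHom W A) (fstHom W A)) ∘ₗ
          (TensorProduct.assoc k _ _ _).toLinearMap := by
    have e := congrArg (fun f => (φ ∘ₗ TensorProduct.map (sndHom B V) f) ∘ₗ
      (TensorProduct.assoc k _ _ _).toLinearMap) (fstHom_comp_mul (B := B) hA)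
    refine Eq.trans ?_ (e.trans ?_) <;> exact TensorProduct.ext_threefold fun _ _ _ => rfl
  have e3 : (φ ∘ₗ A.middle B) ∘ₗ fstHom ((W ⊗[k] V) ⊗[k] (W ⊗[k] V)) (B.tensor A) =
      (φ ∘ₗ fstHom (V ⊗[k] W) (A.tensor B)) ∘ₗ
        ((TensorProduct.assoc k (V ⊗[k] W) V W).toLinearMap ∘ₗ
        LinearMap.rTensor W (TensorProduct.assoc k V W V).symm.toLinearMap ∘ₗ
          TensorProduct.map (LinearMap.rTensor (W ⊗[k] V) (sndHom B V)) (fstHom W A)) := by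
    ext a b c d e f
    simp [middle, ← TensorProduct.smul_tmul', TensorProduct.tmul_smul, smul_smul]
    exact Or.inl (by ring)
  have e4 : (φ ∘ₗ A.middle B) ∘ₗ sndHom (B.tensor A) ((W ⊗[k] V) ⊗[k] (W ⊗[k] V)) ∘ₗ
        (TensorProduct.assoc k _ _ _).toLinearMap =
      (φ ∘ₗ sndHom (A.tensor B) (V ⊗[k] W)) ∘ₗ
        ((TensorProduct.assoc k (V ⊗[k] W) V W).toLinearMap ∘ₗ
        LinearMap.rTensor W (TensorProduct.assoc k V W V).symm.toLinearMap ∘ₗ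
          TensorProduct.map (LinearMap.rTensor (W ⊗[k] V) (sndHom B V)) (fstHom W A)) := by
    ext a b c d e f
    simp [middle, ← TensorProduct.smul_tmul', TensorProduct.tmul_smul, smul_smul]
    exact Or.inl (by ring)
  have e5 : (φ ∘ₗ LinearMap.rTensor W (sndHom A V)) ∘ₗ TensorProduct.map
        (TensorProduct.map (sndHom B V) (sndHom B V)) (fstHom W A) =
      (φ ∘ₗ A.middle B) ∘ₗ sndHom (B.tensor A) ((W ⊗[k] V) ⊗[k] (W ⊗[k] V)) ∘ₗ
        (TensorProduct.assoc k _ _ _).toLinearMap := by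
    ext a b c d e f
    simp [middle, ← TensorProduct.smul_tmul', TensorProduct.tmul_smul, smul_smul]
    exact Or.inl (by ring)
  have e6 : (φ ∘ₗ LinearMap.lTensor V (fstHom W B)) ∘ₗ TensorProduct.map (sndHom B V)
        (TensorProduct.map (fstHom W A) (fstHom W A)) ∘ₗ
          (TensorProduct.assoc k _ _ _).toLinearMap =
      (φ ∘ₗ A.middle B) ∘ₗ fstHom ((W ⊗[k] V) ⊗[k] (W ⊗[k] V)) (B.tensor A) := by
    ext a b c d e f
    simp [middle, ← TensorProduct.smul_tmul', TensorProduct.tmul_smul, smul_smul]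
    exact Or.inl (by ring)
  have e7 : (φ ∘ₗ LinearMap.lTensor V (sndHom B W)) ∘ₗ TensorProduct.map (sndHom B V)
        (TensorProduct.map (fstHom W A) (fstHom W A)) ∘ₗ
          (TensorProduct.assoc k _ _ _).toLinearMap =
      (φ ∘ₗ LinearMap.rTensor W (fstHom V A)) ∘ₗ TensorProduct.map
        (TensorProduct.map (sndHom B V) (sndHom B V)) (fstHom W A) := by
    ext a b c d e f
    simp [← TensorProduct.smul_tmul', TensorProduct.tmul_smul, smul_smul]
    exact Or.inl (by ring)
  rw [e1, e2, h.mul_left, h.mul_right, hr.lact_comp, hl.lact_comp, e5, e6, e7,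
    ← lact_lact hT, ← lact_lact hT, e3, e4, ← hz.lact_comp, ← hz.lact_comp,
    lact_sndHom_fstHom (hA'.tensor hB') (hA'.tensor hB') _ h.even]

theorem IsSkewPairing.isSuperbialgebra_double (h : IsSkewPairing A B φ φ')
    (hA : A.IsSuperbialgebra) (hB : B.IsSuperbialgebra) :
    (A.double B φ φ').IsSuperbialgebra := by
  have h1 : IsConvInverse ((B.tensor A).tensor (B.tensor A)) (φ ∘ₗ A.middle B)
    (φ' ∘ₗ A.middle B) := h.toIsConvInverse.comp
      (isCoalgHom_middle hA.toIsSupercoalgebra hB.toIsSupercoalgebra)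
  have h2 := (hB.tensor hA).twist h1 (h.cocycle hA hB) (fun t => ?_) (fun t => ?_)
    (A.double B φ φ').antipode
  · rw [← h.toIsConvInverse.double_mul hA.toIsSupercoalgebra hB.toIsSupercoalgebra] at h2
    exact h2
  · induction t with
    | zero => simp
    | add x y hx hy => rw [TensorProduct.tmul_add, map_add, hx, hy, map_add]
    | tmul x y => simp [middle, tensor_one, hB.counit_one, h.one_left, tensor_counit_tmul,
        TensorProduct.tmul_smul, mul_comm]
  · induction t with
    | zero => simp
    | add x y hx hy => rw [TensorProduct.add_tmul, map_add, hx, hy, map_add]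
    | tmul x y => simp [middle, tensor_one, hA.counit_one, h.one_right, tensor_counit_tmul,
        ← TensorProduct.smul_tmul', mul_comm]

end Double

end HopfSuperData

namespace HopfSuperData

open SuperGrading

variable {k : Type*} [Field k]
variable {V W U Y V' W' M N P Q M' N' : Type*} [AddCommGroup V] [Module k V] [AddCommGroup W]
  [Module k W] [AddCommGroup U] [Module k U] [AddCommGroup Y] [Module k Y]
  [AddCommGroup V'] [Module k V'] [AddCommGroup W'] [Module k W'] [AddCommGroup M] [Module k M]
  [AddCommGroup N] [Module k N] [AddCommGroup P] [Module k P] [AddCommGroup Q] [Module k Q]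
  [AddCommGroup M'] [Module k M'] [AddCommGroup N'] [Module k N']
variable {A : HopfSuperData k V} {B : HopfSuperData k W} {C : HopfSuperData k U}
  {D : HopfSuperData k Y} {A' : HopfSuperData k V'} {B' : HopfSuperData k W'}

/-! ### The exchange map and the antipode of the double. -/

section Double

variable {φ φ' : V ⊗[k] W →ₗ[k] k}

theorem IsConvInverse.symm {φ φ' : V →ₗ[k] k} (h : IsConvInverse A φ φ') : IsConvInverse A φ' φ :=
  ⟨h.even_inv, h.even, h.inv_mul, h.mul_inv⟩

theorem IsConvInverse.conj_inv_conj {φ φ' : V →ₗ[k] k} (h : IsConvInverse A φ φ')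
    (hA : A.IsSupercoalgebra) (f : V →ₗ[k] M) : A.conj φ' (A.conj φ f φ') φ = f := by
  simp only [conj, ract_lact hA, ract_ract hA, h.inv_lact hA, h.inv_mul, ract_counit hA]

/-- A functional and its inverse are fixed by conjugation with themselves, so the inner endomorphism
attached to φ is undone by the one attached to φ'. -/
theorem IsConvInverse.conj_comp_conj {φ φ' : V →ₗ[k] k} (h : IsConvInverse A φ φ')
    (hA : A.IsSupercoalgebra) :
    A.conj φ' LinearMap.id φ ∘ₗ A.conj φ LinearMap.id φ' = LinearMap.id := by
  rw [(h.isCoalgHom_conj hA IsCoalgHom.id).conj_comp, comp_conj, comp_conj, comp_conj, LinearMap.id_comp]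
  have h1 : A.conj φ φ φ' = φ := by rw [conj, ract_scalar, h.mul_inv, lact_counit hA]
  have h2 : A.conj φ φ' φ' = φ' := by
    rw [conj, ract_scalar, ← lact_lact hA, h.mul_inv, counit_lact hA]
  simp only [LinearMap.comp_id, h1, h2, h.conj_inv_conj hA]

theorem IsConvInverse.conj_id_bijective {φ φ' : V →ₗ[k] k} (h : IsConvInverse A φ φ')
    (hA : A.IsSupercoalgebra) : Function.Bijective (A.conj φ LinearMap.id φ') :=
  Function.bijective_iff_has_inverse.2 ⟨A.conj φ' LinearMap.id φ,
    LinearMap.congr_fun (h.conj_comp_conj hA), LinearMap.congr_fun (h.symm.conj_comp_conj hA)⟩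

theorem flip_bijective (A : HopfSuperData k V) (B : HopfSuperData k W) :
    Function.Bijective (A.gr.flip B.gr) :=
  Function.bijective_iff_has_inverse.2 ⟨B.gr.flip A.gr, SuperGrading.flip_flip _ _,
    SuperGrading.flip_flip _ _⟩

theorem IsConvInverse.exchange_bijective (h : IsConvInverse (A.tensor B) φ φ')
    (hA : A.IsSupercoalgebra) (hB : B.IsSupercoalgebra) :
    Function.Bijective (A.exchange B φ φ') := by
  have e : A.exchange B φ φ' = A.gr.flip B.gr ∘ₗ (A.tensor B).conj φ LinearMap.id φ' := by
    rw [comp_conj]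
    rfl
  rw [e]
  exact (flip_bijective A B).comp (h.conj_id_bijective (hA.tensor hB))

/-- If φ is trivial along i, then so is its inverse by uniqueness, and conjugation has no effect
there. It yields the values of the exchange map on 1 ⊗ y and x ⊗ 1. -/
theorem IsConvInverse.conj_comp_of_counit {φ φ' : W →ₗ[k] k} (h : IsConvInverse B φ φ')
    (hA : A.IsSupercoalgebra) {i : V →ₗ[k] W} (hi : IsCoalgHom A B i)
    (hφ : ∀ x, φ (i x) = A.counit x) (f : W →ₗ[k] M) (x : V) :
    B.conj φ f φ' (i x) = f (i x) := by
  have h1 : φ ∘ₗ i = A.counit := LinearMap.ext hφ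
  have h2 := h.comp hi
  rw [h1] at h2
  have h3 := h2.unique (isConvInverse_counit hA) hA
  have h4 := hi.conj_comp φ φ' f
  rw [h1, h3, counit_conj_counit hA] at h4
  exact LinearMap.congr_fun h4 x

theorem flip_one_left (hA : A.IsSuperalgebra) (y : W) :
    A.gr.flip B.gr (A.one ⊗ₜ y) = y ⊗ₜ A.one := by
  have : A.gr.flip B.gr ∘ₗ TensorProduct.mk k V W A.one =
      (TensorProduct.mk k W V).flip A.one := by
    refine hom_ext B.gr fun i x => ?_
    have := flip_proj A.gr B.gr 0 i A.one x
    simpa [hA.proj_one] using this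
  exact LinearMap.congr_fun this y

theorem flip_one_right (hB : B.IsSuperalgebra) (x : V) :
    A.gr.flip B.gr (x ⊗ₜ B.one) = B.one ⊗ₜ x := by
  rw [← flip_one_left (B := A) hB, SuperGrading.flip_flip]

variable (h : IsSkewPairing A B φ φ')

include h in
theorem IsSkewPairing.exchange_one_left (hA : A.IsSuperbialgebra) (hB : B.IsSuperbialgebra)
    (y : W) : A.exchange B φ φ' (A.one ⊗ₜ y) = y ⊗ₜ A.one :=
  (h.toIsConvInverse.conj_comp_of_counit hB.toIsSupercoalgebra (isCoalgHom_inr hA) h.one_left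
    _ y).trans (flip_one_left hA.toIsSuperalgebra y)

include h in
theorem IsSkewPairing.exchange_one_right (hA : A.IsSuperbialgebra) (hB : B.IsSuperbialgebra)
    (x : V) : A.exchange B φ φ' (x ⊗ₜ B.one) = B.one ⊗ₜ x :=
  (h.toIsConvInverse.conj_comp_of_counit hA.toIsSupercoalgebra (isCoalgHom_inl hB) h.one_right
    _ x).trans (flip_one_right hB.toIsSuperalgebra x)

theorem double_mul_tmul (x y : W) (v w : V) : (A.double B φ φ').mul ((x ⊗ₜ v) ⊗ₜ (y ⊗ₜ w)) =
    TensorProduct.map B.mul A.mul (insertMid x w (A.exchange B φ φ' (v ⊗ₜ y))) := by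
  simp [double]

include h in
theorem IsSkewPairing.isAlgHom_inl (hA : A.IsSuperbialgebra) (hB : B.IsSuperbialgebra) :
    IsAlgHom B (A.double B φ φ') ((TensorProduct.mk k W V).flip A.one) where
  even := (isCoalgHom_inl hA).even
  mul t := by
    have h1 : (TensorProduct.mk k W V).flip A.one ∘ₗ B.mul = (A.double B φ φ').mul ∘ₗ
        TensorProduct.map ((TensorProduct.mk k W V).flip A.one)
          ((TensorProduct.mk k W V).flip A.one) := by
      ext x y
      simp [double_mul_tmul, h.exchange_one_left hA hB, hA.one_mul]
    exact LinearMap.congr_fun h1 t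
  one := rfl

include h in
theorem IsSkewPairing.isAlgHom_inr (hA : A.IsSuperbialgebra) (hB : B.IsSuperbialgebra) :
    IsAlgHom A (A.double B φ φ') (TensorProduct.mk k W V B.one) where
  even := (isCoalgHom_inr hB).even
  mul t := by
    have h1 : TensorProduct.mk k W V B.one ∘ₗ A.mul = (A.double B φ φ').mul ∘ₗ
        TensorProduct.map (TensorProduct.mk k W V B.one) (TensorProduct.mk k W V B.one) := by
      ext x y
      simp [double_mul_tmul, h.exchange_one_right hA hB, hB.one_mul]
    exact LinearMap.congr_fun h1 t
  one := rfl

include h in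
theorem IsSkewPairing.mul_inl_inr (hA : A.IsSuperbialgebra) (hB : B.IsSuperbialgebra) :
    (A.double B φ φ').mul ∘ₗ TensorProduct.map ((TensorProduct.mk k W V).flip A.one)
      (TensorProduct.mk k W V B.one) = LinearMap.id := by
  ext x y
  simp [double_mul_tmul, h.exchange_one_left hA hB, hA.one_mul, hB.mul_one]

/-- Elements of A and B multiplied in the order opposite to the decomposition B ⊗ A: the exchange
map is the commutation rule of the double. -/
theorem double_mul_inr_inl (hA : A.IsSuperalgebra) (hB : B.IsSuperalgebra) :
    (A.double B φ φ').mul ∘ₗ TensorProduct.map (TensorProduct.mk k W V B.one)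
      ((TensorProduct.mk k W V).flip A.one) = A.exchange B φ φ' := by
  ext x y
  have : ∀ t : W ⊗[k] V, TensorProduct.map B.mul A.mul (insertMid B.one A.one t) = t := by
    intro t
    induction t with
    | zero => simp
    | add x y hx hy => rw [map_add, map_add, hx, hy]
    | tmul a b => simp [hB.one_mul, hA.mul_one]
  simp [double_mul_tmul, this]

include h in
-- The identity is the convolution P * Q of the projections to B and A followed by the inclusions.
-- Each of them is inverted by its own antipode, giving P' and Q', so the identity is inverted by Q'
-- * P'. That map multiplies an element of A by an element of B, hence contains the exchange map and
-- equals the antipode in the definition of `double`.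
theorem IsSkewPairing.isHopfSuperalgebra_double (hA : A.IsHopfSuperalgebra)
    (hB : B.IsHopfSuperalgebra) : (A.double B φ φ').IsHopfSuperalgebra := by
  have hA' := hA.toIsSuperbialgebra
  have hB' := hB.toIsSuperbialgebra
  have hD := h.isSuperbialgebra_double hA' hB'
  have hDc := hD.toIsSupercoalgebra
  have hDa := hD.toIsSuperalgebra
  have hl := h.isAlgHom_inl hA' hB'
  have hr := h.isAlgHom_inr hA' hB'
  have hf : IsCoalgHom (B.tensor A) B (fstHom W A) := isCoalgHom_fstHom hA.toIsSupercoalgebra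
  have hs : IsCoalgHom (B.tensor A) A (sndHom B V) := isCoalgHom_sndHom hB.toIsSupercoalgebra
  have hf' : IsCoalgHom (A.double B φ φ') B (fstHom W A) := ⟨hf.even, hf.comul, hf.counit⟩
  have hs' : IsCoalgHom (A.double B φ φ') A (sndHom B V) := ⟨hs.even, hs.comul, hs.counit⟩
  let D := A.double B φ φ'
  let P : W ⊗[k] V →ₗ[k] W ⊗[k] V := (TensorProduct.mk k W V).flip A.one ∘ₗ fstHom W A
  let Q : W ⊗[k] V →ₗ[k] W ⊗[k] V := TensorProduct.mk k W V B.one ∘ₗ sndHom B V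
  let P' : W ⊗[k] V →ₗ[k] W ⊗[k] V :=
    (TensorProduct.mk k W V).flip A.one ∘ₗ B.antipode ∘ₗ fstHom W A
  let Q' : W ⊗[k] V →ₗ[k] W ⊗[k] V := TensorProduct.mk k W V B.one ∘ₗ A.antipode ∘ₗ sndHom B V
  have hPQ : D.conv D.mul P Q = LinearMap.id := by
    refine LinearMap.ext fun t => ?_
    have e := map_fstHom_sndHom_comul hB.toIsSupercoalgebra hA.toIsSupercoalgebra t
    simp only [P, Q, conv, TensorProduct.map_comp, LinearMap.comp_apply]
    refine (congrArg _ (congrArg _ e)).trans ?_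
    exact LinearMap.congr_fun (h.mul_inl_inr hA' hB') t
  have hQP' : D.conv D.mul Q' P' = D.antipode := by
    refine LinearMap.ext fun t => ?_
    have e := map_sndHom_fstHom_comul hB.toIsSupercoalgebra hA.toIsSupercoalgebra t
    simp only [P', Q', conv, TensorProduct.map_comp, LinearMap.comp_apply]
    refine (congrArg _ (congrArg _ (congrArg _ e))).trans ?_
    exact LinearMap.congr_fun (double_mul_inr_inl hA.toIsSuperalgebra hB.toIsSuperalgebra) _
  have hP : D.conv D.mul P P' = D.convOne D := by
    rw [← hl.comp_conv, hB.conv_antipode hf', hl.comp_convOne]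
  have hP' : D.conv D.mul P' P = D.convOne D := by
    rw [← hl.comp_conv, hB.antipode_conv hf', hl.comp_convOne]
  have hQ : D.conv D.mul Q Q' = D.convOne D := by
    rw [← hr.comp_conv, hA.conv_antipode hs', hr.comp_convOne]
  have hQ' : D.conv D.mul Q' Q = D.convOne D := by
    rw [← hr.comp_conv, hA.antipode_conv hs', hr.comp_convOne]
  have h1 := conv_mul_inverse hDc hDa hP hQ
  have h2 := conv_mul_inverse hDc hDa hQ' hP'
  rw [hPQ, hQP'] at h1 h2
  exact
    { toIsSuperbialgebra := hD
      antipode_mem := (h.toIsConvInverse.isCoalgHom_exchange hA.toIsSupercoalgebra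
        hB.toIsSupercoalgebra).even.comp ((hA.antipode_even.map hB.antipode_even).comp
          (IsEven.flip _ _))
      antipode_left := LinearMap.congr_fun h2
      antipode_right := LinearMap.congr_fun h1 }

include h in
theorem IsSkewPairing.double_antipode_bijective (hA : A.IsSupercoalgebra)
    (hB : B.IsSupercoalgebra) (hS : Function.Bijective A.antipode)
    (hS' : Function.Bijective B.antipode) :
    Function.Bijective (A.double B φ φ').antipode :=
  (h.toIsConvInverse.exchange_bijective hA hB).comp
    ((TensorProduct.map_bijective hS hS').comp (flip_bijective B A))

end Double

end HopfSuperData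

namespace HopfSuperData

open SuperGrading

variable {k : Type*} [Field k]
variable {V W U Y V' W' M N P Q M' N' : Type*} [AddCommGroup V] [Module k V] [AddCommGroup W]
  [Module k W] [AddCommGroup U] [Module k U] [AddCommGroup Y] [Module k Y]
  [AddCommGroup V'] [Module k V'] [AddCommGroup W'] [Module k W'] [AddCommGroup M] [Module k M]
  [AddCommGroup N] [Module k N] [AddCommGroup P] [Module k P] [AddCommGroup Q] [Module k Q]
  [AddCommGroup M'] [Module k M'] [AddCommGroup N'] [Module k N']
variable {A : HopfSuperData k V} {B : HopfSuperData k W} {C : HopfSuperData k U}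
  {D : HopfSuperData k Y} {A' : HopfSuperData k V'} {B' : HopfSuperData k W'}

/-! ### The quantum double is the double of the evaluation pairing. -/

section QuantumDouble

theorem midMap_flip_flip (t : (W ⊗[k] W) ⊗[k] (V ⊗[k] V)) :
    midMap (A.gr.flip B.gr) ((B.gr.tensor B.gr).flip (A.gr.tensor A.gr) t) =
      TensorProduct.map (B.gr.flip A.gr) (B.gr.flip A.gr) (midMap (B.gr.flip A.gr) t) := by
  have h : midMap (A.gr.flip B.gr) ∘ₗ (B.gr.tensor B.gr).flip (A.gr.tensor A.gr) =
      TensorProduct.map (B.gr.flip A.gr) (B.gr.flip A.gr) ∘ₗ midMap (B.gr.flip A.gr) := by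
    refine hom_ext₄ B.gr B.gr A.gr A.gr fun i x j y l z m w => ?_
    simp only [LinearMap.comp_apply, flip_tensor_tensor, midMap_tmul, flip_proj, map_smul,
      insertMid_tmul, TensorProduct.map_tmul, ← TensorProduct.smul_tmul',
      TensorProduct.tmul_smul, smul_smul, paritySign_mul]
    congr 2
    revert i j l m
    decide
  exact LinearMap.congr_fun h t

/-- The bicrossed antipode is written with the separate coproducts of x and a. Since antipodes
reverse coproducts, its inner part is the coproduct in A ⊗ B of the element obtained from x ⊗ a by
the flip and the antipodes. -/
theorem tensor_comul_antipode (hA : A.IsHopfSuperalgebra) (hB : B.IsHopfSuperalgebra)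
    (t : W ⊗[k] V) :
    (A.tensor B).comul (TensorProduct.map A.antipode B.antipode (B.gr.flip A.gr t)) =
      TensorProduct.map (B.gr.flip A.gr) (B.gr.flip A.gr) (midMap (B.gr.flip A.gr)
        (TensorProduct.map (B.gr.flip B.gr) (A.gr.flip A.gr)
          (TensorProduct.map (TensorProduct.map B.antipode B.antipode)
            (TensorProduct.map A.antipode A.antipode)
              (TensorProduct.map B.comul A.comul t)))) := by
  have h1 : A.comul ∘ₗ A.antipode =
      A.gr.flip A.gr ∘ₗ TensorProduct.map A.antipode A.antipode ∘ₗ A.comul :=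
    LinearMap.ext hA.comul_antipode
  have h2 : B.comul ∘ₗ B.antipode =
      B.gr.flip B.gr ∘ₗ TensorProduct.map B.antipode B.antipode ∘ₗ B.comul :=
    LinearMap.ext hB.comul_antipode
  have h3 := flip_map (hB.comul_even.comp hB.antipode_even)
    (hA.comul_even.comp hA.antipode_even) t
  rw [← midMap_flip_flip, TensorProduct.map_map, TensorProduct.map_map, LinearMap.comp_assoc,
    LinearMap.comp_assoc, ← h2, ← h1, h3]
  change midMap _ (TensorProduct.map _ _ _) = _
  rw [TensorProduct.map_map]

variable {H : HopfSuperData k V} [FiniteDimensional k V] (hH : H.IsHopfSuperalgebra)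
  (hS : Function.Bijective H.antipode)

include hH in
theorem isSkewPairing_pairing :
    IsSkewPairing H (H.op hS).dual H.pairing (H.pairingInv hS) where
  toIsConvInverse := isConvInverse_pairing hH hS
  mul_left := pairing_mul_left hH hS
  mul_right := pairing_mul_right hH hS
  one_left := pairing_one_left hH hS
  one_right := pairing_one_right hH hS

include hH in
-- As the actions are conjugated projections, `exchange_eq` identifies (α ⊗ β) ∘ Δ with the exchange
-- map. The same identity settles both the product and, after `tensor_comul_antipode`, the antipode.
theorem quantumDouble_eq :
    H.quantumDouble hS = H.double (H.op hS).dual H.pairing (H.pairingInv hS) := by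
  have h := (isConvInverse_pairing hH hS).exchange_eq hH.toIsSupercoalgebra
    (hH.op hS).dual.toIsSupercoalgebra
  rw [← doubleLeftAction_eq hH hS, ← doubleRightAction_eq hH hS] at h
  have h2 : TensorProduct.map (H.doubleLeftAction hS) (H.doubleRightAction hS) ∘ₗ
      TensorProduct.map ((H.op hS).dual.gr.flip H.gr) ((H.op hS).dual.gr.flip H.gr) ∘ₗ
      midMap ((H.op hS).dual.gr.flip H.gr) ∘ₗ
      TensorProduct.map ((H.op hS).dual.gr.flip (H.op hS).dual.gr) (H.gr.flip H.gr) ∘ₗ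
      TensorProduct.map (TensorProduct.map (H.op hS).dual.antipode (H.op hS).dual.antipode)
        (TensorProduct.map H.antipode H.antipode) ∘ₗ
      TensorProduct.map (H.op hS).dual.comul H.comul =
      H.exchange (H.op hS).dual H.pairing (H.pairingInv hS) ∘ₗ
        TensorProduct.map H.antipode (H.op hS).dual.antipode ∘ₗ
          (H.op hS).dual.gr.flip H.gr := by
    refine LinearMap.ext fun t => ?_
    rw [← h]
    exact congrArg _ (tensor_comul_antipode hH (hH.op hS).dual t).symm
  rw [quantumDouble, bicrossed, double, h2, h]

theorem dual_op_antipode_bijective : Function.Bijective (H.op hS).dual.antipode :=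
  (LinearEquiv.ofBijective H.antipode hS).symm.dualMap.bijective

include hH in
theorem isHopfSuperalgebra_quantumDouble : (H.quantumDouble hS).IsHopfSuperalgebra := by
  rw [quantumDouble_eq hH hS]
  exact (isSkewPairing_pairing hH hS).isHopfSuperalgebra_double hH (hH.op hS).dual

include hH in
theorem quantumDouble_antipode_bijective :
    Function.Bijective (H.quantumDouble hS).antipode := by
  rw [quantumDouble_eq hH hS]
  exact (isSkewPairing_pairing hH hS).double_antipode_bijective hH.toIsSupercoalgebra
    (hH.op hS).dual.toIsSupercoalgebra hS (dual_op_antipode_bijective hS)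

end QuantumDouble

end HopfSuperData

namespace HopfSuperData

open SuperGrading

variable {k : Type*} [Field k]
variable {V W U Y V' W' M N P Q M' N' : Type*} [AddCommGroup V] [Module k V] [AddCommGroup W]
  [Module k W] [AddCommGroup U] [Module k U] [AddCommGroup Y] [Module k Y]
  [AddCommGroup V'] [Module k V'] [AddCommGroup W'] [Module k W'] [AddCommGroup M] [Module k M]
  [AddCommGroup N] [Module k N] [AddCommGroup P] [Module k P] [AddCommGroup Q] [Module k Q]
  [AddCommGroup M'] [Module k M'] [AddCommGroup N'] [Module k N']
variable {A : HopfSuperData k V} {B : HopfSuperData k W} {C : HopfSuperData k U}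
  {D : HopfSuperData k Y} {A' : HopfSuperData k V'} {B' : HopfSuperData k W'}

/-! ### Tensors with a factor V or V^* as linear maps; the canonical element. -/

section Eval

/-- `v ⊗ m ↦ (f ↦ f v • m)`. -/
def evalFst (k V M : Type*) [Field k] [AddCommGroup V] [Module k V] [AddCommGroup M] [Module k M] :
    V ⊗[k] M →ₗ[k] Module.Dual k V →ₗ[k] M :=
  dualTensorHom k (Module.Dual k V) M ∘ₗ LinearMap.rTensor M (Module.Dual.eval k V)

/-- `m ⊗ f ↦ (v ↦ f v • m)`. -/
def evalSnd (k V M : Type*) [Field k] [AddCommGroup V] [Module k V] [AddCommGroup M] [Module k M] :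
    M ⊗[k] Module.Dual k V →ₗ[k] V →ₗ[k] M :=
  dualTensorHom k V M ∘ₗ (TensorProduct.comm k M (Module.Dual k V)).toLinearMap

@[simp]
theorem evalFst_tmul (v : V) (m : M) (f : Module.Dual k V) :
    evalFst k V M (v ⊗ₜ m) f = f v • m := by
  simp [evalFst]

@[simp]
theorem evalSnd_tmul (m : M) (f : Module.Dual k V) (v : V) :
    evalSnd k V M (m ⊗ₜ f) v = f v • m := by
  simp [evalSnd]

theorem evalFst_map (F : V →ₗ[k] W) (G : M →ₗ[k] N) (z : V ⊗[k] M) (f : Module.Dual k W) :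
    evalFst k W N (TensorProduct.map F G z) f = G (evalFst k V M z (f ∘ₗ F)) := by
  induction z with
  | zero => simp
  | add x y hx hy => simp only [map_add, LinearMap.add_apply, hx, hy]
  | tmul v m => simp

theorem evalSnd_map (G : M →ₗ[k] N) (L : W →ₗ[k] V) (z : M ⊗[k] Module.Dual k V) (w : W) :
    evalSnd k W N (TensorProduct.map G L.dualMap z) w = G (evalSnd k V M z (L w)) := by
  induction z with
  | zero => simp
  | add x y hx hy => simp only [map_add, LinearMap.add_apply, hx, hy]
  | tmul v m => simp

theorem evalSnd_rTensor (G : M →ₗ[k] N) (z : M ⊗[k] Module.Dual k V) (v : V) :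
    evalSnd k V N (LinearMap.rTensor _ G z) v = G (evalSnd k V M z v) :=
  evalSnd_map G LinearMap.id z v

theorem evalFst_lTensor (G : M →ₗ[k] N) (z : V ⊗[k] M) (f : Module.Dual k V) :
    evalFst k V N (LinearMap.lTensor _ G z) f = G (evalFst k V M z f) :=
  evalFst_map LinearMap.id G z f

variable [FiniteDimensional k V]

theorem evalFst_injective : Function.Injective (evalFst k V M) := by
  refine (dualTensorHomEquiv k (Module.Dual k V) M).injective.comp ?_
  exact (LinearEquiv.rTensor M (Module.evalEquiv k V)).injective

theorem evalSnd_injective : Function.Injective (evalSnd k V M) :=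
  (dualTensorHomEquiv k V M).injective.comp (TensorProduct.comm k M (Module.Dual k V)).injective

variable {ι : Type*} [Fintype ι] (e : Module.Basis ι k V)

omit [FiniteDimensional k V] in
-- The canonical element represents the identity of V^* and, by `evalSnd_basis`, the identity of V.
-- Only these two properties are used afterwards, so no basis appears in the arguments about R.
theorem evalFst_basis : evalFst k V _ (∑ i, e i ⊗ₜ e.coord i) = LinearMap.id := by
  ext f x
  simp [e.sum_dual_apply_smul_coord]

omit [FiniteDimensional k V] in
theorem evalSnd_basis : evalSnd k V _ (∑ i, e i ⊗ₜ e.coord i) = LinearMap.id := by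
  ext x
  simp [e.sum_repr]

omit [FiniteDimensional k V] in
theorem map_proj_mem (G : SuperGrading k V) (G' : SuperGrading k W) (i j : ZMod 2)
    (z : V ⊗[k] W) : TensorProduct.map (G.proj i) (G'.proj j) z ∈ (G.tensor G').deg (i + j) := by
  induction z with
  | zero => simp
  | add x y hx hy => rw [map_add]; exact add_mem hx hy
  | tmul x y => exact tmul_mem (G.proj_mem i x) (G'.proj_mem j y)

/-- The component of c in V_i ⊗ (V^*)_j represents the composite of the projections to degrees i and
j, which is zero when i ≠ j. -/
theorem mem_deg_zero_of_evalSnd {G : SuperGrading k V} {c : V ⊗[k] Module.Dual k V}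
    (hc : evalSnd k V V c = LinearMap.id) : c ∈ (G.tensor G.dual).deg 0 := by
  have h1 : ∀ i j : ZMod 2, TensorProduct.map (G.proj i) (G.dual.proj j) c ∈
      (G.tensor G.dual).deg 0 := by
    intro i j
    by_cases h : i = j
    · subst h
      have := map_proj_mem G G.dual i i c
      rwa [CharTwo.add_self_eq_zero] at this
    · have e1 : G.dual.proj j = (G.proj j).dualMap := by
        ext f x
        exact dual_proj_apply _ _ _ _
      have e2 : TensorProduct.map (G.proj i) (G.dual.proj j) c = 0 := by
        apply evalSnd_injective
        ext x
        rw [e1, evalSnd_map, hc, LinearMap.id_apply, proj_proj, if_neg h]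
        simp
      rw [e2]
      exact zero_mem _
  have h2 : ∀ z : V ⊗[k] Module.Dual k V, z =
      (TensorProduct.map (G.proj 0) (G.dual.proj 0) z +
      TensorProduct.map (G.proj 0) (G.dual.proj 1) z) +
      (TensorProduct.map (G.proj 1) (G.dual.proj 0) z +
      TensorProduct.map (G.proj 1) (G.dual.proj 1) z) := by
    intro z
    rw [← LinearMap.add_apply, ← LinearMap.add_apply, ← LinearMap.add_apply,
      ← TensorProduct.map_add_right, ← TensorProduct.map_add_right, ← TensorProduct.map_add_left]
    have e1 : G.proj 0 + G.proj 1 = LinearMap.id := LinearMap.ext G.proj_zero_add_proj_one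
    have e2 : G.dual.proj 0 + G.dual.proj 1 = LinearMap.id :=
      LinearMap.ext G.dual.proj_zero_add_proj_one
    rw [e1, e2, TensorProduct.map_id, LinearMap.id_apply]
  rw [h2 c]
  exact add_mem (add_mem (h1 _ _) (h1 _ _)) (add_mem (h1 _ _) (h1 _ _))

end Eval

/-! ### Sign twists and induction over homogeneous tensors. -/

section Twist

/-- The map `x ↦ (-1)^(p |x|) x`. -/
def _root_.SuperGrading.twist (G : SuperGrading k V) (p : ZMod 2) : V →ₗ[k] V :=
  G.proj 0 + paritySign k p • G.proj 1

@[simp]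
theorem _root_.SuperGrading.twist_proj (G : SuperGrading k V) (p i : ZMod 2) (x : V) :
    G.twist p (G.proj i x) = paritySign k (p * i) • G.proj i x := by
  rcases ZMod.two_eq_or i with rfl | rfl <;> simp [SuperGrading.twist, proj_proj]

@[simp]
theorem _root_.SuperGrading.twist_zero (G : SuperGrading k V) : G.twist 0 = LinearMap.id :=
  hom_ext G fun i x => by simp

end Twist

section Induction

theorem tensor_induction (GA : SuperGrading k V) (GB : SuperGrading k W) {C : V ⊗[k] W → Prop}
    (h0 : C 0) (hadd : ∀ s t, C s → C t → C (s + t))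
    (h : ∀ i x j y, C (GA.proj i x ⊗ₜ GB.proj j y)) (t : V ⊗[k] W) : C t := by
  induction t with
  | zero => exact h0
  | add s t hs ht => exact hadd s t hs ht
  | tmul x y =>
    rw [← GA.proj_zero_add_proj_one x, ← GB.proj_zero_add_proj_one y, TensorProduct.add_tmul,
      TensorProduct.tmul_add, TensorProduct.tmul_add]
    exact hadd _ _ (hadd _ _ (h _ _ _ _) (h _ _ _ _)) (hadd _ _ (h _ _ _ _) (h _ _ _ _))

theorem deg_induction (GA : SuperGrading k V) (GB : SuperGrading k W) {n : ZMod 2}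
    {C : V ⊗[k] W → Prop} (h0 : C 0) (hadd : ∀ s t, C s → C t → C (s + t))
    (hsmul : ∀ (c : k) t, C t → C (c • t))
    (h : ∀ i x j y, i + j = n → C (GA.proj i x ⊗ₜ GB.proj j y)) {t : V ⊗[k] W}
    (ht : t ∈ (GA.tensor GB).deg n) : C t :=
  (tensor_deg_le GA GB (P :=
    { carrier := {t | C t}
      add_mem' := fun hs ht => hadd _ _ hs ht
      zero_mem' := h0
      smul_mem' := fun c _ ht => hsmul c _ ht }) h) ht

end Induction

/-! ### Products become convolutions under evaluation. -/

section EvalMul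

variable {H : HopfSuperData k V} {N : HopfSuperData k M} [FiniteDimensional k V]
  (hS : Function.Bijective H.antipode)

/-- The product of X is the transpose of Δ, so evaluation of the X-leg gives a convolution. The
twist is the sign for the first leg of Δ(x) passing z', whose total degree is p. -/
theorem evalSnd_mul {p : ZMod 2} (z : M ⊗[k] Module.Dual k V) {z' : M ⊗[k] Module.Dual k V}
    (hz : z' ∈ (N.gr.tensor H.gr.dual).deg p) (x : V) :
    evalSnd k V M ((N.tensor (H.op hS).dual).mul (z ⊗ₜ z')) x =
      H.conv N.mul (evalSnd k V M z ∘ₗ H.gr.twist p) (evalSnd k V M z') x := by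
  have hp : ∀ (a : ZMod 2) (m : M) (b : ZMod 2) (f : Module.Dual k V) (l : ZMod 2) (m' : M)
      (j : ZMod 2) (g : Module.Dual k V), l + j = p →
      (paritySign k (b * l) • LinearMap.toSpanSingleton k M
        (N.mul (N.gr.proj a m ⊗ₜ N.gr.proj l m'))) ∘ₗ
        H.gr.dualDistrib H.gr (H.gr.dual.proj b f ⊗ₜ H.gr.dual.proj j g) =
      N.mul ∘ₗ TensorProduct.map (evalSnd k V M (N.gr.proj a m ⊗ₜ H.gr.dual.proj b f) ∘ₗ
        H.gr.twist p) (evalSnd k V M (N.gr.proj l m' ⊗ₜ H.gr.dual.proj j g)) := by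
    intro a m b f l m' j g hlj
    subst hlj
    refine hom_ext₂ H.gr H.gr fun c x d y => ?_
    simp only [LinearMap.comp_apply, LinearMap.smul_apply, LinearMap.toSpanSingleton_apply,
      dualDistrib_proj, TensorProduct.map_tmul, twist_proj, map_smul, evalSnd_tmul,
      dual_proj_proj, ← TensorProduct.smul_tmul', TensorProduct.tmul_smul, smul_smul]
    by_cases h1 : b = c
    · subst h1
      congr 1
      have e : paritySign k (b * l) * paritySign k (j * b) = paritySign k ((l + j) * b) := by
        rw [paritySign_mul]
        congr 1
        ring
      rw [if_pos rfl, ← e]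
      ring
    · simp [h1]
  induction z using tensor_induction N.gr H.gr.dual with
  | h0 => simp [conv]
  | hadd s t hs ht =>
    rw [TensorProduct.add_tmul, map_add, map_add, LinearMap.add_apply, hs, ht]
    simp [conv, LinearMap.add_comp, TensorProduct.map_add_left]
  | h a m b f =>
    refine deg_induction N.gr H.gr.dual (C := fun z' => evalSnd k V M
      ((N.tensor (H.op hS).dual).mul ((N.gr.proj a m ⊗ₜ H.gr.dual.proj b f) ⊗ₜ z')) x =
        H.conv N.mul (evalSnd k V M (N.gr.proj a m ⊗ₜ H.gr.dual.proj b f) ∘ₗ H.gr.twist p)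
          (evalSnd k V M z') x) ?_ (fun s t hs ht => ?_) (fun c t ht => ?_)
      (fun l m' j g hlj => ?_) hz
    · simp [conv]
    · rw [TensorProduct.tmul_add, map_add, map_add, LinearMap.add_apply, hs, ht]
      simp [conv, TensorProduct.map_add_right]
    · rw [TensorProduct.tmul_smul, map_smul, map_smul, LinearMap.smul_apply, ht]
      simp [conv, TensorProduct.map_smul_right]
    · refine Eq.trans ?_ (LinearMap.congr_fun (hp a m b f l m' j g hlj) (H.comul x))
      have := tensor_mul_proj (A := N) (B := (H.op hS).dual) a b l j m f m' g
      rw [dual_gr] at this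
      refine (congrArg (fun z => evalSnd k V M z x) this).trans ?_
      rw [map_smul, LinearMap.smul_apply, evalSnd_tmul]
      rfl

/-- The dual computation: a functional on a product of H is computed by the coproduct of X followed
by a flip, because X is dual to H^op. The twist has the total degree p of z. -/
theorem evalFst_mul {p : ZMod 2} {z : V ⊗[k] M} (z' : V ⊗[k] M)
    (hz : z ∈ (H.gr.tensor N.gr).deg p) (f : Module.Dual k V) :
    evalFst k V M ((H.tensor N).mul (z ⊗ₜ z')) f =
      N.mul (TensorProduct.map (evalFst k V M z) (evalFst k V M z')
        (H.gr.dual.flip H.gr.dual (LinearMap.rTensor _ (H.gr.dual.twist p)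
          ((H.op hS).dual.comul f)))) := by
  have hp : ∀ (a : ZMod 2) (v : V) (b : ZMod 2) (m : M) (c : ZMod 2) (v' : V)
      (d : ZMod 2) (m' : M), a + b = p →
      (paritySign k (b * c) • paritySign k (a * c) • LinearMap.toSpanSingleton k M
        (N.mul (N.gr.proj b m ⊗ₜ N.gr.proj d m'))) ∘ₗ
        LinearMap.applyₗ (H.gr.proj c v' ⊗ₜ H.gr.proj a v) ∘ₗ
        (H.gr.dualDistrib H.gr).toLinearMap =
      N.mul ∘ₗ TensorProduct.map (evalFst k V M (H.gr.proj a v ⊗ₜ N.gr.proj b m))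
        (evalFst k V M (H.gr.proj c v' ⊗ₜ N.gr.proj d m')) ∘ₗ
          H.gr.dual.flip H.gr.dual ∘ₗ LinearMap.rTensor _ (H.gr.dual.twist p) := by
    intro a v b m c v' d m' hab
    subst hab
    refine hom_ext₂ H.gr.dual H.gr.dual fun l g j h => ?_
    simp only [LinearMap.comp_apply, LinearMap.smul_apply, LinearMap.toSpanSingleton_apply,
      LinearMap.applyₗ_apply_apply, LinearEquiv.coe_coe, LinearMap.rTensor_tmul, flip_proj,
      dualDistrib_proj, TensorProduct.map_tmul, twist_proj, map_smul, evalFst_tmul,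
      dual_proj_proj, ← TensorProduct.smul_tmul', TensorProduct.tmul_smul, smul_smul]
    by_cases h1 : l = c
    · by_cases h2 : j = a
      · subst h1 h2
        congr 1
        have e : paritySign k (b * l) * paritySign k (j * l) * paritySign k (j * l) =
            paritySign k ((j + b) * l) * paritySign k (l * j) := by
          rw [paritySign_mul, paritySign_mul, paritySign_mul]
          congr 1
          clear hz
          revert b l j
          decide
        rw [if_pos rfl, if_pos rfl]
        linear_combination (g (H.gr.proj l v') * h (H.gr.proj j v)) * e
      · simp [h2]
    · simp [h1]
  induction z' using tensor_induction H.gr N.gr with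
  | h0 => simp
  | hadd s t hs ht =>
    rw [TensorProduct.tmul_add, map_add, map_add, LinearMap.add_apply, hs, ht]
    simp [TensorProduct.map_add_right]
  | h c v' d m' =>
    refine deg_induction H.gr N.gr (C := fun z => evalFst k V M
      ((H.tensor N).mul (z ⊗ₜ (H.gr.proj c v' ⊗ₜ N.gr.proj d m'))) f =
        N.mul (TensorProduct.map (evalFst k V M z)
          (evalFst k V M (H.gr.proj c v' ⊗ₜ N.gr.proj d m'))
          (H.gr.dual.flip H.gr.dual (LinearMap.rTensor _ (H.gr.dual.twist p)
            ((H.op hS).dual.comul f))))) ?_ (fun s t hs ht => ?_) (fun c t ht => ?_)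
      (fun a v b m hab => ?_) hz
    · simp
    · rw [TensorProduct.add_tmul, map_add, map_add, LinearMap.add_apply, hs, ht]
      simp [TensorProduct.map_add_left]
    · rw [← TensorProduct.smul_tmul', map_smul, map_smul, LinearMap.smul_apply, ht]
      simp [TensorProduct.map_smul_left]
    · refine Eq.trans ?_ (LinearMap.congr_fun (hp a v b m c v' d m' hab) ((H.op hS).dual.comul f))
      have h1 := dualDistrib_dual_comul (A := H.op hS) f (H.gr.proj c v' ⊗ₜ H.gr.proj a v)
      rw [op_mul, flip_proj, map_smul, map_smul] at h1
      rw [tensor_mul_proj, map_smul, LinearMap.smul_apply, evalFst_tmul]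
      simp only [LinearMap.comp_apply, LinearMap.smul_apply, LinearMap.toSpanSingleton_apply,
        LinearMap.applyₗ_apply_apply, LinearEquiv.coe_coe]
      refine congrArg (_ • ·) ?_
      refine Eq.trans ?_ (congrArg (fun r : k => paritySign k (a * c) • r • _) h1.symm)
      rw [smul_smul, smul_eq_mul, ← mul_assoc, paritySign_mul, mul_comm a c,
        CharTwo.add_self_eq_zero, paritySign_zero, one_mul]

end EvalMul

end HopfSuperData

namespace HopfSuperData

open SuperGrading

variable {k : Type*} [Field k]
variable {V W U Y V' W' M N P Q M' N' : Type*} [AddCommGroup V] [Module k V] [AddCommGroup W]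
  [Module k W] [AddCommGroup U] [Module k U] [AddCommGroup Y] [Module k Y]
  [AddCommGroup V'] [Module k V'] [AddCommGroup W'] [Module k W'] [AddCommGroup M] [Module k M]
  [AddCommGroup N] [Module k N] [AddCommGroup P] [Module k P] [AddCommGroup Q] [Module k Q]
  [AddCommGroup M'] [Module k M'] [AddCommGroup N'] [Module k N']
variable {A : HopfSuperData k V} {B : HopfSuperData k W} {C : HopfSuperData k U}
  {D : HopfSuperData k Y} {A' : HopfSuperData k V'} {B' : HopfSuperData k W'}

/-! ### The sides of R Δ = Δ^op R after evaluation. -/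

section Commutation

theorem deg_induction₂ (GA : SuperGrading k V) (GB : SuperGrading k W) (GC : SuperGrading k U)
    (GD : SuperGrading k Y) {p n : ZMod 2} {C : V ⊗[k] W → U ⊗[k] Y → Prop}
    (h0 : ∀ u, C 0 u) (h0' : ∀ t, C t 0)
    (hadd : ∀ s t u, C s u → C t u → C (s + t) u) (hadd' : ∀ t u v, C t u → C t v → C t (u + v))
    (hsmul : ∀ (c : k) t u, C t u → C (c • t) u) (hsmul' : ∀ (c : k) t u, C t u → C t (c • u))
    (h : ∀ i x j y l z m w, i + j = p → l + m = n →
      C (GA.proj i x ⊗ₜ GB.proj j y) (GC.proj l z ⊗ₜ GD.proj m w)) {t : V ⊗[k] W} {u : U ⊗[k] Y}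
    (ht : t ∈ (GA.tensor GB).deg p) (hu : u ∈ (GC.tensor GD).deg n) : C t u :=
  deg_induction GA GB (C := fun t => C t u) (h0 u) (fun _ _ => hadd _ _ u)
    (fun _ _ => hsmul _ _ u) (fun i x j y hij => deg_induction GC GD
      (C := fun u => C (GA.proj i x ⊗ₜ GB.proj j y) u) (h0' _) (hadd' _) (fun _ _ => hsmul' _ _ _)
      (fun l z m w hlm => h i x j y l z m w hij hlm) hu) ht

variable {H : HopfSuperData k V} {N : HopfSuperData k M} {F : V →ₗ[k] M}
  {G : Module.Dual k V →ₗ[k] M} {p n : ZMod 2} {t : V ⊗[k] V}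
  {u : Module.Dual k V ⊗[k] Module.Dual k V}

/-- The four lemmas that follow treat the two sides of the commutation relation for H (`evalFst`)
and for X (`evalSnd`). The `flip` versions give ∑ ± ⟨a', f'⟩ G(f'') F(a''), the `twist` versions ∑ ±
F(a') G(f') ⟨a'', f''⟩, all with the common sign (-1)^(pn). The arguments t and u stand for the
coproducts of a and f. -/
theorem mul_map_evalFst_flip (ht : t ∈ (H.gr.tensor H.gr).deg p)
    (hu : u ∈ (H.gr.dual.tensor H.gr.dual).deg n) :
    N.mul (TensorProduct.map G (evalFst k V M (LinearMap.lTensor V F t))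
      (H.gr.dual.flip H.gr.dual u)) = paritySign k (p * n) •
        TensorProduct.lid k M (TensorProduct.map H.pairing
          (N.mul ∘ₗ TensorProduct.map G F ∘ₗ H.gr.flip H.gr.dual)
            (midMap (H.gr.flip H.gr.dual) (t ⊗ₜ u))) := by
  refine deg_induction₂ H.gr H.gr H.gr.dual H.gr.dual (C := fun t u =>
    N.mul (TensorProduct.map G (evalFst k V M (LinearMap.lTensor V F t))
      (H.gr.dual.flip H.gr.dual u)) = paritySign k (p * n) •
        TensorProduct.lid k M (TensorProduct.map H.pairing
          (N.mul ∘ₗ TensorProduct.map G F ∘ₗ H.gr.flip H.gr.dual)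
            (midMap (H.gr.flip H.gr.dual) (t ⊗ₜ u)))) ?_ ?_ ?_ ?_ ?_ ?_ ?_ ht hu
  · simp
  · simp
  · intro s t u hs ht
    simp only [map_add, TensorProduct.map_add_right, LinearMap.add_apply, TensorProduct.add_tmul,
      smul_add, hs, ht]
  · intro s t u hs ht
    simp only [map_add, TensorProduct.tmul_add, smul_add, hs, ht]
  · intro c t u ht
    simp only [map_smul, TensorProduct.map_smul_right, LinearMap.smul_apply,
      ← TensorProduct.smul_tmul', ht, smul_comm c]
  · intro c t u ht
    simp only [map_smul, TensorProduct.tmul_smul, ht, smul_comm c]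
  · intro i x j y l g m h hp hn
    subst hp hn
    simp only [LinearMap.comp_apply, flip_proj, midMap_tmul, map_smul, insertMid_tmul,
      TensorProduct.map_tmul, TensorProduct.lid_tmul, pairing_proj_proj, LinearMap.lTensor_tmul,
      evalFst_tmul, dual_proj_proj, TensorProduct.tmul_smul, smul_smul]
    by_cases h1 : l = i
    · subst h1
      congr 1
      rw [if_pos rfl, if_pos rfl]
      have e : paritySign k (l * m) = paritySign k ((l + j) * (l + m)) * paritySign k (j * l) *
          paritySign k (j * m) * paritySign k l := by
        rw [paritySign_mul, paritySign_mul, paritySign_mul]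
        congr 1
        clear ht hu
        revert l j m
        decide
      linear_combination (g (H.gr.proj l x)) * e
    · simp [h1]

theorem mul_map_evalSnd_flip (ht : t ∈ (H.gr.tensor H.gr).deg p)
    (hu : u ∈ (H.gr.dual.tensor H.gr.dual).deg n) :
    N.mul (TensorProduct.map (evalSnd k V M (LinearMap.rTensor _ G (H.gr.dual.flip H.gr.dual u)))
      F t) = paritySign k (p * n) •
        TensorProduct.lid k M (TensorProduct.map H.pairing
          (N.mul ∘ₗ TensorProduct.map G F ∘ₗ H.gr.flip H.gr.dual)
            (midMap (H.gr.flip H.gr.dual) (t ⊗ₜ u))) := by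
  refine deg_induction₂ H.gr H.gr H.gr.dual H.gr.dual (C := fun t u =>
    N.mul (TensorProduct.map (evalSnd k V M (LinearMap.rTensor _ G (H.gr.dual.flip H.gr.dual u)))
      F t) = paritySign k (p * n) •
        TensorProduct.lid k M (TensorProduct.map H.pairing
          (N.mul ∘ₗ TensorProduct.map G F ∘ₗ H.gr.flip H.gr.dual)
            (midMap (H.gr.flip H.gr.dual) (t ⊗ₜ u)))) ?_ ?_ ?_ ?_ ?_ ?_ ?_ ht hu
  · simp
  · simp
  · intro s t u hs ht
    simp only [map_add, TensorProduct.add_tmul, smul_add, hs, ht]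
  · intro s t u hs ht
    simp only [map_add, TensorProduct.map_add_left, LinearMap.add_apply, TensorProduct.tmul_add,
      smul_add, hs, ht]
  · intro c t u ht
    simp only [map_smul, ← TensorProduct.smul_tmul', ht, smul_comm c]
  · intro c t u ht
    simp only [map_smul, TensorProduct.map_smul_left, LinearMap.smul_apply,
      TensorProduct.tmul_smul, ht, smul_comm c]
  · intro i x j y l g m h hp hn
    subst hp hn
    simp only [LinearMap.comp_apply, flip_proj, midMap_tmul, map_smul, insertMid_tmul,
      TensorProduct.map_tmul, TensorProduct.lid_tmul, pairing_proj_proj, LinearMap.rTensor_tmul,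
      LinearMap.smul_apply, TensorProduct.map_smul_left,
      evalSnd_tmul, dual_proj_proj, ← TensorProduct.smul_tmul', smul_smul]
    by_cases h1 : l = i
    · subst h1
      congr 1
      rw [if_pos rfl, if_pos rfl]
      have e : paritySign k (l * m) = paritySign k ((l + j) * (l + m)) * paritySign k (j * l) *
          paritySign k (j * m) * paritySign k l := by
        rw [paritySign_mul, paritySign_mul, paritySign_mul]
        congr 1
        clear ht hu
        revert l j m
        decide
      linear_combination (g (H.gr.proj l x)) * e
    · simp [h1]

theorem mul_map_evalFst_twist (ht : t ∈ (H.gr.tensor H.gr).deg p)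
    (hu : u ∈ (H.gr.dual.tensor H.gr.dual).deg n) :
    N.mul (TensorProduct.map (evalFst k V M (LinearMap.lTensor V F (H.gr.flip H.gr t))) G
      (H.gr.dual.flip H.gr.dual (LinearMap.rTensor _ (H.gr.dual.twist p) u))) =
        paritySign k (p * n) •
        TensorProduct.rid k M (TensorProduct.map (N.mul ∘ₗ TensorProduct.map F G) H.pairing
            (midMap (H.gr.flip H.gr.dual) (t ⊗ₜ u))) := by
  refine deg_induction₂ H.gr H.gr H.gr.dual H.gr.dual (C := fun t u =>
    N.mul (TensorProduct.map (evalFst k V M (LinearMap.lTensor V F (H.gr.flip H.gr t))) G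
      (H.gr.dual.flip H.gr.dual (LinearMap.rTensor _ (H.gr.dual.twist p) u))) =
        paritySign k (p * n) •
        TensorProduct.rid k M (TensorProduct.map (N.mul ∘ₗ TensorProduct.map F G) H.pairing
            (midMap (H.gr.flip H.gr.dual) (t ⊗ₜ u)))) ?_ ?_ ?_ ?_ ?_ ?_ ?_ ht hu
  · simp
  · simp
  · intro s t u hs ht
    simp only [map_add, TensorProduct.map_add_left, LinearMap.add_apply, TensorProduct.add_tmul,
      smul_add, hs, ht]
  · intro s t u hs ht
    simp only [map_add, TensorProduct.tmul_add, smul_add, hs, ht]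
  · intro c t u ht
    simp only [map_smul, TensorProduct.map_smul_left, LinearMap.smul_apply,
      ← TensorProduct.smul_tmul', ht, smul_comm c]
  · intro c t u ht
    simp only [map_smul, TensorProduct.tmul_smul, ht, smul_comm c]
  · intro i x j y l g m h hp hn
    subst hp hn
    simp only [LinearMap.comp_apply, flip_proj, midMap_tmul, map_smul, insertMid_tmul,
      TensorProduct.map_tmul, TensorProduct.rid_tmul, pairing_proj_proj, LinearMap.lTensor_tmul,
      LinearMap.rTensor_tmul, twist_proj, LinearMap.smul_apply, TensorProduct.map_smul_left,
      evalFst_tmul, dual_proj_proj, ← TensorProduct.smul_tmul', smul_smul]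
    by_cases h1 : m = j
    · subst h1
      congr 1
      rw [if_pos rfl, if_pos rfl]
      have e : paritySign k ((i + m) * l) * paritySign k (l * m) * paritySign k (i * m) =
          paritySign k ((i + m) * (l + m)) * paritySign k (m * l) * paritySign k m := by
        rw [paritySign_mul, paritySign_mul, paritySign_mul, paritySign_mul]
        congr 1
        clear ht hu
        revert i l m
        decide
      linear_combination (h (H.gr.proj m y)) * e
    · simp [h1]

theorem mul_map_evalSnd_twist (ht : t ∈ (H.gr.tensor H.gr).deg p)
    (hu : u ∈ (H.gr.dual.tensor H.gr.dual).deg n) :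
    N.mul (TensorProduct.map (F ∘ₗ H.gr.twist n) (evalSnd k V M (LinearMap.rTensor _ G u)) t) =
        paritySign k (p * n) •
        TensorProduct.rid k M (TensorProduct.map (N.mul ∘ₗ TensorProduct.map F G) H.pairing
            (midMap (H.gr.flip H.gr.dual) (t ⊗ₜ u))) := by
  refine deg_induction₂ H.gr H.gr H.gr.dual H.gr.dual (C := fun t u =>
    N.mul (TensorProduct.map (F ∘ₗ H.gr.twist n) (evalSnd k V M (LinearMap.rTensor _ G u)) t) =
        paritySign k (p * n) •
        TensorProduct.rid k M (TensorProduct.map (N.mul ∘ₗ TensorProduct.map F G) H.pairing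
            (midMap (H.gr.flip H.gr.dual) (t ⊗ₜ u)))) ?_ ?_ ?_ ?_ ?_ ?_ ?_ ht hu
  · simp
  · simp
  · intro s t u hs ht
    simp only [map_add, TensorProduct.add_tmul, smul_add, hs, ht]
  · intro s t u hs ht
    simp only [map_add, TensorProduct.map_add_right, LinearMap.add_apply, TensorProduct.tmul_add,
      smul_add, hs, ht]
  · intro c t u ht
    simp only [map_smul, ← TensorProduct.smul_tmul', ht, smul_comm c]
  · intro c t u ht
    simp only [map_smul, TensorProduct.map_smul_right, LinearMap.smul_apply,
      TensorProduct.tmul_smul, ht, smul_comm c]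
  · intro i x j y l g m h hp hn
    subst hp hn
    simp only [LinearMap.comp_apply, flip_proj, midMap_tmul, map_smul, insertMid_tmul,
      TensorProduct.map_tmul, TensorProduct.rid_tmul, pairing_proj_proj,
      LinearMap.rTensor_tmul, twist_proj, TensorProduct.tmul_smul,
      evalSnd_tmul, dual_proj_proj, ← TensorProduct.smul_tmul', smul_smul]
    by_cases h1 : m = j
    · subst h1
      congr 1
      rw [if_pos rfl, if_pos rfl]
      have e : paritySign k ((l + m) * i) =
          paritySign k ((i + m) * (l + m)) * paritySign k (m * l) * paritySign k m := by
        rw [paritySign_mul, paritySign_mul]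
        congr 1
        clear ht hu
        revert i l m
        decide
      linear_combination (h (H.gr.proj m y)) * e
    · simp [h1]

end Commutation

/-! ### Commutation of the canonical element with coproducts. -/

section Canonical

variable {H : HopfSuperData k V} {N : HopfSuperData k M} {F : V →ₗ[k] M}
  {G : Module.Dual k V →ₗ[k] M} [FiniteDimensional k V] (hH : H.IsHopfSuperalgebra)
  (hS : Function.Bijective H.antipode) (hF : IsEven H.gr N.gr F) (hG : IsEven H.gr.dual N.gr G)
  {c : V ⊗[k] Module.Dual k V} (hc : evalFst k V _ c = LinearMap.id)
  (hc' : evalSnd k V _ c = LinearMap.id)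
  (h : (H.tensor (H.op hS).dual).lact H.pairing
      (N.mul ∘ₗ TensorProduct.map G F ∘ₗ H.gr.flip H.gr.dual) =
    (H.tensor (H.op hS).dual).ract (N.mul ∘ₗ TensorProduct.map F G) H.pairing)

include hc in
omit [FiniteDimensional k V] in
theorem evalFst_lTensor_canonical : evalFst k V M (LinearMap.lTensor V G c) = G := by
  ext f
  rw [evalFst_lTensor, hc, LinearMap.id_apply]

include hc' in
omit [FiniteDimensional k V] in
theorem evalSnd_rTensor_canonical : evalSnd k V M (LinearMap.rTensor _ F c) = F := by
  ext x
  rw [evalSnd_rTensor, hc', LinearMap.id_apply]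

include hH hF hG hc hc' h in
-- Evaluating the first leg on f turns the two sides into the two sides of the exchange relation
-- `h`, multiplied by the same sign. In `canonical_mul_rTensor_comul` the second leg is evaluated on
-- a, and the same relation appears read from right to left.
theorem canonical_mul_lTensor_comul (a : V) :
    (H.tensor N).mul (LinearMap.lTensor V G c ⊗ₜ LinearMap.lTensor V F (H.comul a)) =
      (H.tensor N).mul (LinearMap.lTensor V F (H.gr.flip H.gr (H.comul a)) ⊗ₜ
        LinearMap.lTensor V G c) := by
  have hX := (hH.op hS).dual
  have h1 : (H.tensor N).mul ∘ₗ TensorProduct.mk k _ _ (LinearMap.lTensor V G c) ∘ₗ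
      LinearMap.lTensor V F ∘ₗ H.comul = (H.tensor N).mul ∘ₗ
        (TensorProduct.mk k _ _).flip (LinearMap.lTensor V G c) ∘ₗ LinearMap.lTensor V F ∘ₗ
          H.gr.flip H.gr ∘ₗ H.comul := by
    refine hom_ext H.gr fun p a => evalFst_injective (hom_ext H.gr.dual fun n f => ?_)
    have ha := hH.comul_mem p _ (H.gr.proj_mem p a)
    have hf : (H.op hS).dual.comul (H.gr.dual.proj n f) ∈ (H.gr.dual.tensor H.gr.dual).deg n :=
      hX.comul_mem n _ (H.gr.dual.proj_mem n f)
    have hz : LinearMap.lTensor V G c ∈ (H.gr.tensor N.gr).deg 0 :=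
      hG.lTensor _ _ (mem_deg_zero_of_evalSnd hc')
    have hz' : LinearMap.lTensor V F (H.gr.flip H.gr (H.comul (H.gr.proj p a))) ∈
      (H.gr.tensor N.gr).deg p := hF.lTensor _ _ (IsEven.flip _ _ _ _ ha)
    refine (evalFst_mul hS (LinearMap.lTensor V F (H.comul (H.gr.proj p a))) hz _).trans ?_
    refine Eq.trans ?_ (evalFst_mul hS (LinearMap.lTensor V G c) hz' _).symm
    rw [evalFst_lTensor_canonical hc, twist_zero, LinearMap.rTensor_id, LinearMap.id_apply,
      mul_map_evalFst_flip ha hf, mul_map_evalFst_twist ha hf]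
    exact congrArg _ (LinearMap.congr_fun h (H.gr.proj p a ⊗ₜ H.gr.dual.proj n f))
  exact LinearMap.congr_fun h1 a

include hH hF hG hc' h in
theorem canonical_mul_rTensor_comul (f : Module.Dual k V) :
    (N.tensor (H.op hS).dual).mul (LinearMap.rTensor _ F c ⊗ₜ
        LinearMap.rTensor _ G ((H.op hS).dual.comul f)) =
      (N.tensor (H.op hS).dual).mul (LinearMap.rTensor _ G
        (H.gr.dual.flip H.gr.dual ((H.op hS).dual.comul f)) ⊗ₜ LinearMap.rTensor _ F c) := by
  have hX := (hH.op hS).dual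
  have h1 : (N.tensor (H.op hS).dual).mul ∘ₗ TensorProduct.mk k _ _ (LinearMap.rTensor _ F c) ∘ₗ
      LinearMap.rTensor _ G ∘ₗ (H.op hS).dual.comul = (N.tensor (H.op hS).dual).mul ∘ₗ
        (TensorProduct.mk k _ _).flip (LinearMap.rTensor _ F c) ∘ₗ LinearMap.rTensor _ G ∘ₗ
          H.gr.dual.flip H.gr.dual ∘ₗ (H.op hS).dual.comul := by
    refine hom_ext H.gr.dual fun n f => evalSnd_injective (hom_ext H.gr fun p a => ?_)
    have ha := hH.comul_mem p _ (H.gr.proj_mem p a)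
    have hf : (H.op hS).dual.comul (H.gr.dual.proj n f) ∈ (H.gr.dual.tensor H.gr.dual).deg n :=
      hX.comul_mem n _ (H.gr.dual.proj_mem n f)
    have hz : LinearMap.rTensor _ F c ∈ (N.gr.tensor H.gr.dual).deg 0 :=
      hF.rTensor _ _ (mem_deg_zero_of_evalSnd hc')
    have hz' : LinearMap.rTensor _ G ((H.op hS).dual.comul (H.gr.dual.proj n f)) ∈
      (N.gr.tensor H.gr.dual).deg n := hG.rTensor _ _ hf
    refine (evalSnd_mul hS (LinearMap.rTensor _ F c) hz' _).trans ?_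
    refine Eq.trans ?_ (evalSnd_mul hS (LinearMap.rTensor _ G (H.gr.dual.flip H.gr.dual
      ((H.op hS).dual.comul (H.gr.dual.proj n f)))) hz _).symm
    rw [evalSnd_rTensor_canonical hc', twist_zero, LinearMap.comp_id]
    refine (mul_map_evalSnd_twist ha hf).trans
      (Eq.trans ?_ (mul_map_evalSnd_flip ha hf).symm)
    exact congrArg _ (LinearMap.congr_fun h (H.gr.proj p a ⊗ₜ H.gr.dual.proj n f)).symm
  exact LinearMap.congr_fun h1 f

end Canonical

end HopfSuperData

namespace HopfSuperData

open SuperGrading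

variable {k : Type*} [Field k]
variable {V W U Y V' W' M N P Q M' N' : Type*} [AddCommGroup V] [Module k V] [AddCommGroup W]
  [Module k W] [AddCommGroup U] [Module k U] [AddCommGroup Y] [Module k Y]
  [AddCommGroup V'] [Module k V'] [AddCommGroup W'] [Module k W'] [AddCommGroup M] [Module k M]
  [AddCommGroup N] [Module k N] [AddCommGroup P] [Module k P] [AddCommGroup Q] [Module k Q]
  [AddCommGroup M'] [Module k M'] [AddCommGroup N'] [Module k N']
variable {A : HopfSuperData k V} {B : HopfSuperData k W} {C : HopfSuperData k U}
  {D : HopfSuperData k Y} {A' : HopfSuperData k V'} {B' : HopfSuperData k W'}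

/-! ### Tensor products, flips and associators of superalgebra morphisms. -/

section AlgHom

theorem IsAlgHom.id : IsAlgHom A A LinearMap.id where
  even := fun _ _ hx => hx
  mul t := by simp
  one := rfl

theorem IsAlgHom.comp {f : V →ₗ[k] W} {g : W →ₗ[k] U} (hg : IsAlgHom B C g)
    (hf : IsAlgHom A B f) : IsAlgHom A C (g ∘ₗ f) where
  even := hg.even.comp hf.even
  mul t := by simp [hf.mul, hg.mul, TensorProduct.map_map]
  one := by simp [hf.one, hg.one]

theorem IsAlgHom.map {f : V →ₗ[k] V'} {g : W →ₗ[k] W'} (hf : IsAlgHom A A' f)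
    (hg : IsAlgHom B B' g) :
    IsAlgHom (A.tensor B) (A'.tensor B') (TensorProduct.map f g) where
  even := hf.even.map hg.even
  mul t := by
    have h : TensorProduct.map f g ∘ₗ TensorProduct.map A.mul B.mul =
        TensorProduct.map A'.mul B'.mul ∘ₗ
          TensorProduct.map (TensorProduct.map f f) (TensorProduct.map g g) := by
      rw [← TensorProduct.map_comp, ← TensorProduct.map_comp, LinearMap.ext hf.mul
        (f := f ∘ₗ A.mul) (g := A'.mul ∘ₗ TensorProduct.map f f), LinearMap.ext hg.mul
        (f := g ∘ₗ B.mul) (g := B'.mul ∘ₗ TensorProduct.map g g)]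
    exact (LinearMap.congr_fun h _).trans
      (congrArg _ (midMap_flip_map hg.even hf.even f g t).symm)
  one := by simp [tensor_one, hf.one, hg.one]

theorem IsAlgHom.flip (hA : A.IsSuperalgebra) (hB : B.IsSuperalgebra) :
    IsAlgHom (A.tensor B) (B.tensor A) (A.gr.flip B.gr) where
  even := IsEven.flip _ _
  mul t := by
    have h1 : (TensorProduct.map B.mul A.mul ∘ₗ (A.gr.tensor A.gr).flip (B.gr.tensor B.gr)) ∘ₗ
        midMap (B.gr.flip A.gr) = (B.tensor A).mul ∘ₗ
          TensorProduct.map (A.gr.flip B.gr) (A.gr.flip B.gr) := by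
      refine hom_ext₄ A.gr B.gr A.gr B.gr fun i x j y l z m w => ?_
      simp only [LinearMap.comp_apply, TensorProduct.map_tmul, HopfSuperData.tensor, midMap_tmul,
        flip_tensor_tensor, map_smul, insertMid_tmul, TensorProduct.tmul_smul,
        ← TensorProduct.smul_tmul', smul_smul, flip_proj]
      rw [paritySign_mul, paritySign_mul, paritySign_mul]
      congr 2
      revert i j l m
      decide
    rw [← flip_comp_map hA.mul_even hB.mul_even] at h1
    exact LinearMap.congr_fun h1 t
  one := by
    have := flip_proj A.gr B.gr 0 0 A.one B.one
    simpa [hA.proj_one, hB.proj_one, tensor_one] using this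

theorem IsAlgHom.assoc_symm : IsAlgHom (A.tensor (B.tensor C)) ((A.tensor B).tensor C)
    (TensorProduct.assoc k V W U).symm.toLinearMap where
  even := IsEven.assoc_symm
  mul t := by
    have h1 : (TensorProduct.assoc k V W U).symm.toLinearMap ∘ₗ (A.tensor (B.tensor C)).mul =
        ((A.tensor B).tensor C).mul ∘ₗ TensorProduct.map
          (TensorProduct.assoc k V W U).symm.toLinearMap
          (TensorProduct.assoc k V W U).symm.toLinearMap := by
      refine TensorProduct.ext (hom_ext₃' A.gr B.gr C.gr fun i x j y l z =>
        hom_ext₃' A.gr B.gr C.gr fun i' x' j' y' l' z' => ?_)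
      simp only [LinearMap.compr₂ₛₗ_apply, LinearMap.comp_apply, TensorProduct.mk_apply,
        LinearEquiv.coe_coe, TensorProduct.map_tmul, TensorProduct.assoc_symm_tmul,
        HopfSuperData.tensor, midMap_tmul, flip_tensor_left, flip_tensor_right, map_smul,
        insertMid_tmul, TensorProduct.tmul_smul, ← TensorProduct.smul_tmul', smul_smul, flip_proj]
      rw [paritySign_mul, paritySign_mul]
      congr 2
      ring
    exact LinearMap.congr_fun h1 t
  one := rfl

end AlgHom

/-! ### Products of images of the canonical element. -/

section Push

variable {H : HopfSuperData k V} {N : HopfSuperData k M} {E : HopfSuperData k Q}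
  [FiniteDimensional k V]
  (hS : Function.Bijective H.antipode)
  {c : V ⊗[k] Module.Dual k V} (hc : evalFst k V _ c = LinearMap.id)
  (hc' : evalSnd k V _ c = LinearMap.id)

include hc' in
-- Evaluating the dual leg replaces c by the maps F₁ and F₂ themselves and the product by their
-- convolution, which is again represented by an image of c. Applying the algebra morphism L to the
-- second leg afterwards keeps the product.
theorem mul_map_canonical_fst {F₁ F₂ : V →ₗ[k] M} (hF : IsEven H.gr N.gr F₂)
    {L : Module.Dual k V →ₗ[k] Q} (hL : IsAlgHom (H.op hS).dual E L) :
    (N.tensor E).mul (TensorProduct.map F₁ L c ⊗ₜ TensorProduct.map F₂ L c) =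
      TensorProduct.map (H.conv N.mul F₁ F₂) L c := by
  have h1 : (N.tensor (H.op hS).dual).mul (LinearMap.rTensor _ F₁ c ⊗ₜ LinearMap.rTensor _ F₂ c) =
      LinearMap.rTensor _ (H.conv N.mul F₁ F₂) c := by
    refine evalSnd_injective (LinearMap.ext fun x => ?_)
    rw [evalSnd_mul hS (p := 0) _ (hF.rTensor _ _ (mem_deg_zero_of_evalSnd hc')),
      evalSnd_rTensor_canonical hc', evalSnd_rTensor_canonical hc', evalSnd_rTensor_canonical hc',
      twist_zero, LinearMap.comp_id]
  have h2 := (IsAlgHom.id.map hL).mul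
    (LinearMap.rTensor _ F₁ c ⊗ₜ[k] LinearMap.rTensor _ F₂ c) (A := N.tensor (H.op hS).dual)
  rw [h1] at h2
  simp only [LinearMap.rTensor, TensorProduct.map_tmul, TensorProduct.map_map, LinearMap.comp_id,
    LinearMap.id_comp] at h2
  exact h2.symm

include hS hc hc' in
-- The same with the roles of the legs exchanged. The flip of the coproduct of X remains, which is
-- why R₁₃ R₁₂ occurs in (id ⊗ Δ)(R) and not R₁₂ R₁₃.
theorem mul_map_canonical_snd {G₁ G₂ : Module.Dual k V →ₗ[k] M} (hG : IsEven H.gr.dual N.gr G₁)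
    {L : V →ₗ[k] Q} (hL : IsAlgHom H E L) :
    (E.tensor N).mul (TensorProduct.map L G₁ c ⊗ₜ TensorProduct.map L G₂ c) =
      TensorProduct.map L (N.mul ∘ₗ TensorProduct.map G₁ G₂ ∘ₗ H.gr.dual.flip H.gr.dual ∘ₗ
        (H.op hS).dual.comul) c := by
  have h1 : (H.tensor N).mul (LinearMap.lTensor _ G₁ c ⊗ₜ LinearMap.lTensor _ G₂ c) =
      LinearMap.lTensor _ (N.mul ∘ₗ TensorProduct.map G₁ G₂ ∘ₗ H.gr.dual.flip H.gr.dual ∘ₗ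
        (H.op hS).dual.comul) c := by
    refine evalFst_injective (LinearMap.ext fun x => ?_)
    rw [evalFst_mul hS (p := 0) _ (hG.lTensor _ _ (mem_deg_zero_of_evalSnd hc')),
      evalFst_lTensor_canonical hc, evalFst_lTensor_canonical hc, evalFst_lTensor_canonical hc,
      twist_zero, LinearMap.rTensor_id]
    rfl
  have h2 := (hL.map IsAlgHom.id).mul
    (LinearMap.lTensor _ G₁ c ⊗ₜ[k] LinearMap.lTensor _ G₂ c) (A := H.tensor N)
  rw [h1] at h2
  simp only [LinearMap.lTensor, TensorProduct.map_tmul, TensorProduct.map_map, LinearMap.comp_id,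
    LinearMap.id_comp] at h2
  exact h2.symm

include hS hc' in
theorem map_convOne_canonical {L : Module.Dual k V →ₗ[k] Q} (hL : IsAlgHom (H.op hS).dual E L) :
    TensorProduct.map (H.convOne N) L c = (N.tensor E).one := by
  have h1 : LinearMap.rTensor _ (H.convOne N) c = N.one ⊗ₜ H.counit := by
    refine evalSnd_injective (LinearMap.ext fun x => ?_)
    rw [evalSnd_rTensor_canonical hc', evalSnd_tmul]
    rfl
  have h2 := congrArg (LinearMap.lTensor M L) h1
  rw [LinearMap.lTensor_tmul, LinearMap.rTensor, LinearMap.lTensor, TensorProduct.map_map,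
    LinearMap.comp_id, LinearMap.id_comp] at h2
  exact h2.trans (congrArg (N.one ⊗ₜ[k] ·) hL.one)

end Push

end HopfSuperData

namespace HopfSuperData

open SuperGrading

variable {k : Type*} [Field k]
variable {V W U Y V' W' M N P Q M' N' : Type*} [AddCommGroup V] [Module k V] [AddCommGroup W]
  [Module k W] [AddCommGroup U] [Module k U] [AddCommGroup Y] [Module k Y]
  [AddCommGroup V'] [Module k V'] [AddCommGroup W'] [Module k W'] [AddCommGroup M] [Module k M]
  [AddCommGroup N] [Module k N] [AddCommGroup P] [Module k P] [AddCommGroup Q] [Module k Q]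
  [AddCommGroup M'] [Module k M'] [AddCommGroup N'] [Module k N']
variable {A : HopfSuperData k V} {B : HopfSuperData k W} {C : HopfSuperData k U}
  {D : HopfSuperData k Y} {A' : HopfSuperData k V'} {B' : HopfSuperData k W'}

/-! ### The R-matrix attached to a pair of morphisms from H and X. -/

section Braiding

variable {H : HopfSuperData k V} {D : HopfSuperData k M} [FiniteDimensional k V]
  (hH : H.IsHopfSuperalgebra) (hS : Function.Bijective H.antipode) (hD : D.IsSuperbialgebra)
  {F : V →ₗ[k] M} {G : Module.Dual k V →ₗ[k] M}
  (hF : IsAlgHom H D F) (hF' : IsCoalgHom H D F)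
  (hG : IsAlgHom (H.op hS).dual D G) (hG' : IsCoalgHom (H.op hS).dual D G)
  (hGF : Function.Surjective (D.mul ∘ₗ TensorProduct.map G F))
  (h : (H.tensor (H.op hS).dual).lact H.pairing
      (D.mul ∘ₗ TensorProduct.map G F ∘ₗ H.gr.flip H.gr.dual) =
    (H.tensor (H.op hS).dual).ract (D.mul ∘ₗ TensorProduct.map F G) H.pairing)
  {c : V ⊗[k] Module.Dual k V} (hc : evalFst k V _ c = LinearMap.id)
  (hc' : evalSnd k V _ c = LinearMap.id)

include hH hF hG hc' in
-- F and F ∘ S are convolution inverse because F is an algebra morphism, so R⁻¹ arises from R by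
-- applying S in the first leg before F.
theorem mul_map_canonical_antipode :
    (D.tensor D).mul (TensorProduct.map F G c ⊗ₜ TensorProduct.map (F ∘ₗ H.antipode) G c) =
      (D.tensor D).one := by
  rw [mul_map_canonical_fst hS hc' (hF.even.comp hH.antipode_even) hG,
    hH.conv_comp_antipode hF, map_convOne_canonical hS hc' hG]

include hH hF hG hc' in
theorem mul_map_antipode_canonical :
    (D.tensor D).mul (TensorProduct.map (F ∘ₗ H.antipode) G c ⊗ₜ TensorProduct.map F G c) =
      (D.tensor D).one := by
  rw [mul_map_canonical_fst hS hc' hF.even hG, hH.comp_antipode_conv hF,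
    map_convOne_canonical hS hc' hG]

include hS hD hF hF' hG hc' in
-- R₁₃ and R₂₃ are images of c with the value of F placed in the first or the second factor. The
-- convolution of these two placements is Δ ∘ F, since ∑ (y' ⊗ 1)(1 ⊗ y'') = Δ(y) and F is a
-- coalgebra morphism.
theorem comul_map_canonical_left : LinearMap.rTensor M D.comul (TensorProduct.map F G c) =
    ((D.tensor D).tensor D).mul (D.leg13 (TensorProduct.map F G c) ⊗ₜ
      D.leg23 (TensorProduct.map F G c)) := by
  have h13 : D.leg13 (TensorProduct.map F G c) =
      TensorProduct.map ((TensorProduct.mk k M M).flip D.one ∘ₗ F) G c := by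
    rw [leg13, LinearMap.rTensor, TensorProduct.map_map, LinearMap.id_comp]
  have h23 : D.leg23 (TensorProduct.map F G c) =
      TensorProduct.map (TensorProduct.mk k M M D.one ∘ₗ F) G c := by
    have : (TensorProduct.assoc k M M M).symm.toLinearMap ∘ₗ TensorProduct.mk k M _ D.one ∘ₗ
        TensorProduct.map F G = TensorProduct.map (TensorProduct.mk k M M D.one ∘ₗ F) G := by
      ext x y
      simp
    exact LinearMap.congr_fun this c
  have hcomul : (D.tensor D).mul ∘ₗ TensorProduct.map ((TensorProduct.mk k M M).flip D.one)
      (TensorProduct.mk k M M D.one) = LinearMap.id := by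
    ext x y
    exact mul_inl_inr hD.toIsSuperalgebra hD.toIsSuperalgebra x y
  have hconv : H.conv (D.tensor D).mul ((TensorProduct.mk k M M).flip D.one ∘ₗ F)
      (TensorProduct.mk k M M D.one ∘ₗ F) = D.comul ∘ₗ F := by
    ext x
    have := LinearMap.congr_fun hcomul (D.comul (F x))
    simpa [conv, hF'.comul, TensorProduct.map_comp] using this
  rw [h13, h23, mul_map_canonical_fst hS hc'
    ((isAlgHom_inr hD.toIsSuperalgebra).even.comp hF.even) hG, hconv, LinearMap.rTensor,
    TensorProduct.map_map, LinearMap.id_comp]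

include hS hD hF hG hG' hc hc' in
-- Here the placements are multiplied in the order (1 ⊗ y)(x ⊗ 1), which is a flip up to sign; it
-- cancels the flip of the coproduct of X in `mul_map_canonical_snd`.
theorem comul_map_canonical_right :
    (TensorProduct.assoc k M M M).symm
      (LinearMap.lTensor M D.comul (TensorProduct.map F G c)) =
    ((D.tensor D).tensor D).mul (D.leg13 (TensorProduct.map F G c) ⊗ₜ
      D.leg12 (TensorProduct.map F G c)) := by
  have hD' := hD.toIsSuperalgebra
  have h13 : D.leg13 (TensorProduct.map F G c) = (TensorProduct.assoc k M M M).symm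
      (TensorProduct.map F (TensorProduct.mk k M M D.one ∘ₗ G) c) := by
    have : LinearMap.rTensor M ((TensorProduct.mk k M M).flip D.one) ∘ₗ TensorProduct.map F G =
        (TensorProduct.assoc k M M M).symm.toLinearMap ∘ₗ
          TensorProduct.map F (TensorProduct.mk k M M D.one ∘ₗ G) := by
      ext x y
      simp
    exact LinearMap.congr_fun this c
  have h12 : D.leg12 (TensorProduct.map F G c) = (TensorProduct.assoc k M M M).symm
      (TensorProduct.map F ((TensorProduct.mk k M M).flip D.one ∘ₗ G) c) := by
    have : (TensorProduct.mk k (M ⊗[k] M) M).flip D.one ∘ₗ TensorProduct.map F G =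
        (TensorProduct.assoc k M M M).symm.toLinearMap ∘ₗ
          TensorProduct.map F ((TensorProduct.mk k M M).flip D.one ∘ₗ G) := by
      ext x y
      simp
    exact LinearMap.congr_fun this c
  have hconv : (D.tensor D).mul ∘ₗ TensorProduct.map (TensorProduct.mk k M M D.one ∘ₗ G)
      ((TensorProduct.mk k M M).flip D.one ∘ₗ G) ∘ₗ H.gr.dual.flip H.gr.dual ∘ₗ
        (H.op hS).dual.comul = D.comul ∘ₗ G := by
    ext f
    have h1 := mul_inr_inl hD' hD' (TensorProduct.map G G (H.gr.dual.flip H.gr.dual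
      ((H.op hS).dual.comul f)))
    have h2 := flip_map hG.even hG.even
      (H.gr.dual.flip H.gr.dual ((H.op hS).dual.comul f))
    rw [TensorProduct.map_map] at h1
    refine h1.trans (h2.trans ?_)
    refine Eq.trans ?_ (hG'.comul f).symm
    exact congrArg _ (flip_flip _ _ _)
  have hmul := mul_map_canonical_snd hS hc hc'
    (N := D.tensor D) (G₂ := (TensorProduct.mk k M M).flip D.one ∘ₗ G)
    ((isAlgHom_inr hD').even.comp hG.even) hF
  have hassoc := (IsAlgHom.assoc_symm (A := D) (B := D) (C := D)).mul
    (TensorProduct.map F (TensorProduct.mk k M M D.one ∘ₗ G) c ⊗ₜ[k]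
      TensorProduct.map F ((TensorProduct.mk k M M).flip D.one ∘ₗ G) c)
  rw [hconv] at hmul
  rw [h13, h12, LinearMap.lTensor, TensorProduct.map_map, LinearMap.id_comp, ← hmul]
  exact hassoc

include hH hF hF' hG hc hc' h in
theorem map_canonical_mul_comul_left (a : V) :
    (D.tensor D).mul (TensorProduct.map F G c ⊗ₜ D.comul (F a)) =
      (D.tensor D).mul (D.comulOp (F a) ⊗ₜ TensorProduct.map F G c) := by
  have h1 := (hF.map (IsAlgHom.id (A := D))).mul
  have h2 := canonical_mul_lTensor_comul hH hS hF.even hG.even hc hc' h a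
  have h3 := congrArg (TensorProduct.map F (LinearMap.id (M := M))) h2
  rw [h1, h1] at h3
  have h4 : D.comulOp (F a) = TensorProduct.map F F (H.gr.flip H.gr (H.comul a)) := by
    rw [comulOp, LinearMap.comp_apply, hF'.comul, flip_map hF.even hF.even]
  rw [h4, hF'.comul]
  simpa only [LinearMap.lTensor, TensorProduct.map_tmul, TensorProduct.map_map, LinearMap.comp_id,
    LinearMap.id_comp] using h3

include hH hF hG hG' hc' h in
theorem map_canonical_mul_comul_right (f : Module.Dual k V) :
    (D.tensor D).mul (TensorProduct.map F G c ⊗ₜ D.comul (G f)) =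
      (D.tensor D).mul (D.comulOp (G f) ⊗ₜ TensorProduct.map F G c) := by
  have h1 := ((IsAlgHom.id (A := D)).map hG).mul
  have h2 := canonical_mul_rTensor_comul hH hS hF.even hG.even hc' h f
  have h3 := congrArg (TensorProduct.map (LinearMap.id (M := M)) G) h2
  rw [h1, h1] at h3
  have h4 : D.comulOp (G f) = TensorProduct.map G G
      (H.gr.dual.flip H.gr.dual ((H.op hS).dual.comul f)) := by
    rw [comulOp, LinearMap.comp_apply, hG'.comul, flip_map hG.even hG.even]
    rfl
  rw [h4, hG'.comul]
  simpa only [LinearMap.rTensor, TensorProduct.map_tmul, TensorProduct.map_map, LinearMap.comp_id,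
    LinearMap.id_comp] using h3

theorem IsSuperbialgebra.isAlgHom_comulOp {D : HopfSuperData k M} (hD : D.IsSuperbialgebra) :
    IsAlgHom D (D.tensor D) D.comulOp :=
  (IsAlgHom.flip hD.toIsSuperalgebra hD.toIsSuperalgebra).comp hD.isAlgHom_comul

/-- The elements `x` with `R Δ(x) = Δ^op(x) R` are closed under products. -/
theorem mul_comul_mul {D : HopfSuperData k M} (hD : D.IsSuperbialgebra) {R : M ⊗[k] M} {x y : M}
    (hx : (D.tensor D).mul (R ⊗ₜ D.comul x) = (D.tensor D).mul (D.comulOp x ⊗ₜ R))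
    (hy : (D.tensor D).mul (R ⊗ₜ D.comul y) = (D.tensor D).mul (D.comulOp y ⊗ₜ R)) :
    (D.tensor D).mul (R ⊗ₜ D.comul (D.mul (x ⊗ₜ y))) =
      (D.tensor D).mul (D.comulOp (D.mul (x ⊗ₜ y)) ⊗ₜ R) := by
  have hT := hD.toIsSuperalgebra.tensor hD.toIsSuperalgebra
  rw [hD.isAlgHom_comul.mul, hD.isAlgHom_comulOp.mul, TensorProduct.map_tmul,
    TensorProduct.map_tmul, ← hT.mul_assoc, hx, hT.mul_assoc, hy, hT.mul_assoc]

include hH hD hF hF' hG hG' hc hc' h hGF in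
-- By `hGF` every element is a sum of products G(f) F(a), and the relation is known for both kinds
-- of factors and closed under products and sums.
theorem map_canonical_mul_comul (x : M) :
    (D.tensor D).mul (TensorProduct.map F G c ⊗ₜ D.comul x) =
      (D.tensor D).mul (D.comulOp x ⊗ₜ TensorProduct.map F G c) := by
  obtain ⟨t, rfl⟩ := hGF x
  induction t with
  | zero => simp
  | add s t hs ht => simp only [map_add, TensorProduct.tmul_add, TensorProduct.add_tmul, hs, ht]
  | tmul f a =>
    exact mul_comul_mul hD (map_canonical_mul_comul_right hH hS hF hG hG' h hc' f)
      (map_canonical_mul_comul_left hH hS hF hF' hG h hc hc' a)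

include hH hD hF hF' hG hG' hc hc' h hGF in
theorem isUniversalRMatrix_map_canonical : D.IsUniversalRMatrix (TensorProduct.map F G c) := by
  have hT := hD.toIsSuperalgebra.tensor hD.toIsSuperalgebra
  refine ⟨hF.even.map hG.even _ _ (mem_deg_zero_of_evalSnd hc'),
    TensorProduct.map (F ∘ₗ H.antipode) G c, mul_map_canonical_antipode hH hS hF hG hc',
    mul_map_antipode_canonical hH hS hF hG hc', fun x => ?_⟩
  rw [map_canonical_mul_comul hH hS hD hF hF' hG hG' hGF h hc hc', hT.mul_assoc,
    mul_map_canonical_antipode hH hS hF hG hc', hT.mul_one]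

end Braiding

end HopfSuperData

namespace HopfSuperData

open SuperGrading

variable {k : Type*} [Field k]
variable {V W U Y V' W' M N P Q M' N' : Type*} [AddCommGroup V] [Module k V] [AddCommGroup W]
  [Module k W] [AddCommGroup U] [Module k U] [AddCommGroup Y] [Module k Y]
  [AddCommGroup V'] [Module k V'] [AddCommGroup W'] [Module k W'] [AddCommGroup M] [Module k M]
  [AddCommGroup N] [Module k N] [AddCommGroup P] [Module k P] [AddCommGroup Q] [Module k Q]
  [AddCommGroup M'] [Module k M'] [AddCommGroup N'] [Module k N']
variable {A : HopfSuperData k V} {B : HopfSuperData k W} {C : HopfSuperData k U}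
  {D : HopfSuperData k Y} {A' : HopfSuperData k V'} {B' : HopfSuperData k W'}

/-! ### The exchange relation in the double, and the conclusion. -/

section Double

variable {φ φ' : V ⊗[k] W →ₗ[k] k} (h : IsSkewPairing A B φ φ')

theorem isCoalgHom_double_inl (hA : A.IsSuperbialgebra) :
    IsCoalgHom B (A.double B φ φ') ((TensorProduct.mk k W V).flip A.one) :=
  ⟨(isCoalgHom_inl hA).even, (isCoalgHom_inl hA).comul, (isCoalgHom_inl hA).counit⟩

theorem isCoalgHom_double_inr (hB : B.IsSuperbialgebra) :
    IsCoalgHom A (A.double B φ φ') (TensorProduct.mk k W V B.one) :=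
  ⟨(isCoalgHom_inr hB).even, (isCoalgHom_inr hB).comul, (isCoalgHom_inr hB).counit⟩

include h in
/-- The exchange relation `∑ ± φ(a', x') x'' a'' = ∑ ± a' x' φ(a'', x'')` in the double. -/
theorem IsSkewPairing.lact_mul_inl_inr (hA : A.IsSuperbialgebra) (hB : B.IsSuperbialgebra) :
    (A.tensor B).lact φ ((A.double B φ φ').mul ∘ₗ
        TensorProduct.map ((TensorProduct.mk k W V).flip A.one) (TensorProduct.mk k W V B.one) ∘ₗ
          A.gr.flip B.gr) =
      (A.tensor B).ract ((A.double B φ φ').mul ∘ₗ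
        TensorProduct.map (TensorProduct.mk k W V B.one) ((TensorProduct.mk k W V).flip A.one))
          φ := by
  have hT := hA.toIsSupercoalgebra.tensor hB.toIsSupercoalgebra
  -- The product of A with B in this order is the exchange map φ * τ * φ'; acting by φ on the right
  -- cancels φ' and leaves φ * τ.
  rw [double_mul_inr_inl hA.toIsSuperalgebra hB.toIsSuperalgebra, exchange, conj, ract_lact hT,
    ract_ract hT, h.inv_mul, ract_counit hT, ← LinearMap.comp_assoc, h.mul_inl_inr hA hB,
    LinearMap.id_comp]

end Double

theorem isBraided_quantumDouble [FiniteDimensional k V] {H : HopfSuperData k V}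
    (hH : H.IsHopfSuperalgebra) (hS : Function.Bijective H.antipode)
    {c : V ⊗[k] Module.Dual k V} (hc : evalFst k V _ c = LinearMap.id)
    (hc' : evalSnd k V _ c = LinearMap.id) :
    (H.quantumDouble hS).IsBraided (TensorProduct.map
      (TensorProduct.mk k (Module.Dual k V) V (H.op hS).dual.one)
      ((TensorProduct.mk k (Module.Dual k V) V).flip H.one) c) := by
  have hD := isHopfSuperalgebra_quantumDouble hH hS
  have hbij := quantumDouble_antipode_bijective hH hS
  have h := isSkewPairing_pairing hH hS
  rw [quantumDouble_eq hH hS] at hD hbij ⊢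
  have hH' := hH.toIsSuperbialgebra
  have hX' := (hH.op hS).dual.toIsSuperbialgebra
  have hF := h.isAlgHom_inr hH' hX'
  have hF' := isCoalgHom_double_inr (A := H) (φ := H.pairing) (φ' := H.pairingInv hS) hX'
  have hG := h.isAlgHom_inl hH' hX'
  have hG' := isCoalgHom_double_inl (B := (H.op hS).dual) (φ := H.pairing)
    (φ' := H.pairingInv hS) hH'
  have hGF : Function.Surjective ((H.double (H.op hS).dual H.pairing (H.pairingInv hS)).mul ∘ₗ
      TensorProduct.map ((TensorProduct.mk k (Module.Dual k V) V).flip H.one)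
        (TensorProduct.mk k (Module.Dual k V) V (H.op hS).dual.one)) := by
    rw [h.mul_inl_inr hH' hX']
    exact Function.surjective_id
  have hrel := h.lact_mul_inl_inr hH' hX'
  exact ⟨hD, hbij,
    isUniversalRMatrix_map_canonical hH hS hD.toIsSuperbialgebra hF hF' hG hG' hGF hrel hc hc',
    comul_map_canonical_left hS hD.toIsSuperbialgebra hF hF' hG hc',
    comul_map_canonical_right hS hD.toIsSuperbialgebra hF hG hG' hc hc'⟩

end HopfSuperData

end

/-- The quantum double of a finite-dimensional Hopf superalgebra `H` with invertible antipode,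
equipped with `R = ∑ᵢ (1 ⊗ eᵢ) ⊗ (eⁱ ⊗ 1)`, is a braided Hopf superalgebra. -/
theorem mainTheorem3 {k : Type*} [Field k] [CharZero k]
    {V : Type*} [AddCommGroup V] [Module k V] [FiniteDimensional k V]
    (H : HopfSuperData k V) (hH : H.IsHopfSuperalgebra)
    (hS : Function.Bijective H.antipode)
    {ι : Type*} [Fintype ι] (e : Module.Basis ι k V) :
    (H.quantumDouble hS).IsBraided
      (∑ i, ((H.op hS).dual.one ⊗ₜ[k] e i) ⊗ₜ[k] (e.coord i ⊗ₜ[k] H.one)) := by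
  have h := HopfSuperData.isBraided_quantumDouble hH hS (HopfSuperData.evalFst_basis e)
    (HopfSuperData.evalSnd_basis e)
  -- The image of ∑ eᵢ ⊗ eⁱ under the two inclusions is, term by term, the stated R.
  rw [map_sum] at h
  exact h
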